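/- **Theorem 1.4.** Let $G=(V,E)$ be an infinite, connected, locally finite graph with graph distance $d(\cdot,\cdot)$ and closed balls $B(x,n)=\{y\in V: d(x,y)\le n\}$. Let $d'\ge d\ge 2$ be real numbers and $C_{\mathrm{reg}},C_{\mathrm{S}_1}\in(0,\infty)$, and suppose that for every $x\in V$ there are real numbers $N_1(x),N_2(x)<\infty$ such that (a) (volume regularity) $C_{\mathrm{reg}}^{-1}n^d\le |B(x,n)|\le C_{\mathrm{reg}}\,n^d$ for all integers $n\ge N_1(x)$, $n \geq 0$; (b) (local Sobolev inequality) for all integers $n\ge N_2(x)$, $n\geq 0$, and all $u:V\to\mathbb R$ vanishing outside $B(x,n)$, $$\Big(\sum_{y\in B(x,n)}|u(y)|^{\frac{d'}{d'-1}}\Big)^{\frac{d'-1}{d'}}\le C_{\mathrm{S}_1}\,n^{1-\frac d{d'}}\sum_{\{y,z\}\in E,\ \{y,z\}\cap B(x,n)\ne\emptyset}|u(y)-u(z)| .$$ Let $\omega=\{\omega(e)\in(0,\infty):e\in E\}$ be conductances, $\omega(x,y)=\omega(\{x,y\})$ if $\{x,y\}\in E$ and $\omega(x,y)=0$ otherwise,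 and set $\mu^\omega(x)=\sum_{y\sim x}\omega(x,y)$, $\nu^\omega(x)=\sum_{y\sim x}1/\omega(x,y)$. Let $Y=(Y_t)_{t\ge0}$ be the constant speed random walk: at a vertex $x$ it waits an exponential time with mean $1$ and then jumps to $y$ with probability $\omega(x,y)/\mu^\omega(x)$. Write $\mathrm P^\omega_x$ for its law started at $x$, and $q^\omega(t,x,y)=\mathrm P^\omega_x[Y_t=y]/\mu^\omega(y)$ for its heat kernel. For finite non-empty $A\subset V$ and $f:V\to\mathbb R$ let $\|f\|_{p,A}=\big(|A|^{-1}\sum_{x\in A}|f(x)|^p\big)^{1/p}$ if $p<\infty$ and $\|f\|_{\infty,A}=\max_A|f|$. Let $$\bar\mu_p(x)=\limsup_{n\to\infty}\|\mu^\omega\|_{p,B(x,n)},\quad \bar\nu_q(x)=\limsup_{n\to\infty}\|\nu^\omega\|_{q,B(x,n)},\quad \bar\mu_p=\sup_{x\in V}\bar\mu_p(x),\quad \bar\nu_q=\sup_{x\in V}\bar\nu_q(x).$$ Assume that $\bar\mu_p<\infty$ and $\bar\nu_q<\infty$ for some $p,q\in(1,\infty]$ with $\frac1p+\frac1q<\frac2{d'}$,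 and for each $x\in V$ let $N(x)$ be a real number such that $\|\mu^\omega\|_{p,B(x,n)}\le2\bar\mu_p(x)$ and $\|\nu^\omega\|_{q,B(x,n)}\le2\bar\nu_q(x)$ for all integers $n\ge N(x)$, $n\geq 0$. Then there are constants $c_1,c_2,c_3,c_4\in(0,\infty)$ such that for all $t$ and $x\in V$ with $\sqrt t\ge N(x)\vee 2\,(N_1(x)\vee N_2(x))$ and all $y\in V$: (i) if $d(x,y)\le c_1t$, then $q^\omega(t,x,y)\le c_2\,t^{-d/2}\exp\!\big(-c_3\,d(x,y)^2/t\big)$; (ii) if $d(x,y)\ge c_1t$, then $q^\omega(t,x,y)\le c_2\,t^{-d/2}\exp\!\big(-c_4\,d(x,y)\,(1\vee\log(d(x,y)/t))\big)$. The constants depend only on $d,d',C_{\mathrm{reg}},C_{\mathrm{S}_1},p,q$ and on upper bounds for $\bar\mu_p$ and $\bar\nu_q$. -/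

import Mathlib

open MeasureTheory ProbabilityTheory Filter
open scoped ENNReal NNReal

noncomputable section

namespace WeightedGraph

variable {V : Type*}

/-! ### Balls, volume regularity, local Sobolev inequality -/

theorem finite_closedBall (G : SimpleGraph V) [G.LocallyFinite] (x : V) (n : ℕ) :
    {y : V | G.edist x y ≤ n}.Finite := by
  classical
  induction n with
  | zero =>
    refine (Set.finite_singleton x).subset fun y hy => ?_
    have h : G.edist x y ≤ 0 := hy
    exact (SimpleGraph.edist_eq_zero_iff.mp (nonpos_iff_eq_zero.mp h)).symm
  | succ k ih =>
    refine (ih.union (ih.biUnion fun z _ => (G.neighborSet z).toFinite)).subset fun y hy => ?_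
    have hy' : G.edist x y ≤ ((k + 1 : ℕ) : ℕ∞) := hy
    obtain ⟨p, hp⟩ := SimpleGraph.exists_walk_of_edist_ne_top
      (ne_top_of_le_ne_top (ENat.natCast_ne_top _) hy')
    rw [← hp, Nat.cast_le] at hy'
    by_cases h0 : p.length ≤ k
    · left
      exact (SimpleGraph.edist_le p).trans (Nat.cast_le.mpr h0)
    · right
      have hnil : ¬ p.Nil := by
        intro h
        have := SimpleGraph.Walk.length_eq_zero_iff.mpr h
        omega
      simp only [Set.mem_iUnion]
      refine ⟨p.penultimate, ?_, p.adj_penultimate hnil⟩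
      have hl : p.dropLast.length ≤ k := by
        have h2 := SimpleGraph.Walk.length_dropLast_add_one hnil
        omega
      exact (SimpleGraph.edist_le p.dropLast).trans (Nat.cast_le.mpr hl)

/-- The closed ball `B(x, n)` of radius `n` around `x` for the graph distance. -/
def ball (G : SimpleGraph V) [G.LocallyFinite] (x : V) (n : ℕ) : Finset V :=
  (finite_closedBall G x n).toFinset

theorem mem_ball (G : SimpleGraph V) [G.LocallyFinite] (hG : G.Connected) (x y : V) (n : ℕ) :
    y ∈ ball G x n ↔ G.dist x y ≤ n := by
  have h := SimpleGraph.Reachable.coe_dist_eq_edist (hG x y)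
  simp [ball, ← h]

/-- Volume regularity of order `d` for large balls, with constant `C`: for all natural numbers
`n ≥ N₁ x`, `C⁻¹ n ^ d ≤ |B(x, n)| ≤ C n ^ d`. -/
def VolumeRegular (G : SimpleGraph V) [G.LocallyFinite] (d C : ℝ) (N₁ : V → ℝ) : Prop :=
  ∀ (x : V) (n : ℕ), N₁ x ≤ n →
    C⁻¹ * (n : ℝ) ^ d ≤ ((ball G x n).card : ℝ) ∧ ((ball G x n).card : ℝ) ≤ C * (n : ℝ) ^ d

open Classical in
/-- The (non-oriented) edges with at least one endpoint in `B(x, n)`. -/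
def edgesMeetingBall (G : SimpleGraph V) [G.LocallyFinite] (x : V) (n : ℕ) : Finset (Sym2 V) :=
  (ball G x n).biUnion fun y => G.incidenceFinset y

/-- `|u(y) - u(z)|` for the non-oriented edge `{y, z}`. -/
def edgeDiff (u : V → ℝ) : Sym2 V → ℝ :=
  Sym2.lift ⟨fun y z => |u y - u z|, fun y z => abs_sub_comm (u y) (u z)⟩

/-- The local Sobolev inequality `(S¹_{d'})` for large balls, with constant `C`. -/
def LocalSobolev (G : SimpleGraph V) [G.LocallyFinite] (d d' C : ℝ) (N₂ : V → ℝ) : Prop :=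
  ∀ (x : V) (n : ℕ), N₂ x ≤ n → ∀ u : V → ℝ, (∀ y, y ∉ ball G x n → u y = 0) →
    (∑ y ∈ ball G x n, |u y| ^ (d' / (d' - 1))) ^ ((d' - 1) / d') ≤
      C * (n : ℝ) ^ (1 - d / d') * ∑ e ∈ edgesMeetingBall G x n, edgeDiff u e

/-! ### Conductances and their averages -/

/-- A family of conductances: a strictly positive weight for every edge. -/
abbrev Conductances (G : SimpleGraph V) : Type _ := G.edgeSet → Set.Ioi (0 : ℝ)

open Classical in
/-- The conductance matrix `ω(x, y)`. -/
def conductance {G : SimpleGraph V} (ω : Conductances G) (x y : V) : ℝ :=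
  if h : G.Adj x y then (ω ⟨s(x, y), h⟩ : ℝ) else 0

theorem conductance_nonneg {G : SimpleGraph V} (ω : Conductances G) (x y : V) : 0 ≤ conductance ω x y := by
  unfold conductance
  split_ifs with h
  · exact le_of_lt (ω ⟨s(x, y), h⟩).2
  · exact le_rfl

/-- `μ^ω(x) = ∑_{y ∼ x} ω(x, y)`. -/
def mu {G : SimpleGraph V} [G.LocallyFinite] (ω : Conductances G) (x : V) : ℝ :=
  ∑ y ∈ G.neighborFinset x, conductance ω x y

/-- `ν^ω(x) = ∑_{y ∼ x} 1 / ω(x, y)`. -/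
def nu {G : SimpleGraph V} [G.LocallyFinite] (ω : Conductances G) (x : V) : ℝ :=
  ∑ y ∈ G.neighborFinset x, 1 / conductance ω x y

/-- The space-averaged `ℓ^p`-norm of `f` on a non-empty finite set `A`, `p ∈ [1, ∞]`. -/
def avgNorm (p : ℝ≥0∞) (A : Finset V) (f : V → ℝ) : ℝ :=
  if p = ∞ then ⨆ x : A, |f x|
  else ((A.card : ℝ)⁻¹ * ∑ x ∈ A, |f x| ^ p.toReal) ^ (1 / p.toReal)

/-- `limsup_{n → ∞} ‖f‖_{p, B(x, n)}`, as an element of `[0, ∞]`. -/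
def limsupAvg (G : SimpleGraph V) [G.LocallyFinite] (p : ℝ≥0∞) (f : V → ℝ) (x : V) : ℝ≥0∞ :=
  limsup (fun n : ℕ => ENNReal.ofReal (avgNorm p (ball G x n) f)) atTop

/-- For all natural numbers `n ≥ N x`, the average `‖f‖_{p, B(x, n)}` is at most twice its
limit superior as `n → ∞`. -/
def AvgControlled (G : SimpleGraph V) [G.LocallyFinite] (p : ℝ≥0∞) (f : V → ℝ) (N : V → ℝ) :
    Prop :=
  ∀ (x : V) (n : ℕ), N x ≤ n →
    ENNReal.ofReal (avgNorm p (ball G x n) f) ≤ 2 * limsupAvg G p f x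

/-! ### The constant speed random walk and its heat kernel -/

section CSRW

variable {G : SimpleGraph V} [G.LocallyFinite]

theorem mu_nonneg (ω : Conductances G) (x : V) : 0 ≤ mu ω x :=
  Finset.sum_nonneg fun y _ => conductance_nonneg ω x y

variable [MeasurableSpace V]

/-- The jump law from `x`: the next position is `y` with probability `ω(x, y) / μ^ω(x)`.
(A vertex without neighbours, which does not occur in infinite connected graphs, is absorbing.) -/
def jumpLaw (ω : Conductances G) (x : V) : Measure V :=
  if mu ω x = 0 then Measure.dirac x
  else ∑ y ∈ G.neighborFinset x, ENNReal.ofReal (conductance ω x y / mu ω x) • Measure.dirac y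

instance (ω : Conductances G) (x : V) : IsProbabilityMeasure (jumpLaw ω x) := by
  unfold jumpLaw
  split_ifs with h
  · infer_instance
  · constructor
    rw [Measure.finsetSum_apply]
    simp only [Measure.smul_apply, measure_univ, smul_eq_mul, mul_one]
    rw [← ENNReal.ofReal_sum_of_nonneg
      fun y _ => div_nonneg (conductance_nonneg ω x y) (mu_nonneg ω x), ← Finset.sum_div]
    change ENNReal.ofReal (mu ω x / mu ω x) = 1
    rw [div_self h, ENNReal.ofReal_one]

variable [DiscreteMeasurableSpace V]

/-- The transition kernel of the `n`-th jump, given the positions up to time `n`. -/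
def jumpKernel (ω : Conductances G) (n : ℕ) : Kernel (Π _ : Finset.Iic n, V) V where
  toFun z := jumpLaw ω (z ⟨n, Finset.mem_Iic.mpr le_rfl⟩)
  measurable' := (Measurable.of_discrete (f := jumpLaw ω)).comp (measurable_pi_apply _)

instance (ω : Conductances G) (n : ℕ) : IsMarkovKernel (jumpKernel ω n) :=
  ⟨fun z => inferInstanceAs (IsProbabilityMeasure (jumpLaw ω (z ⟨n, _⟩)))⟩

/-- The law `P_x^ω` on pairs (sequence of successive positions, sequence of waiting times):
the positions form the Markov chain with jump laws `ω(x, ·) / μ^ω(x)` started at `x`, and the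
waiting times are i.i.d. exponential with mean `1`, independent of the positions. -/
def walkLaw (ω : Conductances G) (x : V) : Measure ((ℕ → V) × (ℕ → ℝ)) :=
  (Kernel.trajMeasure (X := fun _ : ℕ => V) (Measure.dirac x) (jumpKernel ω)).prod
    (Measure.infinitePi fun _ : ℕ => expMeasure 1)

end CSRW

/-- The number of jumps up to time `t`, when the waiting times are `τ 0, τ 1, …`: the number of
jump times `τ 0 + ⋯ + τ k` that are at most `t` (almost surely finitely many). -/
def jumpCount (t : ℝ) (τ : ℕ → ℝ) : ℕ :=
  {k : ℕ | ∑ i ∈ Finset.range (k + 1), τ i ≤ t}.ncard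

/-- The position `Y_t` of the constant speed random walk at time `t`. -/
def walk (t : ℝ) (s : (ℕ → V) × (ℕ → ℝ)) : V :=
  s.1 (jumpCount t s.2)

/-- The heat kernel `q^ω(t, x, y) = P_x^ω[Y_t = y] / μ^ω(y)` of the constant speed random walk. -/
def heatKernel {G : SimpleGraph V} [G.LocallyFinite] [MeasurableSpace V]
    [DiscreteMeasurableSpace V] (ω : Conductances G) (t : ℝ) (x y : V) : ℝ :=
  (walkLaw ω x).real {s | walk t s = y} / mu ω y

end WeightedGraph

end

open WeightedGraph

/-! On a ball the local Sobolev inequality, combined with Hölder's inequality for the moments of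
`μ^ω` and `ν^ω`, becomes a Nash inequality for the walk killed outside the ball; the condition
`1/p + 1/q < 2/d'` is what makes its exponent positive. It yields an on-diagonal bound for the
killed heat kernel at every time, with a loss polynomial in `R ^ 2 / t`. Davies' weighted bound
controls how fast mass crosses an annulus, and iterating it over shrinking annuli and halving times
turns the on-diagonal bound into a Gaussian bound on the mass far from the starting point, which
absorbs the polynomial loss. Kernels killed outside balls of radii `R` and `2R` differ by at most
the supremum of the larger one outside the smaller ball, so the bound survives summation over dyadic
radii. When `d(x, y) ≥ t`, Davies' bound and the polynomial lower bound on `μ^ω` suffice. Finally,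
the killed kernel is the Poisson mixture of the iterates of the killed jump chain, which agrees with
the walk for `n` steps if `R ≥ n`, so a bound uniform along `R → ∞` passes to the walk. -/

noncomputable section

namespace WeightedGraph

section ExponentialSeries

theorem natCast_succ_mul_pow_div_factorial (n : ℕ) (s : ℝ) :
    ((n + 1 : ℕ) : ℝ) * s ^ n / (n + 1).factorial = s ^ n / n.factorial := by
  rw [Nat.factorial_succ, Nat.cast_mul]
  exact mul_div_mul_left _ _ (by positivity)

variable {a : ℕ → ℝ} {C : ℝ}

theorem summable_pow_div_factorial_mul (ha : ∀ n, |a n| ≤ C) (t : ℝ) :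
    Summable fun n : ℕ => t ^ n / n.factorial * a n := by
  refine .of_norm_bounded ((Real.summable_pow_div_factorial |t|).mul_right C) fun n => ?_
  rw [norm_mul, norm_div, norm_pow, Real.norm_eq_abs, Real.norm_natCast, Real.norm_eq_abs]
  gcongr
  exact ha n

theorem hasDerivAt_tsum_pow_div_factorial_mul (ha : ∀ n, |a n| ≤ C) (t : ℝ) :
    HasDerivAt (fun s : ℝ => ∑' n : ℕ, s ^ n / n.factorial * a n)
      (∑' n : ℕ, t ^ n / n.factorial * a (n + 1)) t := by
  set T : ℝ := |t| + 1
  have termwise : HasDerivAt (fun s : ℝ => ∑' n : ℕ, s ^ n / n.factorial * a n)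
      (∑' n : ℕ, (n : ℝ) * t ^ (n - 1) / n.factorial * a n) t := by
    refine hasDerivAt_tsum_of_isPreconnected
      (u := fun n : ℕ => (n : ℝ) * T ^ (n - 1) / n.factorial * C) (t := Metric.ball 0 T) (y₀ := t)
      ?_ Metric.isOpen_ball (convex_ball 0 T).isPreconnected
      (fun n s _ => ((hasDerivAt_pow n s).div_const _).mul_const _) (fun n s hs => ?_) (by simp [T])
      (summable_pow_div_factorial_mul ha t) (by simp [T])
    · rw [← summable_nat_add_iff 1]
      simp only [Nat.add_sub_cancel, natCast_succ_mul_pow_div_factorial]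
      exact (Real.summable_pow_div_factorial T).mul_right C
    · rw [mem_ball_zero_iff, Real.norm_eq_abs] at hs
      have := (abs_nonneg _).trans (ha 0)
      rw [norm_mul, norm_div, norm_mul, norm_pow, Real.norm_natCast, Real.norm_natCast,
        Real.norm_eq_abs, Real.norm_eq_abs]
      gcongr
      exact ha n
  refine termwise.congr_deriv ?_
  have shifted : Summable fun n : ℕ => t ^ n / n.factorial * a (n + 1) :=
    summable_pow_div_factorial_mul (fun n => ha (n + 1)) t
  rw [Summable.tsum_eq_zero_add]
  · simp only [Nat.add_sub_cancel, natCast_succ_mul_pow_div_factorial, Nat.cast_zero, zero_mul,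
      zero_div, zero_add]
  · rw [← summable_nat_add_iff 1]
    simpa only [Nat.add_sub_cancel, natCast_succ_mul_pow_div_factorial] using shifted

end ExponentialSeries

section KilledWalk

variable {V : Type*}

/-- Symmetric non-negative weights `c` together with a positive speed measure `m` dominating the
total weight at each point: the walk jumps from `x` to `y` with probability `c x y / m x`, and is
killed with the remaining probability. -/
structure IsWeight (c : V → V → ℝ) (m : V → ℝ) : Prop where
  symm : ∀ x y, c x y = c y x
  nonneg : ∀ x y, 0 ≤ c x y
  sum_le : ∀ (A : Finset V) x, ∑ y ∈ A, c x y ≤ m x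
  pos : ∀ x, 0 < m x

/-- The generator of the continuous-time walk with jump rate `1` killed outside `A`. -/
def killedGenerator (c : V → V → ℝ) (m : V → ℝ) (A : Finset V) (f : V → ℝ) (z : V) : ℝ :=
  (∑ w ∈ A, c z w * f w) / m z - f z

/-- The Dirichlet energy of `f` for the walk killed outside `A`. -/
def killedEnergy (c : V → V → ℝ) (m : V → ℝ) (A : Finset V) (f : V → ℝ) : ℝ :=
  ∑ z ∈ A, m z * f z ^ 2 - ∑ z ∈ A, ∑ w ∈ A, c z w * (f z * f w)

/-- `u` solves the heat equation on `A` with zero boundary condition outside `A`. -/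
def IsHeatSolution (c : V → V → ℝ) (m : V → ℝ) (A : Finset V) (u : ℝ → V → ℝ) : Prop :=
  ∀ t, ∀ z ∈ A, HasDerivAt (fun s => u s z) (killedGenerator c m A (u t) z) t

open Classical in
/-- The `n`-step transition density, with respect to `m`, from `y` of the discrete-time walk killed
outside `A`. -/
def killedIter (c : V → V → ℝ) (m : V → ℝ) (A : Finset V) (y : V) : ℕ → V → ℝ
  | 0, z => if z = y then (m y)⁻¹ else 0
  | n + 1, z => if z ∈ A then (∑ w ∈ A, c z w * killedIter c m A y n w) / m z else 0

/-- The heat kernel of the continuous-time walk with jump rate `1` killed outside `A`, as a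
mixture of the `killedIter` over the Poisson number of jumps up to time `t`. -/
def killedKernel (c : V → V → ℝ) (m : V → ℝ) (A : Finset V) (y : V) (t : ℝ) (z : V) : ℝ :=
  Real.exp (-t) * ∑' n : ℕ, t ^ n / n.factorial * killedIter c m A y n z

variable {c : V → V → ℝ} {m : V → ℝ} {A : Finset V}

namespace IsWeight

theorem sum_sum_mul_le (h : IsWeight c m) {a : V → V → ℝ} {K : ℝ} (hK : 0 ≤ K)
    (ha : ∀ z w, c z w ≠ 0 → |a z w| ≤ K) (f : V → ℝ) :
    ∑ z ∈ A, ∑ w ∈ A, c z w * (a z w * (f z * f w)) ≤ K * ∑ z ∈ A, m z * f z ^ 2 := by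
  have pointwise (z w : V) :
      c z w * (a z w * (f z * f w)) ≤ K / 2 * (c z w * f z ^ 2) + K / 2 * (c w z * f w ^ 2) := by
    rcases eq_or_ne (c z w) 0 with hc | hc
    · simp [hc, h.symm w z]
    have young : |f z * f w| ≤ (f z ^ 2 + f w ^ 2) / 2 := by
      rw [abs_mul]
      nlinarith [sq_nonneg (|f z| - |f w|), sq_abs (f z), sq_abs (f w)]
    calc c z w * (a z w * (f z * f w))
        ≤ c z w * (K * ((f z ^ 2 + f w ^ 2) / 2)) := by
          refine mul_le_mul_of_nonneg_left ((le_abs_self _).trans ?_) (h.nonneg z w)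
          rw [abs_mul]
          exact mul_le_mul (ha z w hc) young (abs_nonneg _) hK
      _ = _ := by rw [h.symm w z]; ring
  have row : ∑ z ∈ A, ∑ w ∈ A, c z w * f z ^ 2 ≤ ∑ z ∈ A, m z * f z ^ 2 :=
    Finset.sum_le_sum fun z _ => by
      rw [← Finset.sum_mul]
      exact mul_le_mul_of_nonneg_right (h.sum_le A z) (sq_nonneg _)
  calc ∑ z ∈ A, ∑ w ∈ A, c z w * (a z w * (f z * f w))
      ≤ ∑ z ∈ A, ∑ w ∈ A, (K / 2 * (c z w * f z ^ 2) + K / 2 * (c w z * f w ^ 2)) :=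
        Finset.sum_le_sum fun z _ => Finset.sum_le_sum fun w _ => pointwise z w
    _ = K * ∑ z ∈ A, ∑ w ∈ A, c z w * f z ^ 2 := by
        simp_rw [Finset.sum_add_distrib, ← Finset.mul_sum]
        rw [Finset.sum_comm (f := fun z w => c w z * f w ^ 2)]
        ring
    _ ≤ K * ∑ z ∈ A, m z * f z ^ 2 := mul_le_mul_of_nonneg_left row hK

theorem killedEnergy_nonneg (h : IsWeight c m) (f : V → ℝ) : 0 ≤ killedEnergy c m A f := by
  have := h.sum_sum_mul_le (A := A) (a := fun _ _ => 1) zero_le_one (fun _ _ _ => abs_one.le) f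
  simp only [one_mul] at this
  exact sub_nonneg.mpr this

theorem sum_mul_killedGenerator (h : IsWeight c m) (f g : V → ℝ) :
    ∑ z ∈ A, m z * (f z * killedGenerator c m A g z) =
      ∑ z ∈ A, ∑ w ∈ A, c z w * (f z * g w) - ∑ z ∈ A, m z * (f z * g z) := by
  rw [← Finset.sum_sub_distrib]
  refine Finset.sum_congr rfl fun z _ => ?_
  have hz := (h.pos z).ne'
  simp_rw [killedGenerator, mul_left_comm _ (f z), ← Finset.mul_sum]
  field_simp

theorem sum_mul_killedGenerator_self (h : IsWeight c m) (f : V → ℝ) :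
    ∑ z ∈ A, m z * (f z * killedGenerator c m A f z) = -killedEnergy c m A f := by
  rw [h.sum_mul_killedGenerator, killedEnergy, neg_sub]
  simp_rw [pow_two]

theorem sum_mul_killedGenerator_symm (h : IsWeight c m) (f g : V → ℝ) :
    ∑ z ∈ A, m z * (f z * killedGenerator c m A g z) =
      ∑ z ∈ A, m z * (killedGenerator c m A f z * g z) := by
  simp_rw [mul_comm (killedGenerator c m A f _)]
  rw [h.sum_mul_killedGenerator f g, h.sum_mul_killedGenerator g f, Finset.sum_comm]
  simp_rw [mul_comm (g _), h.symm]

end IsWeight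

variable {y : V}

theorem killedIter_nonneg (h : IsWeight c m) (n : ℕ) (z : V) : 0 ≤ killedIter c m A y n z := by
  induction n generalizing z with
  | zero =>
    rw [killedIter]
    split_ifs
    exacts [inv_nonneg.mpr (h.pos y).le, le_rfl]
  | succ n ih =>
    rw [killedIter]
    split_ifs
    exacts [div_nonneg (Finset.sum_nonneg fun w _ => mul_nonneg (h.nonneg _ _) (ih w)) (h.pos z).le,
      le_rfl]

theorem killedIter_of_notMem (hy : y ∈ A) (n : ℕ) {z : V} (hz : z ∉ A) :
    killedIter c m A y n z = 0 := by
  cases n with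
  | zero => rw [killedIter, if_neg (ne_of_mem_of_not_mem hy hz).symm]
  | succ n => rw [killedIter, if_neg hz]

theorem sum_mul_killedIter_le_one (h : IsWeight c m) (hy : y ∈ A) (n : ℕ) :
    ∑ z ∈ A, m z * killedIter c m A y n z ≤ 1 := by
  classical
  induction n with
  | zero =>
    simp only [killedIter, mul_ite, mul_zero]
    rw [Finset.sum_ite_eq' A y, if_pos hy, mul_inv_cancel₀ (h.pos y).ne']
  | succ n ih =>
    calc ∑ z ∈ A, m z * killedIter c m A y (n + 1) z
        = ∑ w ∈ A, ∑ z ∈ A, c w z * killedIter c m A y n w := by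
          rw [Finset.sum_comm]
          refine Finset.sum_congr rfl fun z hz => ?_
          simp_rw [killedIter, if_pos hz, mul_div_cancel₀ _ (h.pos z).ne', h.symm z]
      _ ≤ ∑ w ∈ A, m w * killedIter c m A y n w := by
          refine Finset.sum_le_sum fun w _ => ?_
          rw [← Finset.sum_mul]
          exact mul_le_mul_of_nonneg_right (h.sum_le A w) (killedIter_nonneg h n w)
      _ ≤ 1 := ih

theorem abs_killedIter_le (h : IsWeight c m) (hy : y ∈ A) (n : ℕ) (z : V) :
    |killedIter c m A y n z| ≤ (m z)⁻¹ := by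
  rw [abs_of_nonneg (killedIter_nonneg h n z)]
  by_cases hz : z ∈ A
  · rw [← one_div, le_div_iff₀' (h.pos z)]
    exact (Finset.single_le_sum (f := fun z => m z * killedIter c m A y n z)
      (fun w _ => mul_nonneg (h.pos w).le (killedIter_nonneg h n w)) hz).trans
      (sum_mul_killedIter_le_one h hy n)
  · rw [killedIter_of_notMem hy n hz]
    exact inv_nonneg.mpr (h.pos z).le

theorem summable_killedIter (h : IsWeight c m) (hy : y ∈ A) (t : ℝ) (z : V) :
    Summable fun n : ℕ => t ^ n / n.factorial * killedIter c m A y n z :=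
  summable_pow_div_factorial_mul (fun n => abs_killedIter_le h hy n z) t

theorem killedKernel_nonneg (h : IsWeight c m) {t : ℝ} (ht : 0 ≤ t) (z : V) :
    0 ≤ killedKernel c m A y t z :=
  mul_nonneg (Real.exp_pos _).le
    (tsum_nonneg fun n => mul_nonneg (by positivity) (killedIter_nonneg h n z))

theorem killedKernel_of_notMem (hy : y ∈ A) (t : ℝ) {z : V} (hz : z ∉ A) :
    killedKernel c m A y t z = 0 := by
  simp only [killedKernel, killedIter_of_notMem hy _ hz, mul_zero, tsum_zero]

open Classical in
theorem killedKernel_zero (z : V) :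
    killedKernel c m A y 0 z = if z = y then (m y)⁻¹ else 0 := by
  rw [killedKernel, tsum_eq_single 0 fun n hn => by simp [hn]]
  simp [killedIter]

theorem sum_mul_killedKernel (h : IsWeight c m) (hy : y ∈ A) (a : V → ℝ) (t : ℝ) :
    ∑ z ∈ A, a z * killedKernel c m A y t z =
      Real.exp (-t) * ∑' n : ℕ, t ^ n / n.factorial * ∑ z ∈ A, a z * killedIter c m A y n z := by
  simp_rw [Finset.mul_sum, mul_left_comm _ (a _)]
  rw [Summable.tsum_finsetSum fun z _ => (summable_killedIter h hy t z).mul_left (a z),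
    Finset.mul_sum]
  simp_rw [killedKernel, tsum_mul_left, mul_left_comm _ (a _)]

theorem sum_mul_killedKernel_le_one (h : IsWeight c m) (hy : y ∈ A) {t : ℝ} (ht : 0 ≤ t) :
    ∑ z ∈ A, m z * killedKernel c m A y t z ≤ 1 := by
  have abs_mass_le (n : ℕ) : |∑ z ∈ A, m z * killedIter c m A y n z| ≤ 1 := by
    rw [abs_of_nonneg (Finset.sum_nonneg fun z _ =>
      mul_nonneg (h.pos z).le (killedIter_nonneg h n z))]
    exact sum_mul_killedIter_le_one h hy n
  calc ∑ z ∈ A, m z * killedKernel c m A y t z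
      ≤ Real.exp (-t) * ∑' n : ℕ, t ^ n / n.factorial := by
        rw [sum_mul_killedKernel h hy]
        refine mul_le_mul_of_nonneg_left (Summable.tsum_le_tsum (fun n => ?_)
          (summable_pow_div_factorial_mul abs_mass_le t) (Real.summable_pow_div_factorial t))
          (Real.exp_pos _).le
        exact mul_le_of_le_one_right (by positivity) (sum_mul_killedIter_le_one h hy n)
    _ = 1 := by
        rw [← congr_fun (NormedSpace.exp_eq_tsum_div (𝔸 := ℝ)) t, ← Real.exp_eq_exp_ℝ,
          ← Real.exp_add, neg_add_cancel, Real.exp_zero]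

theorem isHeatSolution_killedKernel (h : IsWeight c m) (hy : y ∈ A) :
    IsHeatSolution c m A (killedKernel c m A y) := by
  intro t z hz
  have deriv_exp : HasDerivAt (fun s : ℝ => Real.exp (-s)) (-Real.exp (-t)) t := by
    simpa using (hasDerivAt_neg t).exp
  have deriv_tsum := hasDerivAt_tsum_pow_div_factorial_mul (fun n => abs_killedIter_le h hy n z) t
  refine (deriv_exp.mul deriv_tsum).congr_deriv ?_
  rw [killedGenerator, sum_mul_killedKernel h hy, mul_div_assoc, ← tsum_div_const, killedKernel]
  simp_rw [killedIter, if_pos hz, mul_div_assoc]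
  ring

end KilledWalk

section DifferentialInequalities

variable {F F' : ℝ → ℝ} {s t : ℝ}

theorem le_exp_mul_of_hasDerivAt_le_mul {K : ℝ} (hst : s ≤ t)
    (hF : ∀ r ∈ Set.Icc s t, HasDerivAt F (F' r) r) (hle : ∀ r ∈ Set.Icc s t, F' r ≤ K * F r) :
    F t ≤ Real.exp (K * (t - s)) * F s := by
  have gronwall := le_gronwallBound_of_liminf_deriv_right_le (f := F) (f' := F') (ε := 0)
    (fun r hr => (hF r hr).continuousAt.continuousWithinAt)
    (fun r hr _ hlt => (hF r (Set.Ico_subset_Icc_self hr)).hasDerivWithinAt.liminf_right_slope_le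
      hlt) le_rfl
    (fun r hr => (hle r (Set.Ico_subset_Icc_self hr)).trans (add_zero _).ge)
    t (Set.right_mem_Icc.mpr hst)
  rwa [gronwallBound_ε0, mul_comm] at gronwall

theorem antitoneOn_Icc_of_hasDerivAt_nonpos (hF : ∀ r ∈ Set.Icc s t, HasDerivAt F (F' r) r)
    (hle : ∀ r ∈ Set.Icc s t, F' r ≤ 0) : AntitoneOn F (Set.Icc s t) := by
  refine antitoneOn_of_deriv_nonpos (convex_Icc s t)
    (fun r hr => (hF r hr).continuousAt.continuousWithinAt)
    (fun r hr => (hF r (interior_subset hr)).differentiableAt.differentiableWithinAt)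
    fun r hr => ?_
  rw [(hF r (interior_subset hr)).deriv]
  exact hle r (interior_subset hr)

theorem le_rpow_of_rpow_le_neg_mul_deriv {β K : ℝ} (hβ : 0 < β) (hK : 0 < K) (ht : 0 < t)
    (hF : ∀ r ∈ Set.Icc 0 t, HasDerivAt F (F' r) r) (hF0 : ∀ r ∈ Set.Icc 0 t, 0 ≤ F r)
    (hle : ∀ r ∈ Set.Icc 0 t, F r ^ (1 + β) ≤ -K * F' r) :
    F t ≤ (K / (β * t)) ^ (1 / β) := by
  have F_anti : AntitoneOn F (Set.Icc 0 t) := antitoneOn_Icc_of_hasDerivAt_nonpos hF fun r hr => by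
    nlinarith [(Real.rpow_nonneg (hF0 r hr) (1 + β)).trans (hle r hr)]
  have mem_zero := Set.left_mem_Icc.mpr ht.le
  have mem_t := Set.right_mem_Icc.mpr ht.le
  rcases (hF0 t mem_t).eq_or_lt with F_zero | F_pos
  · rw [← F_zero]
    positivity
  have pos (r : ℝ) (hr : r ∈ Set.Icc 0 t) : 0 < F r := F_pos.trans_le (F_anti hr mem_t hr.2)
  -- `F ^ (-β)` grows at least linearly, since its derivative is `-β * F ^ (-β - 1) * F'`.
  have growth : AntitoneOn (fun r => β / K * r - F r ^ (-β)) (Set.Icc 0 t) := by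
    refine antitoneOn_Icc_of_hasDerivAt_nonpos
      (fun r hr => ((hasDerivAt_id' r).const_mul (β / K)).sub
        ((hF r hr).rpow_const (Or.inl (pos r hr).ne'))) fun r hr => ?_
    have cancel : F r ^ (-β - 1) * F r ^ (1 + β) = 1 := by
      rw [← Real.rpow_add (pos r hr), show -β - 1 + (1 + β) = 0 by ring, Real.rpow_zero]
    have inv_le : K⁻¹ ≤ F r ^ (-β - 1) * -F' r := by
      rw [inv_le_iff_one_le_mul₀ hK, mul_assoc]
      refine cancel.symm.le.trans (mul_le_mul_of_nonneg_left ?_ (Real.rpow_nonneg (hF0 r hr) _))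
      linarith [hle r hr]
    rw [div_eq_mul_inv]
    nlinarith
  have lower : β * t / K ≤ F t ^ (-β) := by
    have := growth mem_zero mem_t ht.le
    simp only [mul_zero, zero_sub, div_mul_eq_mul_div] at this
    linarith [Real.rpow_nonneg (hF0 0 mem_zero) (-β)]
  calc F t = (F t ^ (-β)) ^ (-(1 / β)) := by
        rw [← Real.rpow_mul F_pos.le, neg_mul_neg, mul_one_div_cancel hβ.ne', Real.rpow_one]
    _ ≤ (β * t / K) ^ (-(1 / β)) :=
        Real.rpow_le_rpow_of_nonpos (by positivity) lower (by simp [hβ.le])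
    _ = (K / (β * t)) ^ (1 / β) := by
        rw [Real.rpow_neg (by positivity), ← Real.inv_rpow (by positivity), inv_div]

end DifferentialInequalities

section HeatEquation

variable {V : Type*} {c : V → V → ℝ} {m : V → ℝ} {A : Finset V} {u v : ℝ → V → ℝ}

namespace IsHeatSolution

theorem hasDerivAt_sum_reverse_mul (h : IsWeight c m) (hv : IsHeatSolution c m A v)
    {u' : V → ℝ} {r : ℝ} (hu : ∀ z ∈ A, HasDerivAt (fun r => u r z) (u' z) r) (t : ℝ) :
    HasDerivAt (fun r => ∑ z ∈ A, m z * (v (t - r) z * u r z))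
      (∑ z ∈ A, m z * (v (t - r) z * (u' z - killedGenerator c m A (u r) z))) r := by
  have termwise : HasDerivAt (fun r => ∑ z ∈ A, m z * (v (t - r) z * u r z))
      (∑ z ∈ A, m z * (-killedGenerator c m A (v (t - r)) z * u r z + v (t - r) z * u' z)) r := by
    refine .fun_sum fun z hz => .const_mul _ (.mul ?_ (hu z hz))
    simpa [Function.comp_def] using
      (hv (t - r) z hz).comp r ((hasDerivAt_id r).const_sub t)
  refine termwise.congr_deriv ?_
  simp_rw [mul_add, mul_sub, neg_mul, mul_neg, Finset.sum_add_distrib, Finset.sum_sub_distrib,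
    Finset.sum_neg_distrib, h.sum_mul_killedGenerator_symm]
  ring

theorem sum_mul_eq (h : IsWeight c m) (hu : IsHeatSolution c m A u) (hv : IsHeatSolution c m A v)
    (s t : ℝ) : ∑ z ∈ A, m z * (v t z * u s z) = ∑ z ∈ A, m z * (v (s + t) z * u 0 z) := by
  have deriv_zero (r : ℝ) :
      HasDerivAt (fun r => ∑ z ∈ A, m z * (v (s + t - r) z * u r z)) 0 r := by
    simpa only [sub_self, mul_zero, Finset.sum_const_zero] using
      hv.hasDerivAt_sum_reverse_mul h (hu r) (s + t)
  simpa using is_const_of_deriv_eq_zero (fun r => (deriv_zero r).differentiableAt)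
    (fun r => (deriv_zero r).deriv) s 0

theorem hasDerivAt_sum_mul_sq (h : IsWeight c m) (hu : IsHeatSolution c m A u) (t : ℝ) :
    HasDerivAt (fun t => ∑ z ∈ A, m z * u t z ^ 2) (-2 * killedEnergy c m A (u t)) t := by
  rw [neg_mul, ← mul_neg, ← h.sum_mul_killedGenerator_self, Finset.mul_sum]
  refine .fun_sum fun z hz => (((hu t z hz).fun_pow 2).const_mul (m z)).congr_deriv ?_
  ring

end IsHeatSolution

theorem IsWeight.sum_sum_exp_mul_eq_cosh (h : IsWeight c m) (ψ f : V → ℝ) :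
    ∑ z ∈ A, ∑ w ∈ A, c z w * (Real.exp (ψ z) ^ 2 * f z * f w) =
      ∑ z ∈ A, ∑ w ∈ A, c z w *
        (Real.cosh (ψ z - ψ w) * ((Real.exp (ψ z) * f z) * (Real.exp (ψ w) * f w))) := by
  set S : ℝ → ℝ := fun ε => ∑ z ∈ A, ∑ w ∈ A, c z w *
    (Real.exp (ε * (ψ z - ψ w)) * ((Real.exp (ψ z) * f z) * (Real.exp (ψ w) * f w))) with hS
  have S_neg : S (-1) = S 1 := by
    simp only [hS]
    rw [Finset.sum_comm]
    refine Finset.sum_congr rfl fun z _ => Finset.sum_congr rfl fun w _ => ?_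
    rw [h.symm w z, show -1 * (ψ w - ψ z) = 1 * (ψ z - ψ w) by ring]
    ring
  calc ∑ z ∈ A, ∑ w ∈ A, c z w * (Real.exp (ψ z) ^ 2 * f z * f w) = S 1 := by
        refine Finset.sum_congr rfl fun z _ => Finset.sum_congr rfl fun w _ => ?_
        rw [one_mul, Real.exp_sub]
        field_simp
    _ = (S 1 + S (-1)) / 2 := by rw [S_neg]; ring
    _ = _ := by
        simp only [hS, ← Finset.sum_add_distrib, Finset.sum_div, Real.cosh_eq]
        refine Finset.sum_congr rfl fun z _ => Finset.sum_congr rfl fun w _ => ?_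
        rw [one_mul, neg_one_mul]
        ring

variable {ψ : V → ℝ} {θ : ℝ}

theorem IsWeight.sum_exp_mul_killedGenerator_le (h : IsWeight c m)
    (hψ : ∀ z w, c z w ≠ 0 → |ψ z - ψ w| ≤ θ) (f : V → ℝ) :
    ∑ z ∈ A, m z * (Real.exp (ψ z) ^ 2 * f z * killedGenerator c m A f z) ≤
      (Real.cosh θ - 1) * ∑ z ∈ A, m z * (Real.exp (ψ z) * f z) ^ 2 := by
  have cosh_le (z w : V) (hc : c z w ≠ 0) : |Real.cosh (ψ z - ψ w)| ≤ Real.cosh θ := by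
    rw [abs_of_pos (Real.cosh_pos _), Real.cosh_le_cosh]
    exact (hψ z w hc).trans (le_abs_self θ)
  have cross := h.sum_sum_mul_le (A := A) (Real.cosh_pos θ).le cosh_le
    fun z => Real.exp (ψ z) * f z
  rw [h.sum_mul_killedGenerator, h.sum_sum_exp_mul_eq_cosh, sub_one_mul]
  refine (sub_le_sub_right cross _).trans_eq ?_
  congr 1
  exact Finset.sum_congr rfl fun z _ => by ring

/-- Davies' weighted `ℓ²` bound. -/
theorem IsHeatSolution.sum_exp_mul_sq_le (h : IsWeight c m) (hu : IsHeatSolution c m A u)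
    (hψ : ∀ z w, c z w ≠ 0 → |ψ z - ψ w| ≤ θ) {s t : ℝ} (hst : s ≤ t) :
    ∑ z ∈ A, m z * (Real.exp (ψ z) * u t z) ^ 2 ≤
      Real.exp (2 * (Real.cosh θ - 1) * (t - s)) *
        ∑ z ∈ A, m z * (Real.exp (ψ z) * u s z) ^ 2 := by
  refine le_exp_mul_of_hasDerivAt_le_mul
    (F := fun r => ∑ z ∈ A, m z * (Real.exp (ψ z) * u r z) ^ 2)
    (F' := fun r => 2 * ∑ z ∈ A, m z * (Real.exp (ψ z) ^ 2 * u r z *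
      killedGenerator c m A (u r) z)) hst (fun r _ => ?_) fun r _ => ?_
  · rw [Finset.mul_sum]
    refine .fun_sum fun z hz =>
      ((((hu r z hz).const_mul (Real.exp (ψ z))).fun_pow 2).const_mul (m z)).congr_deriv ?_
    ring
  · rw [mul_assoc]
    exact mul_le_mul_of_nonneg_left (h.sum_exp_mul_killedGenerator_le hψ (u r)) zero_le_two

variable {x y : V}

theorem sum_mul_mul_killedKernel_zero (h : IsWeight c m) (hy : y ∈ A) (f : V → ℝ) :
    ∑ z ∈ A, m z * (f z * killedKernel c m A y 0 z) = f y := by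
  classical
  simp only [killedKernel_zero, mul_ite, mul_zero]
  rw [Finset.sum_ite_eq' A y, if_pos hy, mul_left_comm, mul_inv_cancel₀ (h.pos y).ne', mul_one]

theorem killedKernel_add (h : IsWeight c m) (hx : x ∈ A) (hy : y ∈ A) (s t : ℝ) :
    killedKernel c m A y (s + t) x =
      ∑ z ∈ A, m z * (killedKernel c m A x s z * killedKernel c m A y t z) := by
  simp_rw [mul_comm (killedKernel c m A x s _)]
  rw [(isHeatSolution_killedKernel h hx).sum_mul_eq h (isHeatSolution_killedKernel h hy),
    sum_mul_mul_killedKernel_zero h hx]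

theorem killedKernel_symm (h : IsWeight c m) (hx : x ∈ A) (hy : y ∈ A) (t : ℝ) :
    killedKernel c m A y t x = killedKernel c m A x t y := by
  rw [← add_zero t, killedKernel_add h hx hy, sum_mul_mul_killedKernel_zero h hy, add_zero]

theorem IsWeight.killedGenerator_le_killedGenerator_sub (h : IsWeight c m) {A' : Finset V}
    (hA : A ⊆ A') {M : ℝ} (hM : 0 ≤ M) {f : V → ℝ} (hf : ∀ w ∈ A', w ∉ A → f w ≤ M) (z : V) :
    killedGenerator c m A' f z ≤ killedGenerator c m A (fun w => f w - M) z := by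
  classical
  have outer : ∑ w ∈ A' \ A, c z w * f w ≤ (∑ w ∈ A' \ A, c z w) * M := by
    rw [Finset.sum_mul]
    refine Finset.sum_le_sum fun w hw => mul_le_mul_of_nonneg_left ?_ (h.nonneg z w)
    exact hf w (Finset.mem_sdiff.mp hw).1 (Finset.mem_sdiff.mp hw).2
  have mass : (∑ w ∈ A' \ A, c z w + ∑ w ∈ A, c z w) * M ≤ m z * M := by
    rw [Finset.sum_sdiff hA]
    exact mul_le_mul_of_nonneg_right (h.sum_le A' z) hM
  have numerator : ∑ w ∈ A', c z w * f w ≤ ∑ w ∈ A, c z w * (f w - M) + m z * M := by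
    rw [← Finset.sum_sdiff hA]
    simp_rw [mul_sub]
    rw [Finset.sum_sub_distrib, ← Finset.sum_mul]
    linarith
  calc killedGenerator c m A' f z
      ≤ (∑ w ∈ A, c z w * (f w - M) + m z * M) / m z - f z :=
        sub_le_sub_right (div_le_div_of_nonneg_right numerator (h.pos z).le) _
    _ = killedGenerator c m A (fun w => f w - M) z := by
        rw [add_div, mul_div_cancel_left₀ _ (h.pos z).ne', killedGenerator]
        ring

/-- Domain comparison: shrinking the domain from `A'` to `A` loses at most the supremum of the
kernel over `A' \ A`. -/
theorem killedKernel_le_add (h : IsWeight c m) {A' : Finset V} (hA : A ⊆ A')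
    (hx : x ∈ A) (hy : y ∈ A) {t M : ℝ} (ht : 0 ≤ t) (hM0 : 0 ≤ M)
    (hM : ∀ s ∈ Set.Icc 0 t, ∀ w ∈ A', w ∉ A → killedKernel c m A' y s w ≤ M) :
    killedKernel c m A' y t x ≤ killedKernel c m A y t x + M := by
  set v := killedKernel c m A x
  set u := killedKernel c m A' y with hu
  -- `v (t - s)` is paired with `u s - M`, a subsolution on `A` that is nonpositive on `A' \ A`.
  set Φ : ℝ → ℝ := fun s => ∑ z ∈ A, m z * (v (t - s) z * (u s z - M)) with hΦ
  have Φ_anti : AntitoneOn Φ (Set.Icc 0 t) := by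
    refine antitoneOn_Icc_of_hasDerivAt_nonpos (fun s _ =>
      (isHeatSolution_killedKernel h hx).hasDerivAt_sum_reverse_mul h (fun z hz =>
        (isHeatSolution_killedKernel h (hA hy) s z (hA hz)).sub_const M) t) fun s hs => ?_
    refine Finset.sum_nonpos fun z _ => mul_nonpos_of_nonneg_of_nonpos (h.pos z).le
      (mul_nonpos_of_nonneg_of_nonpos (killedKernel_nonneg h (sub_nonneg.mpr hs.2) z)
        (sub_nonpos.mpr (h.killedGenerator_le_killedGenerator_sub hA hM0 (hM s hs) z)))
  have Φ_right : Φ t = u t x - M := by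
    simp only [hΦ, sub_self, mul_comm (v 0 _)]
    exact sum_mul_mul_killedKernel_zero h hx fun z => u t z - M
  have Φ_left : Φ 0 ≤ killedKernel c m A y t x := by
    rw [killedKernel_symm h hx hy, ← sum_mul_mul_killedKernel_zero h hy (killedKernel c m A x t)]
    refine Finset.sum_le_sum fun z _ => ?_
    rw [sub_zero, hu, killedKernel_zero, killedKernel_zero]
    exact mul_le_mul_of_nonneg_left (mul_le_mul_of_nonneg_left (by linarith)
      (killedKernel_nonneg h ht z)) (h.pos z).le
  linarith [Φ_anti (Set.left_mem_Icc.mpr ht) (Set.right_mem_Icc.mpr ht) ht]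

/-- The Nash inequality of exponent `β` and constant `S` on `A`, normalised for sub-probability
densities with respect to `m`. -/
def NashInequality (c : V → V → ℝ) (m : V → ℝ) (A : Finset V) (β S : ℝ) : Prop :=
  ∀ f : V → ℝ, (∀ z, 0 ≤ f z) → (∀ z, z ∉ A → f z = 0) → ∑ z ∈ A, m z * f z ≤ 1 →
    (∑ z ∈ A, m z * f z ^ 2) ^ (1 + β) ≤ S * killedEnergy c m A f

theorem NashInequality.sum_mul_killedKernel_sq_le {β S : ℝ} (hN : NashInequality c m A β S)
    (h : IsWeight c m) (hy : y ∈ A) (hβ : 0 < β) (hS : 0 < S) {t : ℝ} (ht : 0 < t) :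
    ∑ z ∈ A, m z * killedKernel c m A y t z ^ 2 ≤ (S / (2 * β * t)) ^ (1 / β) := by
  have decay := le_rpow_of_rpow_le_neg_mul_deriv hβ (half_pos hS) ht
    (fun s _ => (isHeatSolution_killedKernel h hy).hasDerivAt_sum_mul_sq h s)
    (fun s _ => Finset.sum_nonneg fun z _ => mul_nonneg (h.pos z).le (sq_nonneg _)) fun s hs => by
      refine (hN _ (fun z => killedKernel_nonneg h hs.1 z)
        (fun z hz => killedKernel_of_notMem hy s hz)
        (sum_mul_killedKernel_le_one h hy hs.1)).trans_eq ?_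
      ring
  rwa [div_div, ← mul_assoc] at decay

end HeatEquation

section Conductances

variable {V : Type*} {G : SimpleGraph V} (ω : Conductances G)

theorem conductance_symm (x y : V) : conductance ω x y = conductance ω y x := by
  unfold conductance
  by_cases h : G.Adj x y
  · rw [dif_pos h, dif_pos h.symm]
    congr 2
    exact Subtype.ext Sym2.eq_swap
  · rw [dif_neg h, dif_neg fun h' => h h'.symm]

theorem conductance_pos {x y : V} (h : G.Adj x y) : 0 < conductance ω x y := by
  rw [conductance, dif_pos h]
  exact (ω ⟨s(x, y), h⟩).2

theorem conductance_of_not_adj {x y : V} (h : ¬ G.Adj x y) : conductance ω x y = 0 := by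
  rw [conductance, dif_neg h]

variable [G.LocallyFinite]

theorem nu_nonneg (x : V) : 0 ≤ nu ω x :=
  Finset.sum_nonneg fun y _ => one_div_nonneg.mpr (conductance_nonneg ω x y)

theorem inv_mu_le_nu [Nontrivial V] (hG : G.Connected) (x : V) : (mu ω x)⁻¹ ≤ nu ω x := by
  obtain ⟨z, hz⟩ := hG.preconnected.exists_adj_of_nontrivial x
  have mem_nbr := (G.mem_neighborFinset x z).mpr hz
  calc (mu ω x)⁻¹ ≤ (conductance ω x z)⁻¹ :=
        inv_anti₀ (conductance_pos ω hz) (Finset.single_le_sum (f := conductance ω x)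
          (fun y _ => conductance_nonneg ω x y) mem_nbr)
    _ = 1 / conductance ω x z := (one_div _).symm
    _ ≤ nu ω x := Finset.single_le_sum (f := fun y => 1 / conductance ω x y)
        (fun y _ => one_div_nonneg.mpr (conductance_nonneg ω x y)) mem_nbr

theorem sum_neighborFinset_eq {A : Finset V} {y : V} {a g : V → ℝ}
    (ha : ∀ z, ¬ G.Adj y z → a z = 0) (hg : ∀ z, z ∉ A → g z = 0) :
    ∑ z ∈ G.neighborFinset y, a z * g z = ∑ z ∈ A, a z * g z := by
  classical
  calc ∑ z ∈ G.neighborFinset y, a z * g z = ∑ z ∈ G.neighborFinset y ∩ A, a z * g z :=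
        (Finset.sum_subset Finset.inter_subset_left fun z hz hzA => by
          rw [hg z fun hA => hzA (Finset.mem_inter.mpr ⟨hz, hA⟩), mul_zero]).symm
    _ = ∑ z ∈ A, a z * g z :=
        Finset.sum_subset Finset.inter_subset_right fun z hz hzA => by
          rw [ha z fun h => hzA (Finset.mem_inter.mpr ⟨(G.mem_neighborFinset y z).mpr h, hz⟩),
            zero_mul]

theorem sum_le_sum_neighborFinset (A : Finset V) {y : V} {a : V → ℝ} (ha0 : ∀ z, 0 ≤ a z)
    (ha : ∀ z, ¬ G.Adj y z → a z = 0) :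
    ∑ z ∈ A, a z ≤ ∑ z ∈ G.neighborFinset y, a z := by
  classical
  rw [← Finset.sum_filter_ne_zero]
  refine Finset.sum_le_sum_of_subset_of_nonneg (fun z hz => ?_) fun z _ _ => ha0 z
  exact (G.mem_neighborFinset y z).mpr (not_imp_comm.mp (ha z) (Finset.mem_filter.mp hz).2)

theorem isWeight_conductance [Nontrivial V] (hG : G.Connected) :
    IsWeight (conductance ω) (mu ω) where
  symm := conductance_symm ω
  nonneg := conductance_nonneg ω
  sum_le A x := sum_le_sum_neighborFinset A (conductance_nonneg ω x)
    fun _ => conductance_of_not_adj ω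
  pos x := by
    obtain ⟨z, hz⟩ := hG.preconnected.exists_adj_of_nontrivial x
    exact Finset.sum_pos' (fun y _ => conductance_nonneg ω x y)
      ⟨z, (G.mem_neighborFinset x z).mpr hz, conductance_pos ω hz⟩

theorem sum_sum_neighborFinset_mul_add_le {A : Finset V} {a : V → V → ℝ}
    (a_symm : ∀ y z, a y z = a z y) (a_nonneg : ∀ y z, 0 ≤ a y z)
    (a_zero : ∀ y z, ¬ G.Adj y z → a y z = 0) {g : V → ℝ} (g_nonneg : ∀ z, 0 ≤ g z)
    (g_zero : ∀ z, z ∉ A → g z = 0) :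
    ∑ y ∈ A, ∑ z ∈ G.neighborFinset y, a y z * (g y + g z) ≤
      2 * ∑ y ∈ A, (∑ z ∈ G.neighborFinset y, a y z) * g y := by
  have swapped : ∑ y ∈ A, ∑ z ∈ G.neighborFinset y, a y z * g z ≤
      ∑ y ∈ A, (∑ z ∈ G.neighborFinset y, a y z) * g y := by
    simp_rw [sum_neighborFinset_eq (a_zero _) g_zero]
    rw [Finset.sum_comm]
    refine Finset.sum_le_sum fun z _ => ?_
    rw [← Finset.sum_mul]
    refine mul_le_mul_of_nonneg_right ?_ (g_nonneg z)
    simp_rw [a_symm _ z]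
    exact sum_le_sum_neighborFinset A (a_nonneg z) (a_zero z)
  simp_rw [mul_add, Finset.sum_add_distrib, ← Finset.sum_mul]
  linarith

theorem sum_sum_conductance_mul_sq_sub_le {A : Finset V} {f : V → ℝ}
    (hf : ∀ z, z ∉ A → f z = 0) :
    ∑ y ∈ A, ∑ z ∈ G.neighborFinset y, conductance ω y z * (f y - f z) ^ 2 ≤
      2 * killedEnergy (conductance ω) (mu ω) A f := by
  have squares := sum_sum_neighborFinset_mul_add_le (conductance_symm ω) (conductance_nonneg ω)
    (fun _ _ => conductance_of_not_adj ω) (fun z => sq_nonneg (f z))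
    (fun z hz => by rw [hf z hz, zero_pow two_ne_zero])
  have expand (y z : V) : conductance ω y z * (f y - f z) ^ 2 =
      conductance ω y z * (f y ^ 2 + f z ^ 2) - 2 * (conductance ω y z * (f y * f z)) := by ring
  have cross (y : V) : ∑ z ∈ G.neighborFinset y, conductance ω y z * (f y * f z) =
      ∑ z ∈ A, conductance ω y z * (f y * f z) :=
    sum_neighborFinset_eq (fun _ => conductance_of_not_adj ω)
      fun z hz => by rw [hf z hz, mul_zero]
  simp_rw [expand, Finset.sum_sub_distrib, ← Finset.mul_sum, cross, killedEnergy]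
  change _ ≤ 2 * ∑ y ∈ A, mu ω y * f y ^ 2 at squares
  linarith

end Conductances

section Sobolev

variable {V : Type*} {G : SimpleGraph V}

theorem edgeDiff_nonneg (u : V → ℝ) (e : Sym2 V) : 0 ≤ edgeDiff u e := by
  induction e with
  | _ x y => exact abs_nonneg (u x - u y)

variable [G.LocallyFinite]

theorem sum_incidenceFinset_edgeDiff_le [DecidableEq V] (u : V → ℝ) (y : V) :
    ∑ e ∈ G.incidenceFinset y, edgeDiff u e ≤ ∑ z ∈ G.neighborFinset y, |u y - u z| := by
  have subset_image : G.incidenceFinset y ⊆ (G.neighborFinset y).image fun z => s(y, z) := by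
    intro e he
    rw [SimpleGraph.mem_incidenceFinset] at he
    obtain ⟨z, rfl⟩ := he.2
    exact Finset.mem_image.mpr ⟨z, (G.mem_neighborFinset y z).mpr he.1, rfl⟩
  refine (Finset.sum_le_sum_of_subset_of_nonneg subset_image
    fun e _ _ => edgeDiff_nonneg u e).trans_eq ?_
  exact Finset.sum_image fun _ _ _ _ => Sym2.congr_right.mp

theorem sum_edgesMeetingBall_le (u : V → ℝ) (x : V) (n : ℕ) :
    ∑ e ∈ edgesMeetingBall G x n, edgeDiff u e ≤
      ∑ y ∈ ball G x n, ∑ z ∈ G.neighborFinset y, |u y - u z| := by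
  classical
  have union_bound (B : Finset V) :
      ∑ e ∈ B.biUnion (fun y => G.incidenceFinset y), edgeDiff u e ≤
        ∑ y ∈ B, ∑ e ∈ G.incidenceFinset y, edgeDiff u e := by
    induction B using Finset.induction_on with
    | empty => simp
    | insert b B hb ih =>
      rw [Finset.biUnion_insert, Finset.sum_insert hb]
      refine le_trans ?_ (add_le_add_right ih _)
      rw [← Finset.sum_union_inter]
      exact le_add_of_nonneg_right (Finset.sum_nonneg fun e _ => edgeDiff_nonneg u e)
  refine le_trans (le_of_eq ?_) ((union_bound _).trans
    (Finset.sum_le_sum fun y _ => sum_incidenceFinset_edgeDiff_le u y))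
  unfold edgesMeetingBall
  congr!

theorem abs_rpow_sub_rpow_le {a b s : ℝ} (ha : 0 ≤ a) (hb : 0 ≤ b) (hs : 1 ≤ s) :
    |a ^ s - b ^ s| ≤ s * (a ^ (s - 1) + b ^ (s - 1)) * |a - b| := by
  wlog hab : b ≤ a generalizing a b
  · rw [abs_sub_comm, abs_sub_comm a b, add_comm]
    exact this hb ha (le_of_not_ge hab)
  rw [abs_of_nonneg (sub_nonneg.mpr (Real.rpow_le_rpow hb hab (by linarith))),
    abs_of_nonneg (sub_nonneg.mpr hab)]
  rcases ha.eq_or_lt with rfl | a_pos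
  · simp [le_antisymm hab hb]
  -- Bernoulli's inequality for `b / a`, multiplied by `a ^ s`.
  have bernoulli := one_add_mul_self_le_rpow_one_add (s := b / a - 1)
    (by linarith [div_nonneg hb ha]) hs
  rw [add_sub_cancel, Real.div_rpow hb ha, le_div_iff₀ (Real.rpow_pos_of_pos a_pos s)] at bernoulli
  have scaled : (1 + s * (b / a - 1)) * a ^ s = a ^ s + s * (b - a) * a ^ (s - 1) := by
    rw [Real.rpow_sub_one a_pos.ne']
    field_simp
  have := mul_nonneg (mul_nonneg (zero_le_one.trans hs) (Real.rpow_nonneg hb (s - 1)))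
    (sub_nonneg.mpr hab)
  linarith

variable {A : Finset V} {f : V → ℝ}

theorem sum_sum_one_div_conductance_mul_sq_add_le (ω : Conductances G) (hf : ∀ z, 0 ≤ f z)
    (hfA : ∀ z, z ∉ A → f z = 0) {s : ℝ} (hs : 1 < s) :
    ∑ y ∈ A, ∑ z ∈ G.neighborFinset y,
        1 / conductance ω y z * (f y ^ (s - 1) + f z ^ (s - 1)) ^ 2 ≤
      4 * ∑ z ∈ A, nu ω z * f z ^ (2 * s - 2) := by
  have rpow_sq (z : V) : (f z ^ (s - 1)) ^ 2 = f z ^ (2 * s - 2) := by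
    rw [← Real.rpow_mul_natCast (hf z)]
    congr 1
    push_cast
    ring
  have inv_nonneg (y z : V) : 0 ≤ 1 / conductance ω y z :=
    one_div_nonneg.mpr (conductance_nonneg ω y z)
  have symmetrized := sum_sum_neighborFinset_mul_add_le (G := G) (A := A)
    (fun y z => by rw [conductance_symm]) inv_nonneg
    (fun y z hyz => by rw [conductance_of_not_adj ω hyz, div_zero])
    (fun z => Real.rpow_nonneg (hf z) (2 * s - 2))
    (fun z hz => by rw [hfA z hz, Real.zero_rpow (by linarith)])
  calc ∑ y ∈ A, ∑ z ∈ G.neighborFinset y,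
        1 / conductance ω y z * (f y ^ (s - 1) + f z ^ (s - 1)) ^ 2
      ≤ ∑ y ∈ A, ∑ z ∈ G.neighborFinset y,
        2 * (1 / conductance ω y z * (f y ^ (2 * s - 2) + f z ^ (2 * s - 2))) := by
        refine Finset.sum_le_sum fun y _ => Finset.sum_le_sum fun z _ => ?_
        rw [← rpow_sq, ← rpow_sq, mul_left_comm]
        exact mul_le_mul_of_nonneg_left add_sq_le (inv_nonneg y z)
    _ ≤ 2 * (2 * ∑ z ∈ A, nu ω z * f z ^ (2 * s - 2)) := by
        simp_rw [← Finset.mul_sum]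
        exact mul_le_mul_of_nonneg_left symmetrized zero_le_two
    _ = 4 * ∑ z ∈ A, nu ω z * f z ^ (2 * s - 2) := by ring

theorem sq_sum_sum_neighborFinset_mul_abs_sub_le (ω : Conductances G) (a : V → V → ℝ) :
    (∑ y ∈ A, ∑ z ∈ G.neighborFinset y, a y z * |f y - f z|) ^ 2 ≤
      (∑ y ∈ A, ∑ z ∈ G.neighborFinset y, conductance ω y z * (f y - f z) ^ 2) *
        ∑ y ∈ A, ∑ z ∈ G.neighborFinset y, 1 / conductance ω y z * a y z ^ 2 := by
  simp only [Finset.sum_sigma']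
  refine Finset.sum_sq_le_sum_mul_sum_of_sq_le_mul _
    (fun i _ => mul_nonneg (conductance_nonneg ω _ _) (sq_nonneg _))
    (fun i _ => mul_nonneg (one_div_nonneg.mpr (conductance_nonneg ω _ _)) (sq_nonneg _))
    fun i hi => le_of_eq ?_
  rw [Finset.mem_sigma, SimpleGraph.mem_neighborFinset] at hi
  have := (conductance_pos ω hi.2).ne'
  rw [mul_pow, sq_abs]
  field_simp

theorem sq_sum_abs_rpow_sub_le (ω : Conductances G) (hf : ∀ z, 0 ≤ f z)
    (hfA : ∀ z, z ∉ A → f z = 0) {s : ℝ} (hs : 1 < s) :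
    (∑ y ∈ A, ∑ z ∈ G.neighborFinset y, |f y ^ s - f z ^ s|) ^ 2 ≤
      8 * s ^ 2 * killedEnergy (conductance ω) (mu ω) A f *
        ∑ z ∈ A, nu ω z * f z ^ (2 * s - 2) := by
  set D := ∑ y ∈ A, ∑ z ∈ G.neighborFinset y, (f y ^ (s - 1) + f z ^ (s - 1)) * |f y - f z|
  set E := ∑ y ∈ A, ∑ z ∈ G.neighborFinset y, conductance ω y z * (f y - f z) ^ 2
  set T := ∑ y ∈ A, ∑ z ∈ G.neighborFinset y,
    1 / conductance ω y z * (f y ^ (s - 1) + f z ^ (s - 1)) ^ 2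
  have chain_rule : ∑ y ∈ A, ∑ z ∈ G.neighborFinset y, |f y ^ s - f z ^ s| ≤ s * D := by
    simp_rw [D, Finset.mul_sum, ← mul_assoc]
    exact Finset.sum_le_sum fun y _ => Finset.sum_le_sum fun z _ =>
      abs_rpow_sub_rpow_le (hf y) (hf z) hs.le
  have cauchy_schwarz : D ^ 2 ≤ E * T := sq_sum_sum_neighborFinset_mul_abs_sub_le ω _
  have E_nonneg : 0 ≤ E := Finset.sum_nonneg fun y _ => Finset.sum_nonneg fun z _ =>
    mul_nonneg (conductance_nonneg ω _ _) (sq_nonneg _)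
  have T_nonneg : 0 ≤ T := Finset.sum_nonneg fun y _ => Finset.sum_nonneg fun z _ =>
    mul_nonneg (one_div_nonneg.mpr (conductance_nonneg ω _ _)) (sq_nonneg _)
  have E_le : E ≤ 2 * killedEnergy (conductance ω) (mu ω) A f :=
    sum_sum_conductance_mul_sq_sub_le ω hfA
  calc _ ≤ (s * D) ^ 2 := pow_le_pow_left₀ (Finset.sum_nonneg fun y _ =>
        Finset.sum_nonneg fun z _ => abs_nonneg _) chain_rule 2
    _ ≤ s ^ 2 * (E * T) := by
        rw [mul_pow]
        exact mul_le_mul_of_nonneg_left cauchy_schwarz (sq_nonneg s)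
    _ ≤ s ^ 2 * ((2 * killedEnergy (conductance ω) (mu ω) A f) *
          (4 * ∑ z ∈ A, nu ω z * f z ^ (2 * s - 2))) :=
        mul_le_mul_of_nonneg_left (mul_le_mul E_le
          (sum_sum_one_div_conductance_mul_sq_add_le ω hf hfA hs) T_nonneg
          (E_nonneg.trans E_le)) (sq_nonneg s)
    _ = _ := by ring

end Sobolev

section Hoelder

variable {ι : Type*} {A : Finset ι} {f w : ι → ℝ} {p : ℝ}

theorem sum_mul_rpow_le_rpow_sum_mul (hw : ∀ z, 0 ≤ w z) (hf : ∀ z, 0 ≤ f z) (hp : 1 < p) (e : ℝ) :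
    ∑ z ∈ A, w z * f z ^ (e * (1 - 1 / p)) ≤
      (∑ z ∈ A, w z ^ p) ^ (1 / p) * (∑ z ∈ A, f z ^ e) ^ (1 - 1 / p) := by
  have conj : p.HolderConjugate (1 - 1 / p)⁻¹ := by
    rw [Real.holderConjugate_iff]
    refine ⟨hp, ?_⟩
    rw [inv_inv]
    ring
  refine (Real.inner_le_Lp_mul_Lq_of_nonneg A conj (fun z _ => hw z)
    fun z _ => Real.rpow_nonneg (hf z) _).trans_eq ?_
  have cancel : (1 - 1 / p) * (1 - 1 / p)⁻¹ = 1 :=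
    mul_inv_cancel₀ fun h => conj.symm.ne_zero (by rw [h, inv_zero])
  simp_rw [← Real.rpow_mul (hf _), mul_assoc, cancel, mul_one, one_div (1 - 1 / p)⁻¹, inv_inv]

theorem sum_mul_sq_le_rpow (hw : ∀ z, 0 ≤ w z) (hf : ∀ z, 0 ≤ f z)
    (mass_le : ∑ z ∈ A, w z * f z ≤ 1) (hp : 2 ≤ p) :
    ∑ z ∈ A, w z * f z ^ 2 ≤ (∑ z ∈ A, w z * f z ^ p) ^ (p - 1)⁻¹ := by
  have weighted := Real.inner_le_weight_mul_Lp_of_nonneg A (p := p - 1) (by linarith)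
    (fun z => w z * f z) f (fun z => mul_nonneg (hw z) (hf z)) hf
  have pow_split (z : ι) : w z * f z * f z ^ (p - 1) = w z * f z ^ p := by
    rw [mul_assoc, ← Real.rpow_one_add' (hf z) (by linarith), add_sub_cancel]
  simp_rw [pow_split, mul_assoc, ← pow_two] at weighted
  refine weighted.trans (mul_le_of_le_one_left (Real.rpow_nonneg
    (Finset.sum_nonneg fun z _ => mul_nonneg (hw z) (Real.rpow_nonneg (hf z) p)) _) ?_)
  exact Real.rpow_le_one (Finset.sum_nonneg fun z _ => mul_nonneg (hw z) (hf z)) mass_le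
    (sub_nonneg.mpr (inv_le_one_of_one_le₀ (by linarith)))

theorem sum_mul_sq_rpow_le (hw : ∀ z, 0 ≤ w z) (hf : ∀ z, 0 ≤ f z)
    (mass_le : ∑ z ∈ A, w z * f z ≤ 1) (hp : 1 < p) {σ θ : ℝ} (hθ0 : 0 < θ) (hθ1 : θ < 1)
    (hσ : σ = θ * (1 - 1 / p)) :
    (∑ z ∈ A, w z * f z ^ 2) ^ (2 - θ) ≤
      ((∑ z ∈ A, w z ^ p) ^ (1 / p)) ^ θ * (∑ z ∈ A, f z ^ (2 / σ)) ^ σ := by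
  have conj_pos : 0 < 1 - 1 / p := by
    rw [sub_pos, div_lt_one (by linarith)]
    exact hp
  have two_div : 2 / θ = 2 / σ * (1 - 1 / p) := by
    rw [hσ, div_mul_eq_mul_div, mul_div_mul_right _ _ conj_pos.ne']
  have moment_nonneg : 0 ≤ ∑ z ∈ A, w z * f z ^ (2 / θ) :=
    Finset.sum_nonneg fun z _ => mul_nonneg (hw z) (Real.rpow_nonneg (hf z) _)
  have wp_nonneg : 0 ≤ (∑ z ∈ A, w z ^ p) ^ (1 / p) :=
    Real.rpow_nonneg (Finset.sum_nonneg fun z _ => Real.rpow_nonneg (hw z) p) _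
  have f_nonneg : 0 ≤ ∑ z ∈ A, f z ^ (2 / σ) :=
    Finset.sum_nonneg fun z _ => Real.rpow_nonneg (hf z) _
  calc (∑ z ∈ A, w z * f z ^ 2) ^ (2 - θ)
      ≤ ((∑ z ∈ A, w z * f z ^ (2 / θ)) ^ (2 / θ - 1)⁻¹) ^ (2 - θ) := by
        refine Real.rpow_le_rpow (Finset.sum_nonneg fun z _ => mul_nonneg (hw z) (sq_nonneg _))
          (sum_mul_sq_le_rpow hw hf mass_le ?_) (by linarith)
        rw [le_div_iff₀ hθ0]
        linarith
    _ = (∑ z ∈ A, w z * f z ^ (2 / θ)) ^ θ := by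
        rw [← Real.rpow_mul moment_nonneg, div_sub_one hθ0.ne', inv_div,
          div_mul_cancel₀ _ (by linarith)]
    _ ≤ ((∑ z ∈ A, w z ^ p) ^ (1 / p) * (∑ z ∈ A, f z ^ (2 / σ)) ^ (1 - 1 / p)) ^ θ := by
        refine Real.rpow_le_rpow moment_nonneg ?_ hθ0.le
        rw [two_div]
        exact sum_mul_rpow_le_rpow_sum_mul hw hf hp _
    _ = _ := by
        rw [Real.mul_rpow wp_nonneg (Real.rpow_nonneg f_nonneg _), ← Real.rpow_mul f_nonneg,
          mul_comm _ θ, ← hσ]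

end Hoelder

section Nash

/-- The exponent `σ` for which the `ℓ¹`-Sobolev inequality of dimension `d'` and the `ℓ^q`-norm of
`ν^ω` control `‖f‖²` in `ℓ^(2 / σ)` by the energy of `f`. -/
def sobolevExponent (d' q : ℝ) : ℝ := 1 - 2 / d' + 1 / q

theorem sobolevExponent_pos {d' q : ℝ} (hd' : 2 ≤ d') (hq : 0 < q) : 0 < sobolevExponent d' q := by
  have : 2 / d' ≤ 1 := (div_le_one (by linarith)).mpr hd'
  have : 0 < 1 / q := one_div_pos.mpr hq
  rw [sobolevExponent]
  linarith

theorem two_mul_two_div_sobolevExponent_sub_two {d' q : ℝ} (hd' : 2 ≤ d') (hq : 0 < q) :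
    2 * (2 / sobolevExponent d' q * ((d' - 1) / d')) - 2 =
      2 / sobolevExponent d' q * (1 - 1 / q) := by
  have := (sobolevExponent_pos hd' hq).ne'
  have d'_ne : d' ≠ 0 := by linarith
  have : 2 * ((d' - 1) / d') - sobolevExponent d' q = 1 - 1 / q := by
    rw [sobolevExponent]
    field_simp
    ring
  rw [← this, mul_sub, div_mul_cancel₀ _ (by assumption)]
  ring

theorem one_lt_two_div_sobolevExponent_mul {d' q : ℝ} (hd' : 2 ≤ d') (hq : 1 < q) :
    1 < 2 / sobolevExponent d' q * ((d' - 1) / d') := by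
  have σ_pos := sobolevExponent_pos hd' (zero_lt_one.trans hq)
  have : 0 < 2 / sobolevExponent d' q * (1 - 1 / q) :=
    mul_pos (by positivity) (sub_pos.mpr ((div_lt_one (by linarith)).mpr hq))
  linarith [two_mul_two_div_sobolevExponent_sub_two hd' (zero_lt_one.trans hq)]

/-- The `ℓ¹`-Sobolev inequality of dimension `d'` and constant `K` for functions supported
in `A`. -/
def SobolevInequality {V : Type*} (G : SimpleGraph V) [G.LocallyFinite] (A : Finset V) (d' K : ℝ) :
    Prop :=
  ∀ u : V → ℝ, (∀ y, y ∉ A → u y = 0) →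
    (∑ y ∈ A, |u y| ^ (d' / (d' - 1))) ^ ((d' - 1) / d') ≤
      K * ∑ y ∈ A, ∑ z ∈ G.neighborFinset y, |u y - u z|

variable {V : Type*} {G : SimpleGraph V} [G.LocallyFinite] {A : Finset V} {f : V → ℝ}
  {d' p q K : ℝ}

theorem SobolevInequality.rpow_sum_rpow_le (hSob : SobolevInequality G A d' K) (ω : Conductances G)
    {s : ℝ} (hs : 1 < s) (hf : ∀ z, 0 ≤ f z) (hfA : ∀ z, z ∉ A → f z = 0) :
    (∑ z ∈ A, f z ^ (s * (d' / (d' - 1)))) ^ (2 * (d' - 1) / d') ≤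
      8 * (s * K) ^ 2 * killedEnergy (conductance ω) (mu ω) A f *
        ∑ z ∈ A, nu ω z * f z ^ (2 * s - 2) := by
  have sobolev_rpow := hSob (fun z => f z ^ s) fun z hz => by
    rw [hfA z hz, Real.zero_rpow (by linarith)]
  simp_rw [abs_of_nonneg (Real.rpow_nonneg (hf _) _), ← Real.rpow_mul (hf _)] at sobolev_rpow
  have sum_nonneg : 0 ≤ ∑ z ∈ A, f z ^ (s * (d' / (d' - 1))) :=
    Finset.sum_nonneg fun z _ => Real.rpow_nonneg (hf z) _
  calc (∑ z ∈ A, f z ^ (s * (d' / (d' - 1)))) ^ (2 * (d' - 1) / d')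
      = ((∑ z ∈ A, f z ^ (s * (d' / (d' - 1)))) ^ ((d' - 1) / d')) ^ 2 := by
        rw [← Real.rpow_mul_natCast sum_nonneg]
        congr 1
        push_cast
        ring
    _ ≤ (K * ∑ y ∈ A, ∑ z ∈ G.neighborFinset y, |f y ^ s - f z ^ s|) ^ 2 :=
        pow_le_pow_left₀ (Real.rpow_nonneg sum_nonneg _) sobolev_rpow 2
    _ ≤ K ^ 2 * (8 * s ^ 2 * killedEnergy (conductance ω) (mu ω) A f *
          ∑ z ∈ A, nu ω z * f z ^ (2 * s - 2)) := by
        rw [mul_pow]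
        exact mul_le_mul_of_nonneg_left (sq_sum_abs_rpow_sub_le ω hf hfA hs) (sq_nonneg K)
    _ = _ := by ring

/-- The weighted `ℓ²`-Sobolev inequality, from the `ℓ¹` one applied to `f ^ s`. -/
theorem SobolevInequality.rpow_sum_le_energy (hSob : SobolevInequality G A d' K)
    (ω : Conductances G) (hw : IsWeight (conductance ω) (mu ω)) (hd' : 2 ≤ d') (hq : 1 < q)
    (hf : ∀ z, 0 ≤ f z) (hfA : ∀ z, z ∉ A → f z = 0) :
    (∑ z ∈ A, f z ^ (2 / sobolevExponent d' q)) ^ sobolevExponent d' q ≤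
      32 * (K / sobolevExponent d' q) ^ 2 * (∑ z ∈ A, nu ω z ^ q) ^ (1 / q) *
        killedEnergy (conductance ω) (mu ω) A f := by
  set σ := sobolevExponent d' q with hσ
  set E := killedEnergy (conductance ω) (mu ω) A f
  set N := (∑ z ∈ A, nu ω z ^ q) ^ (1 / q)
  set X := ∑ z ∈ A, f z ^ (2 / σ)
  set s := 2 / σ * ((d' - 1) / d') with hs
  have two_mul_s : 2 * s - 2 = 2 / σ * (1 - 1 / q) :=
    two_mul_two_div_sobolevExponent_sub_two hd' (by linarith)
  have σ_pos : 0 < σ := sobolevExponent_pos hd' (by linarith)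
  have E_nonneg : 0 ≤ E := hw.killedEnergy_nonneg f
  have N_nonneg : 0 ≤ N :=
    Real.rpow_nonneg (Finset.sum_nonneg fun z _ => Real.rpow_nonneg (nu_nonneg ω z) _) _
  have X_nonneg : 0 ≤ X := Finset.sum_nonneg fun z _ => Real.rpow_nonneg (hf z) _
  rcases X_nonneg.eq_or_lt with X_zero | X_pos
  · rw [← X_zero, Real.zero_rpow σ_pos.ne']
    positivity
  have one_lt_s : 1 < s := one_lt_two_div_sobolevExponent_mul hd' hq
  have s_mul : s * (d' / (d' - 1)) = 2 / σ := by
    rw [hs, mul_assoc, div_mul_div_cancel₀ (by linarith), div_self (by linarith), mul_one]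
  have s_le : s ≤ 2 / σ :=
    mul_le_of_le_one_right (by positivity) ((div_le_one (by linarith)).mpr (by linarith))
  refine le_of_mul_le_mul_right ?_ (Real.rpow_pos_of_pos X_pos (1 - 1 / q))
  calc X ^ σ * X ^ (1 - 1 / q) = X ^ (2 * (d' - 1) / d') := by
        rw [← Real.rpow_add X_pos, hσ, sobolevExponent]
        congr 1
        have : d' ≠ 0 := by linarith
        field_simp
        ring
    _ ≤ 8 * (s * K) ^ 2 * E * ∑ z ∈ A, nu ω z * f z ^ (2 * s - 2) := by
        have := hSob.rpow_sum_rpow_le ω one_lt_s hf hfA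
        rwa [s_mul] at this
    _ ≤ 8 * (2 / σ * K) ^ 2 * E * (N * X ^ (1 - 1 / q)) := by
        rw [two_mul_s]
        refine mul_le_mul ?_ (sum_mul_rpow_le_rpow_sum_mul (nu_nonneg ω) hf hq _)
          (Finset.sum_nonneg fun z _ => mul_nonneg (nu_nonneg ω z) (Real.rpow_nonneg (hf z) _))
          (by positivity)
        simp only [mul_pow]
        gcongr
    _ = _ := by ring

theorem SobolevInequality.nashInequality (hSob : SobolevInequality G A d' K) (ω : Conductances G)
    (hw : IsWeight (conductance ω) (mu ω)) (hd' : 2 ≤ d') (hp : 1 < p) (hq : 1 < q) {θ : ℝ}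
    (hθ : θ * (1 - 1 / p) = sobolevExponent d' q) (hθ0 : 0 < θ) (hθ1 : θ < 1) :
    NashInequality (conductance ω) (mu ω) A (1 - θ)
      (32 * (K / sobolevExponent d' q) ^ 2 * (∑ z ∈ A, nu ω z ^ q) ^ (1 / q) *
        ((∑ z ∈ A, mu ω z ^ p) ^ (1 / p)) ^ θ) := by
  intro f hf hfA mass_le
  have interpolated :=
    sum_mul_sq_rpow_le (mu_nonneg ω) hf mass_le hp hθ0 hθ1 hθ.symm
  have : 0 ≤ ((∑ z ∈ A, mu ω z ^ p) ^ (1 / p)) ^ θ := Real.rpow_nonneg (Real.rpow_nonneg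
    (Finset.sum_nonneg fun z _ => Real.rpow_nonneg (mu_nonneg ω z) _) _) _
  calc (∑ z ∈ A, mu ω z * f z ^ 2) ^ (1 + (1 - θ))
      = (∑ z ∈ A, mu ω z * f z ^ 2) ^ (2 - θ) := by ring_nf
    _ ≤ _ := interpolated.trans
        (mul_le_mul_of_nonneg_left (hSob.rpow_sum_le_energy ω hw hd' hq hf hfA) this)
    _ = _ := by ring

end Nash

section Exponents

theorem exists_real_exponent {p : ℝ≥0∞} (hp : 1 < p) {ε : ℝ} (hε : 0 < ε) :
    ∃ P : ℝ, 1 < P ∧ 1 / P < (p⁻¹).toReal + ε ∧ (p = ∞ ∨ p = ENNReal.ofReal P) := by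
  rcases eq_or_ne p ∞ with rfl | p_ne_top
  · refine ⟨max 2 (2 / ε), lt_max_of_lt_left one_lt_two, ?_, Or.inl rfl⟩
    have : 1 / max 2 (2 / ε) ≤ 1 / (2 / ε) :=
      one_div_le_one_div_of_le (by positivity) (le_max_right _ _)
    rw [one_div_div] at this
    simp only [ENNReal.inv_top, ENNReal.toReal_zero]
    linarith
  · refine ⟨p.toReal, ?_, ?_, Or.inr (ENNReal.ofReal_toReal p_ne_top).symm⟩
    · simpa using (ENNReal.toReal_lt_toReal ENNReal.one_ne_top p_ne_top).mpr hp
    · rw [ENNReal.toReal_inv, one_div]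
      linarith

theorem exists_real_exponents {p q : ℝ≥0∞} {a : ℝ} (ha : a ≤ 1)
    (hpq : p⁻¹ + q⁻¹ < ENNReal.ofReal a) :
    ∃ P Q : ℝ, 1 < P ∧ 1 < Q ∧ 1 / P + 1 / Q < a ∧ (p = ∞ ∨ p = ENNReal.ofReal P) ∧
      (q = ∞ ∨ q = ENNReal.ofReal Q) := by
  have sum_lt_one : p⁻¹ + q⁻¹ < 1 := hpq.trans_le (ENNReal.ofReal_le_one.mpr ha)
  have hp : p⁻¹ < 1 := le_self_add.trans_lt sum_lt_one
  have hq : q⁻¹ < 1 := le_add_self.trans_lt sum_lt_one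
  have toReal_sum_lt : (p⁻¹).toReal + (q⁻¹).toReal < a := by
    rw [← ENNReal.toReal_add hp.ne_top hq.ne_top]
    exact (ENNReal.lt_ofReal_iff_toReal_lt (ENNReal.add_ne_top.mpr ⟨hp.ne_top, hq.ne_top⟩)).mp hpq
  obtain ⟨P, hP, P_lt, hpP⟩ :=
    exists_real_exponent (ENNReal.inv_lt_one.mp hp) (half_pos (sub_pos.mpr toReal_sum_lt))
  obtain ⟨Q, hQ, Q_lt, hqQ⟩ :=
    exists_real_exponent (ENNReal.inv_lt_one.mp hq) (half_pos (sub_pos.mpr toReal_sum_lt))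
  exact ⟨P, Q, hP, hQ, by linarith, hpP, hqQ⟩

variable {V : Type*} {A : Finset V} {f : V → ℝ}

theorem le_avgNorm_top {x : V} (hx : x ∈ A) : f x ≤ avgNorm ∞ A f := by
  rw [avgNorm, if_pos rfl]
  exact (le_abs_self _).trans
    (le_ciSup (f := fun x : A => |f x|) (Set.finite_range _).bddAbove ⟨x, hx⟩)

theorem rpow_sum_le_of_avgNorm_le (hA : A.Nonempty) {p : ℝ≥0∞} {P M : ℝ} (hP : 0 < P)
    (hpP : p = ∞ ∨ p = ENNReal.ofReal P) (hf : ∀ x, 0 ≤ f x) (hM : avgNorm p A f ≤ M) :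
    (∑ x ∈ A, f x ^ P) ^ (1 / P) ≤ M * (A.card : ℝ) ^ (1 / P) := by
  have card_pos : (0 : ℝ) < A.card := by exact_mod_cast hA.card_pos
  have sum_nonneg : 0 ≤ ∑ x ∈ A, f x ^ P := Finset.sum_nonneg fun x _ => Real.rpow_nonneg (hf x) _
  rcases hpP with rfl | rfl
  · have f_le (x : V) (hx : x ∈ A) : f x ≤ M := (le_avgNorm_top hx).trans hM
    obtain ⟨x₀, hx₀⟩ := hA
    have M_nonneg : 0 ≤ M := (hf x₀).trans (f_le x₀ hx₀)
    have sum_le : ∑ x ∈ A, f x ^ P ≤ M ^ P * A.card := by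
      rw [mul_comm, ← nsmul_eq_mul]
      exact Finset.sum_le_card_nsmul _ _ _ fun x hx => Real.rpow_le_rpow (hf x) (f_le x hx) hP.le
    calc _ ≤ (M ^ P * A.card) ^ (1 / P) := Real.rpow_le_rpow sum_nonneg sum_le (by positivity)
      _ = _ := by
        rw [Real.mul_rpow (Real.rpow_nonneg M_nonneg _) card_pos.le, ← Real.rpow_mul M_nonneg,
          mul_one_div_cancel hP.ne', Real.rpow_one]
  · rw [avgNorm, if_neg ENNReal.ofReal_ne_top, ENNReal.toReal_ofReal hP.le] at hM
    simp_rw [abs_of_nonneg (hf _)] at hM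
    rw [Real.mul_rpow (by positivity) sum_nonneg, Real.inv_rpow card_pos.le,
      inv_mul_le_iff₀ (Real.rpow_pos_of_pos card_pos _)] at hM
    rwa [mul_comm]

theorem rpow_sum_le_mul_rpow (hA : A.Nonempty) {p : ℝ≥0∞} {P M C R d : ℝ} (hP : 0 < P)
    (hpP : p = ∞ ∨ p = ENNReal.ofReal P) (hf : ∀ x, 0 ≤ f x) (hM0 : 0 ≤ M)
    (hM : avgNorm p A f ≤ M) (hC : 0 ≤ C) (hR : 0 ≤ R) (hcard : (A.card : ℝ) ≤ C * R ^ d) :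
    (∑ x ∈ A, f x ^ P) ^ (1 / P) ≤ M * C ^ (1 / P) * R ^ (d * (1 / P)) := by
  refine (rpow_sum_le_of_avgNorm_le hA hP hpP hf hM).trans ?_
  rw [mul_assoc, Real.rpow_mul hR, ← Real.mul_rpow hC (Real.rpow_nonneg hR _)]
  gcongr

end Exponents

section OnDiagonal

universe u

variable {V : Type u} {G : SimpleGraph V} [G.LocallyFinite] {ω : Conductances G} {x : V} {R : ℕ}
  {d d' Creg CS Mμ Mν : ℝ} {p q : ℝ≥0∞}

theorem self_mem_ball (hG : G.Connected) (x : V) (n : ℕ) : x ∈ ball G x n := by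
  rw [mem_ball G hG, SimpleGraph.dist_self]
  exact n.zero_le

/-- The assumptions on the environment in the single ball `B(x, R)`: an upper volume bound, the
local Sobolev inequality, and bounds on the averages of `μ^ω` and `ν^ω`. -/
structure RegularBall (ω : Conductances G) (d d' Creg CS : ℝ) (p q : ℝ≥0∞) (Mμ Mν : ℝ) (x : V)
    (R : ℕ) : Prop where
  card_le : ((ball G x R).card : ℝ) ≤ Creg * (R : ℝ) ^ d
  sobolev : ∀ u : V → ℝ, (∀ y, y ∉ ball G x R → u y = 0) →
    (∑ y ∈ ball G x R, |u y| ^ (d' / (d' - 1))) ^ ((d' - 1) / d') ≤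
      CS * (R : ℝ) ^ (1 - d / d') * ∑ e ∈ edgesMeetingBall G x R, edgeDiff u e
  avgNorm_mu_le : avgNorm p (ball G x R) (mu ω) ≤ Mμ
  avgNorm_nu_le : avgNorm q (ball G x R) (nu ω) ≤ Mν

/-- The scale-invariant on-diagonal decay rate `R ^ (-d)` of the heat kernel killed outside a ball
of radius `R`, with polynomial loss in `R ^ 2 / t`. -/
def onDiagonalRate (d γ R t : ℝ) : ℝ :=
  R ^ (-d) * (R ^ 2 / t) ^ γ

/-- An `ℓ²` bound for the heat kernel killed outside `B(x, R)`, which by symmetry and the semigroup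
property is an on-diagonal bound, and a polynomial lower bound for the speed measure. -/
structure OnDiagonalBound (ω : Conductances G) (x : V) (R : ℕ) (d γ g C₁ C₂ : ℝ) : Prop where
  sq_le : ∀ y ∈ ball G x R, ∀ t : ℝ, 0 < t →
    ∑ z ∈ ball G x R, mu ω z *
      killedKernel (conductance ω) (mu ω) (ball G x R) y t z ^ 2 ≤
      C₁ * onDiagonalRate d γ R t
  inv_mu_le : ∀ y ∈ ball G x R, (mu ω y)⁻¹ ≤ C₂ * (R : ℝ) ^ g

namespace RegularBall

variable {P Q θ : ℝ}

theorem sobolevInequality (h : RegularBall ω d d' Creg CS p q Mμ Mν x R) (hCS : 0 ≤ CS) :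
    SobolevInequality G (ball G x R) d' (CS * (R : ℝ) ^ (1 - d / d')) := fun u hu =>
  (h.sobolev u hu).trans (mul_le_mul_of_nonneg_left (sum_edgesMeetingBall_le u x R) (by positivity))

theorem nashInequality (h : RegularBall ω d d' Creg CS p q Mμ Mν x R) (hx : x ∈ ball G x R)
    (hw : IsWeight (conductance ω) (mu ω)) (hR : 0 < R) (hd' : 2 ≤ d') (hCreg : 0 ≤ Creg)
    (hCS : 0 ≤ CS) (hMμ : 0 ≤ Mμ) (hMν : 0 ≤ Mν) (hP : 1 < P) (hQ : 1 < Q)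
    (hpP : p = ∞ ∨ p = ENNReal.ofReal P) (hqQ : q = ∞ ∨ q = ENNReal.ofReal Q)
    (hθ : θ * (1 - 1 / P) = sobolevExponent d' Q) (hθ0 : 0 < θ) (hθ1 : θ < 1) :
    NashInequality (conductance ω) (mu ω) (ball G x R) (1 - θ)
      (32 * (CS / sobolevExponent d' Q) ^ 2 * (Mν * Creg ^ (1 / Q)) * (Mμ * Creg ^ (1 / P)) ^ θ *
        (R : ℝ) ^ (2 - d * (1 - θ))) := by
  intro f hf hfA mass_le
  have R_pos : (0 : ℝ) < R := Nat.cast_pos.mpr hR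
  refine ((h.sobolevInequality hCS).nashInequality ω hw hd' hP hQ hθ hθ0 hθ1 f hf hfA
    mass_le).trans (mul_le_mul_of_nonneg_right ?_ (hw.killedEnergy_nonneg f))
  set σ := sobolevExponent d' Q
  have mu_moment : (∑ z ∈ ball G x R, mu ω z ^ P) ^ (1 / P) ≤ _ :=
    rpow_sum_le_mul_rpow ⟨x, hx⟩ (by linarith) hpP (mu_nonneg ω) hMμ h.avgNorm_mu_le hCreg
      R_pos.le h.card_le
  have nu_moment : (∑ z ∈ ball G x R, nu ω z ^ Q) ^ (1 / Q) ≤ _ :=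
    rpow_sum_le_mul_rpow ⟨x, hx⟩ (by linarith) hqQ (nu_nonneg ω) hMν h.avgNorm_nu_le hCreg
      R_pos.le h.card_le
  have mu_nonneg' : 0 ≤ (∑ z ∈ ball G x R, mu ω z ^ P) ^ (1 / P) :=
    Real.rpow_nonneg (Finset.sum_nonneg fun z _ => Real.rpow_nonneg (mu_nonneg ω z) _) _
  have exponent_sum : (1 - d / d') * 2 + d * (1 / Q) + d * (1 / P) * θ = 2 - d * (1 - θ) := by
    have : θ * (1 - 1 / P) = 1 - 2 / d' + 1 / Q := hθ
    linear_combination -d * this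
  calc _ ≤ 32 * (CS * (R : ℝ) ^ (1 - d / d') / σ) ^ 2 *
        (Mν * Creg ^ (1 / Q) * (R : ℝ) ^ (d * (1 / Q))) *
        (Mμ * Creg ^ (1 / P) * (R : ℝ) ^ (d * (1 / P))) ^ θ := by gcongr
    _ = 32 * (CS / σ) ^ 2 * (Mν * Creg ^ (1 / Q)) * (Mμ * Creg ^ (1 / P)) ^ θ *
        (((R : ℝ) ^ (1 - d / d')) ^ 2 * (R : ℝ) ^ (d * (1 / Q)) *
          ((R : ℝ) ^ (d * (1 / P))) ^ θ) := by
        rw [Real.mul_rpow (by positivity) (by positivity)]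
        ring
    _ = _ := by
        rw [← exponent_sum, Real.rpow_add R_pos, Real.rpow_add R_pos, Real.rpow_mul R_pos.le _ θ,
          Real.rpow_mul R_pos.le _ 2, Real.rpow_two]

theorem inv_mu_le [Nontrivial V] (hG : G.Connected) (h : RegularBall ω d d' Creg CS p q Mμ Mν x R)
    (hCreg : 0 ≤ Creg) (hMν : 0 ≤ Mν) (hQ : 0 < Q) (hqQ : q = ∞ ∨ q = ENNReal.ofReal Q) {y : V}
    (hy : y ∈ ball G x R) : (mu ω y)⁻¹ ≤ Mν * Creg ^ (1 / Q) * (R : ℝ) ^ (d * (1 / Q)) := by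
  calc (mu ω y)⁻¹ ≤ nu ω y := inv_mu_le_nu ω hG y
    _ = (nu ω y ^ Q) ^ (1 / Q) := by
        rw [← Real.rpow_mul (nu_nonneg ω y), mul_one_div_cancel hQ.ne', Real.rpow_one]
    _ ≤ (∑ z ∈ ball G x R, nu ω z ^ Q) ^ (1 / Q) :=
        Real.rpow_le_rpow (Real.rpow_nonneg (nu_nonneg ω y) _)
          (Finset.single_le_sum (f := fun z => nu ω z ^ Q)
            (fun z _ => Real.rpow_nonneg (nu_nonneg ω z) _) hy) (by positivity)
    _ ≤ _ := rpow_sum_le_mul_rpow ⟨y, hy⟩ hQ hqQ (nu_nonneg ω) hMν h.avgNorm_nu_le hCreg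
        R.cast_nonneg h.card_le

end RegularBall

theorem rpow_nash_rate_eq {S R t d β : ℝ} (hS : 0 ≤ S) (hR : 0 < R) (ht : 0 < t) (hβ : 0 < β) :
    (S * R ^ (2 - d * β) / (2 * β * t)) ^ (1 / β) =
      (S / (2 * β)) ^ (1 / β) * onDiagonalRate d (1 / β) R t := by
  have split_rate :
      S * R ^ (2 - d * β) / (2 * β * t) = S / (2 * β) * R ^ (-d * β) * (R ^ 2 / t) := by
    rw [show 2 - d * β = -d * β + 2 by ring, Real.rpow_add hR, Real.rpow_two]
    field_simp
  rw [split_rate, Real.mul_rpow (by positivity) (by positivity),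
    Real.mul_rpow (by positivity) (by positivity), ← Real.rpow_mul hR.le, mul_assoc (-d),
    mul_one_div_cancel hβ.ne', mul_one, onDiagonalRate, mul_assoc]

theorem exists_onDiagonalBound (hd : 0 < d) (hd' : 2 ≤ d') (hCreg : 0 < Creg) (hCS : 0 < CS)
    (hpq : p⁻¹ + q⁻¹ < ENNReal.ofReal (2 / d')) (hMμ : 0 < Mμ) (hMν : 0 < Mν) :
    ∃ γ g C₁ C₂ : ℝ, 0 < γ ∧ 0 < g ∧ 0 < C₁ ∧ 0 < C₂ ∧
      ∀ (V : Type u) [Nontrivial V] (G : SimpleGraph V) [G.LocallyFinite], G.Connected →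
      ∀ (ω : Conductances G) (x : V) (R : ℕ), 0 < R →
        RegularBall ω d d' Creg CS p q Mμ Mν x R → OnDiagonalBound ω x R d γ g C₁ C₂ := by
  obtain ⟨P, Q, hP, hQ, hPQ, hpP, hqQ⟩ :=
    exists_real_exponents ((div_le_one (by linarith)).mpr hd') hpq
  have P_conj : 0 < 1 - 1 / P := sub_pos.mpr ((div_lt_one (by linarith)).mpr hP)
  set σ := sobolevExponent d' Q with hσ
  have σ_pos : 0 < σ := sobolevExponent_pos hd' (by linarith)
  set θ := σ / (1 - 1 / P)
  have θ_pos : 0 < θ := div_pos σ_pos P_conj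
  have θ_lt_one : θ < 1 := by
    rw [div_lt_one P_conj, hσ, sobolevExponent]
    linarith
  have hθ : θ * (1 - 1 / P) = σ := div_mul_cancel₀ _ P_conj.ne'
  have β_pos : 0 < 1 - θ := sub_pos.mpr θ_lt_one
  set S := 32 * (CS / σ) ^ 2 * (Mν * Creg ^ (1 / Q)) * (Mμ * Creg ^ (1 / P)) ^ θ
  have S_pos : 0 < S := by positivity
  refine ⟨1 / (1 - θ), d * (1 / Q), (S / (2 * (1 - θ))) ^ (1 / (1 - θ)), Mν * Creg ^ (1 / Q),
    by positivity, by positivity, by positivity, by positivity, ?_⟩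
  intro V _ G _ hG ω x R hR h
  have hw := isWeight_conductance ω hG
  have R_pos : (0 : ℝ) < R := Nat.cast_pos.mpr hR
  have nash := h.nashInequality (self_mem_ball hG x R) hw hR hd' hCreg.le hCS.le hMμ.le hMν.le
    hP hQ hpP hqQ hθ θ_pos θ_lt_one
  exact {
    sq_le := fun y hy t ht => (nash.sum_mul_killedKernel_sq_le hw hy β_pos (by positivity)
      ht).trans_eq (rpow_nash_rate_eq S_pos.le R_pos ht β_pos)
    inv_mu_le := fun y hy => h.inv_mu_le hG hCreg.le hMν.le (by linarith) hqQ hy }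

end OnDiagonal

section DaviesBound

variable {V : Type*} {c : V → V → ℝ} {m : V → ℝ} {A : Finset V} {y z : V} {ψ ρ : V → ℝ}
  {θ r r' s t H : ℝ}

theorem sum_mul_mul_killedKernel_zero_sq (h : IsWeight c m) (hy : y ∈ A) (φ : V → ℝ) :
    ∑ z ∈ A, m z * (φ z * killedKernel c m A y 0 z) ^ 2 = φ y ^ 2 * (m y)⁻¹ := by
  calc _ = ∑ z ∈ A, m z * ((φ z ^ 2 * killedKernel c m A y 0 z) * killedKernel c m A y 0 z) :=
        Finset.sum_congr rfl fun z _ => by ring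
    _ = _ := by
        rw [sum_mul_mul_killedKernel_zero h hy fun z => φ z ^ 2 * killedKernel c m A y 0 z,
          killedKernel_zero, if_pos rfl]

theorem sum_exp_mul_killedKernel_sq_le (h : IsWeight c m) (hy : y ∈ A)
    (hψ : ∀ z w, c z w ≠ 0 → |ψ z - ψ w| ≤ θ) (ht : 0 ≤ t) :
    ∑ z ∈ A, m z * (Real.exp (ψ z) * killedKernel c m A y t z) ^ 2 ≤
      Real.exp (2 * (Real.cosh θ - 1) * t) * (Real.exp (ψ y) ^ 2 * (m y)⁻¹) := by
  have davies := (isHeatSolution_killedKernel h hy).sum_exp_mul_sq_le h hψ ht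
  rwa [sub_zero, sum_mul_mul_killedKernel_zero_sq h hy fun z => Real.exp (ψ z)] at davies

theorem killedKernel_le_exp (h : IsWeight c m) (hy : y ∈ A) (hz : z ∈ A)
    (hψ : ∀ z w, c z w ≠ 0 → |ψ z - ψ w| ≤ θ) (ht : 0 ≤ t) (hyH : (m y)⁻¹ ≤ H)
    (hzH : (m z)⁻¹ ≤ H) :
    killedKernel c m A y t z ≤ H * Real.exp ((Real.cosh θ - 1) * t - (ψ z - ψ y)) := by
  have hmy := h.pos y
  have hmz := h.pos z
  have H_nonneg : 0 ≤ H := (inv_pos.mpr hmz).le.trans hzH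
  have single : m z * (Real.exp (ψ z) * killedKernel c m A y t z) ^ 2 ≤
      Real.exp (2 * (Real.cosh θ - 1) * t) * (Real.exp (ψ y) ^ 2 * (m y)⁻¹) :=
    (Finset.single_le_sum
      (f := fun z => m z * (Real.exp (ψ z) * killedKernel c m A y t z) ^ 2)
      (fun w _ => mul_nonneg (h.pos w).le (sq_nonneg _)) hz).trans
      (sum_exp_mul_killedKernel_sq_le h hy hψ ht)
  have weighted : Real.exp (ψ z) * killedKernel c m A y t z ≤
      H * (Real.exp ((Real.cosh θ - 1) * t) * Real.exp (ψ y)) := by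
    refine le_of_sq_le_sq ?_ (by positivity)
    calc _ ≤ (m z)⁻¹ * (Real.exp (2 * (Real.cosh θ - 1) * t) *
            (Real.exp (ψ y) ^ 2 * (m y)⁻¹)) := (le_inv_mul_iff₀ hmz).mpr single
      _ ≤ H * (Real.exp (2 * (Real.cosh θ - 1) * t) * (Real.exp (ψ y) ^ 2 * H)) := by
          gcongr
      _ = _ := by
          rw [mul_assoc 2, two_mul, Real.exp_add]
          ring
  rw [sub_sub_eq_add_sub, Real.exp_sub, Real.exp_add, ← mul_div_assoc, le_div_iff₀ (Real.exp_pos _),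
    mul_comm]
  exact weighted

theorem killedKernel_self_le (h : IsWeight c m) (hy : y ∈ A) (ht : 0 ≤ t) :
    killedKernel c m A y t y ≤ (m y)⁻¹ := by
  simpa using killedKernel_le_exp (ψ := 0) (θ := 0) h hy hy (by simp) ht le_rfl le_rfl

open Classical in
/-- The `ℓ²(m)` mass on `{ρ ≥ r}`, at time `t`, of the killed heat kernel started from `y`. The
function `ρ` plays the role of the distance to `y`. -/
def farMass (c : V → V → ℝ) (m : V → ℝ) (A : Finset V) (y : V) (ρ : V → ℝ) (r t : ℝ) : ℝ :=
  ∑ z ∈ A with r ≤ ρ z, m z * killedKernel c m A y t z ^ 2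

theorem farMass_le_sum (h : IsWeight c m) (r t : ℝ) :
    farMass c m A y ρ r t ≤ ∑ z ∈ A, m z * killedKernel c m A y t z ^ 2 :=
  Finset.sum_le_sum_of_subset_of_nonneg (Finset.filter_subset _ _)
    fun z _ _ => mul_nonneg (h.pos z).le (sq_nonneg _)

theorem farMass_le_sum_exp_mul_sq (h : IsWeight c m) (hψ : ∀ z, r ≤ ρ z → 0 ≤ ψ z) :
    farMass c m A y ρ r t ≤ ∑ z ∈ A, m z * (Real.exp (ψ z) * killedKernel c m A y t z) ^ 2 := by
  refine (Finset.sum_le_sum fun z hz => ?_).trans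
    (Finset.sum_le_sum_of_subset_of_nonneg (Finset.filter_subset _ A)
      fun z _ _ => mul_nonneg (h.pos z).le (sq_nonneg _))
  rw [mul_pow]
  exact mul_le_mul_of_nonneg_left (le_mul_of_one_le_left (sq_nonneg _)
    (one_le_pow₀ (Real.one_le_exp (hψ z (Finset.mem_filter.mp hz).2)))) (h.pos z).le

theorem farMass_le_exp (h : IsWeight c m) (hy : y ∈ A) (hρ : ∀ z w, c z w ≠ 0 → |ρ z - ρ w| ≤ 1)
    (hρy : ρ y = 0) (hθ : 0 ≤ θ) (ht : 0 ≤ t) :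
    farMass c m A y ρ r t ≤ Real.exp (2 * (Real.cosh θ - 1) * t - 2 * (θ * r)) * (m y)⁻¹ := by
  calc _ ≤ ∑ z ∈ A, m z * (Real.exp (θ * (ρ z - r)) * killedKernel c m A y t z) ^ 2 :=
        farMass_le_sum_exp_mul_sq h fun z hz => mul_nonneg hθ (sub_nonneg.mpr hz)
    _ ≤ Real.exp (2 * (Real.cosh θ - 1) * t) * (Real.exp (θ * (ρ y - r)) ^ 2 * (m y)⁻¹) := by
        refine sum_exp_mul_killedKernel_sq_le h hy (fun z w hc => ?_) ht
        rw [← mul_sub, abs_mul, abs_of_nonneg hθ, sub_sub_sub_cancel_right]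
        exact mul_le_of_le_one_right hθ (hρ z w hc)
    _ = _ := by
        rw [hρy, ← mul_assoc, ← Real.exp_nat_mul, ← Real.exp_add]
        push_cast
        ring_nf

theorem farMass_le_exp_mul_farMass_add (h : IsWeight c m) (hy : y ∈ A)
    (hρ : ∀ z w, c z w ≠ 0 → |ρ z - ρ w| ≤ 1) (hθ : 0 ≤ θ) (hst : s ≤ t) :
    farMass c m A y ρ r t ≤ Real.exp (2 * (Real.cosh θ - 1) * (t - s)) *
      (farMass c m A y ρ r' s + Real.exp (-(2 * (θ * (r - r')))) *
        ∑ z ∈ A, m z * killedKernel c m A y s z ^ 2) := by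
  classical
  set φ : V → ℝ := fun z => θ * min (ρ z - r) 0
  have lipschitz : ∀ z w, c z w ≠ 0 → |φ z - φ w| ≤ θ := fun z w hc => by
    rw [← mul_sub, abs_mul, abs_of_nonneg hθ]
    refine mul_le_of_le_one_right hθ ((abs_min_sub_min_le_max _ _ _ _).trans ?_)
    simpa using hρ z w hc
  refine (farMass_le_sum_exp_mul_sq h fun z hz => ?_).trans
    (((isHeatSolution_killedKernel h hy).sum_exp_mul_sq_le h lipschitz hst).trans
      (mul_le_mul_of_nonneg_left ?_ (Real.exp_pos _).le))
  · exact mul_nonneg hθ (le_min (sub_nonneg.mpr hz) le_rfl)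
  rw [farMass, Finset.mul_sum, Finset.sum_filter, ← Finset.sum_add_distrib]
  refine Finset.sum_le_sum fun z _ => ?_
  have term_nonneg : 0 ≤ m z * killedKernel c m A y s z ^ 2 :=
    mul_nonneg (h.pos z).le (sq_nonneg _)
  rw [mul_pow, mul_left_comm, ← Real.exp_nat_mul]
  split_ifs with hz
  · refine (mul_le_of_le_one_left term_nonneg (Real.exp_le_one_iff.mpr ?_)).trans
      (le_add_of_nonneg_right (mul_nonneg (Real.exp_pos _).le term_nonneg))
    exact mul_nonpos_of_nonneg_of_nonpos (Nat.cast_nonneg _)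
      (mul_nonpos_of_nonneg_of_nonpos hθ (min_le_right _ _))
  · rw [zero_add]
    refine mul_le_mul_of_nonneg_right (Real.exp_le_exp.mpr ?_) term_nonneg
    have : θ * min (ρ z - r) 0 ≤ θ * (r' - r) :=
      mul_le_mul_of_nonneg_left ((min_le_left _ _).trans (by linarith)) hθ
    push_cast
    linarith

theorem sum_mul_killedKernel_mul_le_sqrt (h : IsWeight c m) (B : Finset V) (y z : V) (t : ℝ) :
    ∑ w ∈ B, m w * (killedKernel c m A z t w * killedKernel c m A y t w) ≤
      √((∑ w ∈ B, m w * killedKernel c m A z t w ^ 2) *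
        ∑ w ∈ B, m w * killedKernel c m A y t w ^ 2) :=
  Real.le_sqrt_of_sq_le (Finset.sum_sq_le_sum_mul_sum_of_sq_le_mul _
    (fun w _ => mul_nonneg (h.pos w).le (sq_nonneg _))
    (fun w _ => mul_nonneg (h.pos w).le (sq_nonneg _)) fun w _ => le_of_eq (by ring))

theorem killedKernel_le_of_farMass_le (h : IsWeight c m) (hy : y ∈ A) (hz : z ∈ A)
    {ρ' : V → ℝ} {J F : ℝ} (hcover : ∀ w, r ≤ ρ w ∨ r ≤ ρ' w) (hJ0 : 0 ≤ J)
    (hJy : farMass c m A y ρ r t ≤ J) (hJz : farMass c m A z ρ' r t ≤ J)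
    (hFy : ∑ w ∈ A, m w * killedKernel c m A y t w ^ 2 ≤ F)
    (hFz : ∑ w ∈ A, m w * killedKernel c m A z t w ^ 2 ≤ F) :
    killedKernel c m A y (t + t) z ≤ 2 * √(J * F) := by
  classical
  have sum_sq_nonneg (B : Finset V) (v : V) : 0 ≤ ∑ w ∈ B, m w * killedKernel c m A v t w ^ 2 :=
    Finset.sum_nonneg fun w _ => mul_nonneg (h.pos w).le (sq_nonneg _)
  have far_from_y :
      ∑ w ∈ A with r ≤ ρ w, m w * (killedKernel c m A z t w * killedKernel c m A y t w) ≤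
        √(J * F) := by
    refine (sum_mul_killedKernel_mul_le_sqrt h _ y z t).trans (Real.sqrt_le_sqrt ?_)
    rw [mul_comm]
    exact mul_le_mul hJy ((farMass_le_sum h r t).trans hFz) (sum_sq_nonneg _ _) hJ0
  have far_from_z :
      ∑ w ∈ A with ¬ r ≤ ρ w, m w * (killedKernel c m A z t w * killedKernel c m A y t w) ≤
        √(J * F) := by
    refine (sum_mul_killedKernel_mul_le_sqrt h _ y z t).trans (Real.sqrt_le_sqrt ?_)
    refine mul_le_mul (le_trans (Finset.sum_le_sum_of_subset_of_nonneg (fun w hw => ?_)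
      fun w _ _ => mul_nonneg (h.pos w).le (sq_nonneg _)) hJz)
      ((Finset.sum_le_sum_of_subset_of_nonneg (Finset.filter_subset _ _)
        fun w _ _ => mul_nonneg (h.pos w).le (sq_nonneg _)).trans hFy) (sum_sq_nonneg _ _) hJ0
    rw [Finset.mem_filter] at hw ⊢
    exact ⟨hw.1, (hcover w).resolve_left hw.2⟩
  rw [killedKernel_add h hz hy, ← Finset.sum_filter_add_sum_filter_not A (fun w => r ≤ ρ w)]
  linarith

end DaviesBound

section FarMassIteration

theorem cosh_sub_one_le_sq {x : ℝ} (hx0 : 0 ≤ x) (hx1 : x ≤ 1) : Real.cosh x - 1 ≤ x ^ 2 := by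
  have half_sq_lt_one : x ^ 2 / 2 < 1 := by nlinarith
  have exp_le := Real.exp_bound_div_one_sub_of_interval (by positivity) half_sq_lt_one
  have div_le : 1 / (1 - x ^ 2 / 2) ≤ 1 + x ^ 2 := by
    rw [div_le_iff₀ (by linarith)]
    nlinarith [mul_nonneg (sq_nonneg x) (by nlinarith : 0 ≤ 1 - x ^ 2)]
  linarith [Real.cosh_le_exp_half_sq x]

/-- The bound on `farMass` at distance `r` and time `t` produced by the iteration. The factor
`κ = (m y)⁻¹` enters only with a stretched exponential weight. -/
def farMassBound (K γ κ r t : ℝ) : ℝ :=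
  2 ^ (4 * (γ + 1)) * (K * t ^ (-γ)) * Real.exp (-(r ^ 2 / t / 256)) +
    Real.exp (-(r ^ 2 / t / 512 + √(r ^ 2 / t * r) / 8)) * κ

variable {K γ κ r t : ℝ}

theorem half_rpow_neg (ht : 0 ≤ t) : (t / 2) ^ (-γ) = 2 ^ γ * t ^ (-γ) := by
  rw [Real.div_rpow ht zero_le_two, Real.rpow_neg zero_le_two, div_inv_eq_mul, mul_comm]

theorem farMassBound_half_le (hr : 0 ≤ r) (ht : 0 < t) (hK : 0 ≤ K) (hκ : 0 ≤ κ) :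
    farMassBound K γ κ (7 / 8 * r) (t / 2) ≤
      2 ^ γ * (2 ^ (4 * (γ + 1)) * (K * t ^ (-γ)) * Real.exp (-(r ^ 2 / t / 256)) *
        Real.exp (-(r ^ 2 / t / 512))) +
      Real.exp (-(r ^ 2 / t / 1024)) *
        (Real.exp (-(r ^ 2 / t / 512 + √(r ^ 2 / t * r) / 8)) * κ) := by
  set Z := r ^ 2 / t with hZ
  have Z_nonneg : 0 ≤ Z := by positivity
  have half_Z : (7 / 8 * r) ^ 2 / (t / 2) = 49 / 32 * Z := by
    rw [hZ]
    ring
  have sqrt_le : √(Z * r) ≤ √(49 / 32 * Z * (7 / 8 * r)) := by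
    refine Real.sqrt_le_sqrt ?_
    nlinarith [mul_nonneg Z_nonneg hr]
  rw [farMassBound, half_Z, half_rpow_neg ht.le]
  refine add_le_add ?_ ?_
  · calc _ = 2 ^ γ * (2 ^ (4 * (γ + 1)) * (K * t ^ (-γ)) * Real.exp (-(49 / 32 * Z / 256))) := by
          ring
      _ ≤ _ := by
          rw [mul_assoc _ (Real.exp _) (Real.exp _), ← Real.exp_add]
          gcongr
          linarith
  · rw [← mul_assoc (Real.exp _), ← Real.exp_add]
    gcongr
    linarith

theorem farMassBound_step (hr : 0 ≤ r) (ht : 0 < t) (hK : 0 ≤ K) (hκ : 0 ≤ κ) (hγ : 0 ≤ γ)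
    (hZ : 1024 * ((γ + 1) * Real.log 2) ≤ r ^ 2 / t) :
    Real.exp (r ^ 2 / t / 1024) * (farMassBound K γ κ (7 / 8 * r) (t / 2) +
      Real.exp (-(r ^ 2 / t / 128)) * (K * (t / 2) ^ (-γ))) ≤ farMassBound K γ κ r t := by
  refine (mul_le_mul_of_nonneg_left (add_le_add_left (farMassBound_half_le hr ht hK hκ) _)
    (Real.exp_pos _).le).trans ?_
  rw [half_rpow_neg ht.le, farMassBound, mul_left_comm K]
  set Z := r ^ 2 / t
  set E := Real.exp (-(Z / 1024)) with hE
  set L : ℝ := 2 ^ (4 * (γ + 1))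
  have E_pos : 0 < E := Real.exp_pos _
  have one_le_L : 1 ≤ L := Real.one_le_rpow one_le_two (by linarith)
  have exp_neg_mul (n : ℕ) : Real.exp (-(n * (Z / 1024))) = E ^ n := by
    rw [hE, ← Real.exp_nat_mul, mul_neg]
  have absorb : 2 ^ γ * E ≤ 1 / 2 := by
    have : (2 : ℝ) ^ γ * E * 2 ≤ 1 := by
      rw [mul_right_comm, ← Real.rpow_add_one two_ne_zero, Real.rpow_def_of_pos two_pos, hE,
        ← Real.exp_add, Real.exp_le_one_iff]
      linarith
    linarith
  have E_sq_le_one : E ^ 2 ≤ 1 := pow_le_one₀ E_pos.le (Real.exp_le_one_iff.mpr (by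
    have : 0 ≤ Z := by positivity
    linarith))
  rw [show Z / 1024 = -(-(Z / 1024)) by ring, Real.exp_neg, ← hE,
    show Z / 256 = (4 : ℕ) * (Z / 1024) by push_cast; ring, exp_neg_mul,
    show -(Z / 512) = -((2 : ℕ) * (Z / 1024)) by push_cast; ring, exp_neg_mul,
    show Z / 128 = (8 : ℕ) * (Z / 1024) by push_cast; ring, exp_neg_mul]
  set T := K * t ^ (-γ)
  have T_nonneg : 0 ≤ T := by positivity
  set stretched := Real.exp (-(Z / 512 + √(Z * r) / 8)) * κ
  calc _ = L * T * E ^ 4 * (2 ^ γ * E) + stretched + T * E ^ 4 * E ^ 2 * (2 ^ γ * E) := by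
        field_simp
    _ ≤ L * T * E ^ 4 * (1 / 2) + stretched + L * T * E ^ 4 * 1 * (1 / 2) := by
        gcongr
        exact le_mul_of_one_le_left T_nonneg one_le_L
    _ = _ := by ring

variable {V : Type*} {c : V → V → ℝ} {m : V → ℝ} {A : Finset V} {y : V} {ρ : V → ℝ}

theorem farMass_le_farMassBound_of_le (h : IsWeight c m) (hy : y ∈ A)
    (hρ : ∀ z w, c z w ≠ 0 → |ρ z - ρ w| ≤ 1) (hρy : ρ y = 0) (hK : 0 ≤ K) (hr : 0 < r)
    (hrt : r / 64 ≤ t) (htr : t ≤ r / 32) :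
    farMass c m A y ρ r t ≤ farMassBound K γ (m y)⁻¹ r t := by
  have ht : 0 < t := lt_of_lt_of_le (by positivity) hrt
  have Z_le : r ^ 2 / t ≤ 64 * r := by
    rw [div_le_iff₀ ht]
    nlinarith
  have sqrt_le : √(r ^ 2 / t * r) ≤ 8 * r := Real.sqrt_le_iff.mpr ⟨by positivity, by nlinarith⟩
  have cosh_le := cosh_sub_one_le_sq zero_le_one le_rfl
  refine (farMass_le_exp h hy hρ hρy zero_le_one ht.le).trans
    ((mul_le_mul_of_nonneg_right (Real.exp_le_exp.mpr ?_) (inv_pos.mpr (h.pos y)).le).trans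
      (le_add_of_nonneg_left (by positivity)))
  nlinarith

theorem le_farMassBound_of_sq_div_lt (hK : 0 ≤ K) (hκ : 0 ≤ κ) (ht : 0 < t)
    (hZ : r ^ 2 / t < 1024 * ((γ + 1) * Real.log 2)) : K * t ^ (-γ) ≤ farMassBound K γ κ r t := by
  have one_le : 1 ≤ 2 ^ (4 * (γ + 1)) * Real.exp (-(r ^ 2 / t / 256)) := by
    rw [Real.rpow_def_of_pos two_pos, ← Real.exp_add]
    exact Real.one_le_exp (by linarith)
  calc _ ≤ K * t ^ (-γ) * (2 ^ (4 * (γ + 1)) * Real.exp (-(r ^ 2 / t / 256))) :=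
        le_mul_of_one_le_right (by positivity) one_le
    _ = 2 ^ (4 * (γ + 1)) * (K * t ^ (-γ)) * Real.exp (-(r ^ 2 / t / 256)) := by ring
    _ ≤ _ := le_add_of_nonneg_right (by positivity)

theorem farMass_le_exp_mul_farMass_half_add (h : IsWeight c m) (hy : y ∈ A)
    (hρ : ∀ z w, c z w ≠ 0 → |ρ z - ρ w| ≤ 1) (hr : 0 ≤ r) (ht : 0 < t) (hrt : r / 32 ≤ t)
    (hdiag : ∀ s : ℝ, 0 < s → ∑ z ∈ A, m z * killedKernel c m A y s z ^ 2 ≤ K * s ^ (-γ)) :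
    farMass c m A y ρ r t ≤ Real.exp (r ^ 2 / t / 1024) *
      (farMass c m A y ρ (7 / 8 * r) (t / 2) +
        Real.exp (-(r ^ 2 / t / 128)) * (K * (t / 2) ^ (-γ))) := by
  have farMass_nonneg : 0 ≤ farMass c m A y ρ (7 / 8 * r) (t / 2) :=
    Finset.sum_nonneg fun z _ => mul_nonneg (h.pos z).le (sq_nonneg _)
  have diag_nonneg : 0 ≤ ∑ z ∈ A, m z * killedKernel c m A y (t / 2) z ^ 2 :=
    Finset.sum_nonneg fun z _ => mul_nonneg (h.pos z).le (sq_nonneg _)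
  have diag_half := hdiag (t / 2) (by positivity)
  -- `θ = r / (32 t)` balances the growth `θ² t` against the gain `θ r / 4`.
  set θ := r / (32 * t) with hθ
  have θ_nonneg : 0 ≤ θ := by positivity
  have θ_le_one : θ ≤ 1 := (div_le_one (by positivity)).mpr (by linarith)
  have growth : 2 * (Real.cosh θ - 1) * (t - t / 2) ≤ r ^ 2 / t / 1024 := by
    have : θ ^ 2 * t = r ^ 2 / t / 1024 := by
      rw [hθ]
      field_simp
      norm_num
    nlinarith [mul_le_mul_of_nonneg_right (cosh_sub_one_le_sq θ_nonneg θ_le_one) ht.le]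
  have gain : 2 * (θ * (r - 7 / 8 * r)) = r ^ 2 / t / 128 := by
    rw [hθ]
    field_simp
    ring
  refine (farMass_le_exp_mul_farMass_add (r' := 7 / 8 * r) h hy hρ θ_nonneg
    (half_le_self ht.le)).trans ?_
  rw [gain]
  gcongr

theorem farMass_le_farMassBound (h : IsWeight c m) (hy : y ∈ A)
    (hρ : ∀ z w, c z w ≠ 0 → |ρ z - ρ w| ≤ 1) (hρy : ρ y = 0) (hK : 0 ≤ K) (hγ : 0 ≤ γ)
    (hdiag : ∀ s : ℝ, 0 < s → ∑ z ∈ A, m z * killedKernel c m A y s z ^ 2 ≤ K * s ^ (-γ))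
    (hr : 0 < r) (hrt : r / 64 ≤ t) :
    farMass c m A y ρ r t ≤ farMassBound K γ (m y)⁻¹ r t := by
  have inv_nonneg : 0 ≤ (m y)⁻¹ := (inv_pos.mpr (h.pos y)).le
  obtain ⟨n, hn⟩ := pow_unbounded_of_one_lt (t / (r / 32)) (by norm_num : (1 : ℝ) < 7 / 4)
  rw [div_lt_iff₀ (by positivity)] at hn
  -- Each step replaces `(r, t)` by `(7 r / 8, t / 2)`, dividing `t / r` by `7 / 4`.
  induction n generalizing r t with
  | zero =>
    exact farMass_le_farMassBound_of_le h hy hρ hρy hK hr hrt (by linarith)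
  | succ n ih =>
    have ht : 0 < t := lt_of_lt_of_le (by positivity) hrt
    rcases le_total t (r / 32) with htr | htr
    · exact farMass_le_farMassBound_of_le h hy hρ hρy hK hr hrt htr
    rcases lt_or_ge (r ^ 2 / t) (1024 * ((γ + 1) * Real.log 2)) with hZ | hZ
    · exact (farMass_le_sum h r t).trans
        ((hdiag t ht).trans (le_farMassBound_of_sq_div_lt hK inv_nonneg ht hZ))
    · have half_le := ih (r := 7 / 8 * r) (t := t / 2) (by positivity) (by linarith) (by
        rw [pow_succ] at hn
        linarith)
      refine (farMass_le_exp_mul_farMass_half_add h hy hρ hr.le ht htr hdiag).trans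
        (le_trans ?_ (farMassBound_step hr.le ht hK inv_nonneg hγ hZ))
      gcongr

end FarMassIteration

section ExponentialAbsorption

variable {k a x g d : ℝ}

theorem rpow_mul_exp_neg_le (hk : 0 ≤ k) (ha : 0 < a) (hx : 0 ≤ x) :
    x ^ k * Real.exp (-(a * x)) ≤ (k / a) ^ k := by
  rcases hk.eq_or_lt with rfl | hk
  · rw [Real.rpow_zero, Real.rpow_zero, one_mul, Real.exp_le_one_iff]
    exact neg_nonpos.mpr (by positivity)
  have rescale : x = k / a * (a * x / k) := by field_simp
  have rpow_le_exp : (a * x / k) ^ k ≤ Real.exp (a * x) := by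
    calc (a * x / k) ^ k ≤ Real.exp (a * x / k) ^ k := by
          refine Real.rpow_le_rpow (by positivity) ?_ hk.le
          linarith [Real.add_one_le_exp (a * x / k)]
      _ = Real.exp (a * x) := by rw [← Real.exp_mul, div_mul_cancel₀ _ hk.ne']
  calc x ^ k * Real.exp (-(a * x))
      = (k / a) ^ k * ((a * x / k) ^ k * Real.exp (-(a * x))) := by
        conv_lhs => rw [rescale, Real.mul_rpow (by positivity) (by positivity), ← rescale]
        ring
    _ ≤ (k / a) ^ k * (Real.exp (a * x) * Real.exp (-(a * x))) := by gcongr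
    _ = (k / a) ^ k := by rw [← Real.exp_add, add_neg_cancel, Real.exp_zero, mul_one]

theorem rpow_mul_exp_neg_sqrt_le (hk : 0 ≤ k) (ha : 0 < a) (hx : 0 ≤ x) :
    x ^ k * Real.exp (-(a * √x)) ≤ (2 * k / a) ^ (2 * k) := by
  have rpow_sqrt : x ^ k = √x ^ (2 * k) := by
    rw [Real.sqrt_eq_rpow, ← Real.rpow_mul hx, one_div, inv_mul_cancel_left₀ two_ne_zero]
  rw [rpow_sqrt]
  exact rpow_mul_exp_neg_le (by positivity) ha (Real.sqrt_nonneg x)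

theorem mul_le_mul_rpow_neg_of_rpow_add_mul_le {E C : ℝ} (hx : 0 < x) (h : x ^ (g + d) * E ≤ C) :
    x ^ g * E ≤ C * x ^ (-d) := by
  rw [Real.rpow_neg hx.le, ← div_eq_mul_inv, le_div_iff₀ (by positivity)]
  rw [Real.rpow_add hx] at h
  linarith

end ExponentialAbsorption

section OnDiagonalRate

variable {d γ R t : ℝ}

theorem onDiagonalRate_eq (ht : 0 ≤ t) :
    onDiagonalRate d γ R t = R ^ (-d) * (R ^ 2) ^ γ * t ^ (-γ) := by
  rw [onDiagonalRate, Real.div_rpow (sq_nonneg R) ht, Real.rpow_neg ht, div_eq_mul_inv, mul_assoc]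

theorem onDiagonalRate_nonneg (hR : 0 ≤ R) (ht : 0 ≤ t) : 0 ≤ onDiagonalRate d γ R t := by
  unfold onDiagonalRate
  positivity

theorem onDiagonalRate_half (ht : 0 ≤ t) :
    onDiagonalRate d γ R (t / 2) = 2 ^ γ * onDiagonalRate d γ R t := by
  rw [onDiagonalRate_eq ht, onDiagonalRate_eq (by positivity), half_rpow_neg ht, mul_left_comm]

theorem rpow_neg_le_onDiagonalRate (hγ : 0 ≤ γ) (hR : 0 ≤ R) (ht : 0 < t) (htR : t ≤ 2 * R ^ 2) :
    R ^ (-d) ≤ 2 ^ γ * onDiagonalRate d γ R t := by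
  have one_le : 1 ≤ 2 ^ γ * (R ^ 2 / t) ^ γ := by
    rw [← Real.mul_rpow zero_le_two (by positivity)]
    exact Real.one_le_rpow (by rwa [← mul_div_assoc, one_le_div ht]) hγ
  calc R ^ (-d) ≤ R ^ (-d) * (2 ^ γ * (R ^ 2 / t) ^ γ) :=
        le_mul_of_one_le_right (Real.rpow_nonneg hR _) one_le
    _ = _ := by
        rw [onDiagonalRate]
        ring

theorem onDiagonalRate_le_mul_rpow {Z a : ℝ} (hγ : 0 ≤ γ) (hR : 0 ≤ R) (ht : 0 < t) (ha : 0 ≤ a)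
    (hZ : 0 ≤ Z) (h : R ^ 2 ≤ a * (Z * t)) :
    onDiagonalRate d γ R t ≤ R ^ (-d) * (a ^ γ * Z ^ γ) := by
  rw [onDiagonalRate, ← Real.mul_rpow ha hZ]
  gcongr
  rwa [div_le_iff₀ ht, mul_assoc]

end OnDiagonalRate

section Distance

variable {V : Type*} {G : SimpleGraph V}

theorem cast_dist_triangle (hG : G.Connected) (x y z : V) :
    (G.dist x z : ℝ) ≤ G.dist x y + G.dist y z := by
  exact_mod_cast hG.dist_triangle (u := x) (v := y) (w := z)

theorem abs_dist_sub_dist_le (hG : G.Connected) (ω : Conductances G) (y z w : V)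
    (h : conductance ω z w ≠ 0) : |(G.dist y z : ℝ) - G.dist y w| ≤ 1 := by
  have hadj : G.Adj z w := not_imp_comm.mp (conductance_of_not_adj ω) h
  have dist_z := cast_dist_triangle hG y w z
  have dist_w := cast_dist_triangle hG y z w
  rw [SimpleGraph.dist_eq_one_iff_adj.mpr hadj.symm, Nat.cast_one] at dist_z
  rw [SimpleGraph.dist_eq_one_iff_adj.mpr hadj, Nat.cast_one] at dist_w
  rw [abs_le]
  constructor <;> linarith

theorem ball_mono [G.LocallyFinite] (hG : G.Connected) (x : V) {m n : ℕ} (h : m ≤ n) :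
    ball G x m ⊆ ball G x n := fun y hy => by
  rw [mem_ball G hG] at hy ⊢
  exact hy.trans h

theorem cast_dist_le_two_mul_of_mem_ball [G.LocallyFinite] (hG : G.Connected) {x y z : V} {n : ℕ}
    (hy : y ∈ ball G x n) (hz : z ∈ ball G x n) : (G.dist y z : ℝ) ≤ 2 * n := by
  rw [mem_ball G hG] at hy hz
  have triangle := hG.dist_triangle (u := y) (v := x) (w := z)
  rw [G.dist_comm (v := x)] at triangle
  exact_mod_cast (by lia : G.dist y z ≤ 2 * n)

end Distance

section GaussianBounds

variable {V : Type*} {G : SimpleGraph V} [G.LocallyFinite] {ω : Conductances G}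
  {x y z : V} {R : ℕ} {d γ g C₁ C₂ r s t : ℝ}

/-- The constant in `OnDiagonalBound.farMass_le`. -/
def farMassConst (d γ g C₁ C₂ : ℝ) : ℝ :=
  2 ^ (4 * (γ + 1)) * C₁ + C₂ * (2 * (g + d) / (1 / 64)) ^ (2 * (g + d)) * 2 ^ γ

/-- The constant in `OnDiagonalBound.killedKernel_le_gaussian`. -/
def gaussianConst (d γ g C₁ C₂ : ℝ) : ℝ :=
  2 ^ γ * (4 * C₁ + 2 * √(farMassConst d γ g C₁ C₂ * C₁))

/-- The constant in `OnDiagonalBound.killedKernel_le_of_le_four_mul_dist`. -/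
def offDiagonalConst (d γ g C₁ C₂ : ℝ) : ℝ :=
  gaussianConst d γ g C₁ C₂ * (16 ^ γ * (γ / (1 / 4096)) ^ γ) +
    C₂ * ((g + d) / (1 / 32)) ^ (g + d)

theorem farMassConst_nonneg (hd : 0 ≤ d) (hg : 0 ≤ g) (hC₁ : 0 ≤ C₁) (hC₂ : 0 ≤ C₂) :
    0 ≤ farMassConst d γ g C₁ C₂ := by
  unfold farMassConst
  positivity

theorem gaussianConst_nonneg (hC₁ : 0 ≤ C₁) : 0 ≤ gaussianConst d γ g C₁ C₂ := by
  unfold gaussianConst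
  positivity

theorem offDiagonalConst_nonneg (hd : 0 ≤ d) (hγ : 0 ≤ γ) (hg : 0 ≤ g) (hC₁ : 0 ≤ C₁)
    (hC₂ : 0 ≤ C₂) : 0 ≤ offDiagonalConst d γ g C₁ C₂ := by
  have := gaussianConst_nonneg (d := d) (γ := γ) (g := g) (C₂ := C₂) hC₁
  unfold offDiagonalConst
  positivity

namespace OnDiagonalBound

theorem exp_neg_sqrt_mul_inv_mu_le (hB : OnDiagonalBound ω x R d γ g C₁ C₂) (hd : 0 ≤ d)
    (hg : 0 ≤ g) (hC₂ : 0 ≤ C₂) (hR : 0 < R) (hy : y ∈ ball G x R) :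
    Real.exp (-(1 / 64 * √(R : ℝ))) * (mu ω y)⁻¹ ≤
      C₂ * (2 * (g + d) / (1 / 64)) ^ (2 * (g + d)) * (R : ℝ) ^ (-d) := by
  have R_pos : (0 : ℝ) < R := Nat.cast_pos.mpr hR
  calc _ ≤ Real.exp (-(1 / 64 * √(R : ℝ))) * (C₂ * (R : ℝ) ^ g) := by
        gcongr
        exact hB.inv_mu_le y hy
    _ = C₂ * ((R : ℝ) ^ g * Real.exp (-(1 / 64 * √(R : ℝ)))) := by ring
    _ ≤ C₂ * ((2 * (g + d) / (1 / 64)) ^ (2 * (g + d)) * (R : ℝ) ^ (-d)) :=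
        mul_le_mul_of_nonneg_left (mul_le_mul_rpow_neg_of_rpow_add_mul_le R_pos
          (rpow_mul_exp_neg_sqrt_le (by positivity) (by norm_num) R_pos.le)) hC₂
    _ = _ := by ring

variable [Nontrivial V]

theorem farMass_le (hB : OnDiagonalBound ω x R d γ g C₁ C₂) (hG : G.Connected) (hd : 0 ≤ d)
    (hγ : 0 ≤ γ) (hg : 0 ≤ g) (hC₁ : 0 ≤ C₁) (hC₂ : 0 ≤ C₂) (hR : 0 < R) (hy : y ∈ ball G x R)
    (hr : 0 < r) (hrt : r / 64 ≤ t) (hZ : 1 / 2 ≤ r ^ 2 / t) (hRr : (R : ℝ) ≤ 16 * r)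
    (htR : t ≤ 2 * (R : ℝ) ^ 2) :
    farMass (conductance ω) (mu ω) (ball G x R) y (fun w => (G.dist y w : ℝ)) r t ≤
      farMassConst d γ g C₁ C₂ * onDiagonalRate d γ R t * Real.exp (-(r ^ 2 / t / 512)) := by
  have R_pos : (0 : ℝ) < R := Nat.cast_pos.mpr hR
  have ht : 0 < t := lt_of_lt_of_le (by positivity) hrt
  have hw := isWeight_conductance ω hG
  have inv_mu_pos : 0 < (mu ω y)⁻¹ := inv_pos.mpr (hw.pos y)
  refine (farMass_le_farMassBound (K := C₁ * ((R : ℝ) ^ (-d) * ((R : ℝ) ^ 2) ^ γ)) (γ := γ) hw hy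
    (abs_dist_sub_dist_le hG ω y) (by simp) (by positivity) hγ (fun s hs =>
      (hB.sq_le y hy s hs).trans_eq (by rw [onDiagonalRate_eq hs.le, mul_assoc C₁]))
    hr hrt).trans ?_
  rw [farMassBound, mul_assoc C₁, ← onDiagonalRate_eq ht.le]
  have rate_nonneg : 0 ≤ onDiagonalRate d γ R t := onDiagonalRate_nonneg R_pos.le ht.le
  set Z := r ^ 2 / t
  set rate := onDiagonalRate d γ R t
  have sqrt_le : √(R : ℝ) / 8 ≤ √(Z * r) := by
    refine Real.le_sqrt_of_sq_le ?_
    rw [div_pow, Real.sq_sqrt R_pos.le]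
    nlinarith
  calc _ ≤ 2 ^ (4 * (γ + 1)) * (C₁ * rate) * Real.exp (-(Z / 512)) +
        Real.exp (-(Z / 512) + -(1 / 64 * √(R : ℝ))) * (mu ω y)⁻¹ := by
        gcongr <;> linarith
    _ = (2 ^ (4 * (γ + 1)) * C₁ * rate + Real.exp (-(1 / 64 * √(R : ℝ))) * (mu ω y)⁻¹) *
        Real.exp (-(Z / 512)) := by
        rw [Real.exp_add]
        ring
    _ ≤ (2 ^ (4 * (γ + 1)) * C₁ * rate + C₂ * (2 * (g + d) / (1 / 64)) ^ (2 * (g + d)) *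
        (2 ^ γ * rate)) * Real.exp (-(Z / 512)) := by
        refine mul_le_mul_of_nonneg_right (add_le_add_right ?_ _) (Real.exp_pos _).le
        exact (hB.exp_neg_sqrt_mul_inv_mu_le hd hg hC₂ hR hy).trans
          (mul_le_mul_of_nonneg_left (rpow_neg_le_onDiagonalRate hγ R_pos.le ht htR)
            (by positivity))
    _ = _ := by
        rw [farMassConst]
        ring

theorem killedKernel_le (hB : OnDiagonalBound ω x R d γ g C₁ C₂) (hG : G.Connected) (hC₁ : 0 ≤ C₁)
    (hy : y ∈ ball G x R) (hz : z ∈ ball G x R) (ht : 0 < t) :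
    killedKernel (conductance ω) (mu ω) (ball G x R) y t z ≤
      2 * (C₁ * (2 ^ γ * onDiagonalRate d γ R t)) := by
  have hw := isWeight_conductance ω hG
  have rate_nonneg := onDiagonalRate_nonneg (d := d) (γ := γ) R.cast_nonneg ht.le
  have sq_le (v) (hv : v ∈ ball G x R) := hB.sq_le v hv (t / 2) (half_pos ht)
  simp only [onDiagonalRate_half ht.le] at sq_le
  have le_sqrt := killedKernel_le_of_farMass_le (ρ := 0) (ρ' := 0) hw hy hz
    (fun _ => Or.inl le_rfl) (by positivity) ((farMass_le_sum hw 0 _).trans (sq_le y hy))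
    ((farMass_le_sum hw 0 _).trans (sq_le z hz)) (sq_le y hy) (sq_le z hz)
  rwa [add_halves, Real.sqrt_mul_self (by positivity)] at le_sqrt

theorem killedKernel_le_of_le_dist_sq (hB : OnDiagonalBound ω x R d γ g C₁ C₂) (hG : G.Connected)
    (hd : 0 ≤ d) (hγ : 0 ≤ γ) (hg : 0 ≤ g) (hC₁ : 0 ≤ C₁) (hC₂ : 0 ≤ C₂) (hR : 0 < R)
    (hy : y ∈ ball G x R) (hz : z ∈ ball G x R) (ht : 0 < t) (hDt : (G.dist y z : ℝ) ≤ t)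
    (htD : t ≤ (G.dist y z : ℝ) ^ 2) (hRD : (R : ℝ) ≤ 8 * G.dist y z) :
    killedKernel (conductance ω) (mu ω) (ball G x R) y t z ≤
      2 * √(farMassConst d γ g C₁ C₂ * C₁) * (2 ^ γ * onDiagonalRate d γ R t) *
        Real.exp (-((G.dist y z : ℝ) ^ 2 / t / 2048)) := by
  have hw := isWeight_conductance ω hG
  have R_pos : (0 : ℝ) < R := Nat.cast_pos.mpr hR
  have cover (w : V) : (G.dist y z : ℝ) / 2 ≤ G.dist y w ∨ (G.dist y z : ℝ) / 2 ≤ G.dist z w := by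
    have := cast_dist_triangle hG y w z
    rw [G.dist_comm (u := w)] at this
    by_contra! hlt
    linarith
  have dist_le := cast_dist_le_two_mul_of_mem_ball hG hy hz
  set D := (G.dist y z : ℝ)
  have D_pos : 0 < D := by linarith
  have half_Z : (D / 2) ^ 2 / (t / 2) = D ^ 2 / t / 2 := by field_simp
  have one_le_Z : 1 ≤ D ^ 2 / t := (one_le_div ht).mpr htD
  have sq_le (v) (hv : v ∈ ball G x R) := hB.sq_le v hv (t / 2) (half_pos ht)
  have farMass_le (v) (hv : v ∈ ball G x R) := hB.farMass_le hG hd hγ hg hC₁ hC₂ hR hv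
    (r := D / 2) (t := t / 2) (by positivity) (by linarith) (by linarith) (by linarith)
    (by nlinarith)
  simp only [onDiagonalRate_half ht.le] at sq_le
  simp only [onDiagonalRate_half ht.le, half_Z] at farMass_le
  have rate_nonneg := onDiagonalRate_nonneg (d := d) (γ := γ) R_pos.le ht.le
  have const_nonneg := farMassConst_nonneg (γ := γ) hd hg hC₁ hC₂
  set rate := 2 ^ γ * onDiagonalRate d γ R t
  have le_sqrt := killedKernel_le_of_farMass_le hw hy hz cover (by positivity) (farMass_le y hy)
    (farMass_le z hz) (sq_le y hy) (sq_le z hz)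
  have exp_split : Real.exp (-(D ^ 2 / t / 2 / 512)) = Real.exp (-(D ^ 2 / t / 2048)) ^ 2 := by
    rw [← Real.exp_nat_mul]
    ring_nf
  rw [add_halves, exp_split, show ∀ C E : ℝ, C * rate * E ^ 2 * (C₁ * rate) =
    C * C₁ * (rate * E) ^ 2 by intros; ring, Real.sqrt_mul (by positivity),
    Real.sqrt_sq (by positivity)] at le_sqrt
  linarith

theorem killedKernel_le_gaussian (hB : OnDiagonalBound ω x R d γ g C₁ C₂) (hG : G.Connected)
    (hd : 0 ≤ d) (hγ : 0 ≤ γ) (hg : 0 ≤ g) (hC₁ : 0 ≤ C₁) (hC₂ : 0 ≤ C₂) (hR : 0 < R)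
    (hy : y ∈ ball G x R) (hz : z ∈ ball G x R) (ht : 0 < t) (hDt : (G.dist y z : ℝ) ≤ t)
    (hRD : (R : ℝ) ^ 2 ≤ 64 * max ((G.dist y z : ℝ) ^ 2) t) :
    killedKernel (conductance ω) (mu ω) (ball G x R) y t z ≤
      gaussianConst d γ g C₁ C₂ * onDiagonalRate d γ R t *
        Real.exp (-((G.dist y z : ℝ) ^ 2 / t / 2048)) := by
  have rate_nonneg := onDiagonalRate_nonneg (d := d) (γ := γ) R.cast_nonneg ht.le
  rw [gaussianConst]
  rcases le_total ((G.dist y z : ℝ) ^ 2) t with hle | hle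
  · have half_le : 1 / 2 ≤ Real.exp (-((G.dist y z : ℝ) ^ 2 / t / 2048)) := by
      have := (div_le_one ht).mpr hle
      linarith [Real.add_one_le_exp (-((G.dist y z : ℝ) ^ 2 / t / 2048))]
    calc _ ≤ 2 ^ γ * (4 * C₁ + 0) * onDiagonalRate d γ R t * (1 / 2) :=
          (hB.killedKernel_le hG hC₁ hy hz ht).trans_eq (by ring)
      _ ≤ _ := by
          gcongr
          positivity
  · have le_dist : (R : ℝ) ≤ 8 * G.dist y z := by
      rw [max_eq_left hle] at hRD
      exact abs_le_of_sq_le_sq' (by linarith) (by positivity) |>.2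
    calc _ ≤ 2 ^ γ * (0 + 2 * √(farMassConst d γ g C₁ C₂ * C₁)) * onDiagonalRate d γ R t *
          Real.exp (-((G.dist y z : ℝ) ^ 2 / t / 2048)) :=
          (hB.killedKernel_le_of_le_dist_sq hG hd hγ hg hC₁ hC₂ hR hy hz ht hDt hle
            le_dist).trans_eq (by ring)
      _ ≤ _ := by
          gcongr
          positivity

theorem killedKernel_le_of_dist_le (hB : OnDiagonalBound ω x R d γ g C₁ C₂) (hG : G.Connected)
    (hd : 0 ≤ d) (hγ : 0 ≤ γ) (hg : 0 ≤ g) (hC₁ : 0 ≤ C₁) (hC₂ : 0 ≤ C₂) (hR : 0 < R)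
    (hy : y ∈ ball G x R) (hz : z ∈ ball G x R) (hRD : (R : ℝ) ≤ 4 * G.dist y z)
    (hDt : (G.dist y z : ℝ) ≤ t) :
    killedKernel (conductance ω) (mu ω) (ball G x R) y t z ≤
      gaussianConst d γ g C₁ C₂ * (16 ^ γ * (γ / (1 / 4096)) ^ γ) * (R : ℝ) ^ (-d) *
        Real.exp (-((G.dist y z : ℝ) ^ 2 / t / 4096)) := by
  have R_pos : (0 : ℝ) < R := Nat.cast_pos.mpr hR
  have ht : 0 < t := by linarith
  have const_nonneg := gaussianConst_nonneg (d := d) (γ := γ) (g := g) (C₂ := C₂) hC₁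
  have le_gaussian := hB.killedKernel_le_gaussian hG hd hγ hg hC₁ hC₂ hR hy hz ht hDt
    (by nlinarith [le_max_left ((G.dist y z : ℝ) ^ 2) t])
  set Z := (G.dist y z : ℝ) ^ 2 / t with hZ
  have Z_nonneg : 0 ≤ Z := by positivity
  have rate_le : onDiagonalRate d γ R t ≤ (R : ℝ) ^ (-d) * (16 ^ γ * Z ^ γ) :=
    onDiagonalRate_le_mul_rpow hγ R_pos.le ht (by norm_num) Z_nonneg (by
      rw [hZ, div_mul_cancel₀ _ ht.ne']
      nlinarith)
  calc _ ≤ gaussianConst d γ g C₁ C₂ * ((R : ℝ) ^ (-d) * (16 ^ γ * Z ^ γ)) *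
        Real.exp (-(1 / 4096 * Z) + -(Z / 4096)) :=
        le_gaussian.trans (by
          gcongr
          linarith)
    _ = gaussianConst d γ g C₁ C₂ * (16 ^ γ * (Z ^ γ * Real.exp (-(1 / 4096 * Z)))) *
        (R : ℝ) ^ (-d) * Real.exp (-(Z / 4096)) := by
        rw [Real.exp_add]
        ring
    _ ≤ _ := by
        gcongr
        exact rpow_mul_exp_neg_le hγ (by norm_num) Z_nonneg

theorem killedKernel_le_of_le_dist (hB : OnDiagonalBound ω x R d γ g C₁ C₂) (hG : G.Connected)
    (hd : 0 ≤ d) (hg : 0 ≤ g) (hC₂ : 0 ≤ C₂) (hR : 0 < R) (hy : y ∈ ball G x R)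
    (hz : z ∈ ball G x R) (hRD : (R : ℝ) ≤ 4 * G.dist y z) (ht : 0 ≤ t)
    (htD : t ≤ (G.dist y z : ℝ)) :
    killedKernel (conductance ω) (mu ω) (ball G x R) y t z ≤
      C₂ * ((g + d) / (1 / 32)) ^ (g + d) * (R : ℝ) ^ (-d) *
        Real.exp (-((G.dist y z : ℝ) / 8)) := by
  have R_pos : (0 : ℝ) < R := Nat.cast_pos.mpr hR
  have davies := killedKernel_le_exp (isWeight_conductance ω hG) hy hz (θ := 1 / 2)
    (ψ := fun w => 1 / 2 * (G.dist y w : ℝ))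
    (fun w w' h => by
      rw [← mul_sub, abs_mul, abs_of_pos one_half_pos]
      linarith [abs_dist_sub_dist_le hG ω y w w' h])
    ht (hB.inv_mu_le y hy) (hB.inv_mu_le z hz)
  rw [SimpleGraph.dist_self, Nat.cast_zero, mul_zero, sub_zero] at davies
  have cosh_le := cosh_sub_one_le_sq one_half_pos.le one_half_lt_one.le
  have absorb : (R : ℝ) ^ g * Real.exp (-(1 / 32 * R)) ≤
      ((g + d) / (1 / 32)) ^ (g + d) * (R : ℝ) ^ (-d) :=
    mul_le_mul_rpow_neg_of_rpow_add_mul_le R_pos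
      (rpow_mul_exp_neg_le (by positivity) (by norm_num) R_pos.le)
  calc _ ≤ C₂ * (R : ℝ) ^ g * Real.exp (-(1 / 32 * R) + -((G.dist y z : ℝ) / 8)) :=
        davies.trans (by
          gcongr
          nlinarith)
    _ = C₂ * ((R : ℝ) ^ g * Real.exp (-(1 / 32 * R))) * Real.exp (-((G.dist y z : ℝ) / 8)) := by
        rw [Real.exp_add]
        ring
    _ ≤ _ := by
        rw [mul_assoc C₂ _ ((R : ℝ) ^ (-d))]
        gcongr

theorem killedKernel_le_of_le_four_mul_dist (hB : OnDiagonalBound ω x R d γ g C₁ C₂)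
    (hG : G.Connected) (hd : 0 ≤ d) (hγ : 0 ≤ γ) (hg : 0 ≤ g) (hC₁ : 0 ≤ C₁) (hC₂ : 0 ≤ C₂)
    (hR : 0 < R) (hy : y ∈ ball G x R) (hz : z ∈ ball G x R) (hRD : (R : ℝ) ≤ 4 * G.dist y z)
    {D : ℝ} (hD : 0 ≤ D) (hDyz : D ≤ G.dist y z) (hDt : D ≤ t) (hs : 0 ≤ s) (hst : s ≤ t) :
    killedKernel (conductance ω) (mu ω) (ball G x R) y s z ≤
      offDiagonalConst d γ g C₁ C₂ * (R : ℝ) ^ (-d) * Real.exp (-(D ^ 2 / t / 4096)) := by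
  have R_pos : (0 : ℝ) < R := Nat.cast_pos.mpr hR
  have const_nonneg := gaussianConst_nonneg (d := d) (γ := γ) (g := g) (C₂ := C₂) hC₁
  rw [offDiagonalConst]
  rcases le_total (G.dist y z : ℝ) s with hcase | hcase
  · have s_pos : 0 < s := by linarith
    refine (hB.killedKernel_le_of_dist_le hG hd hγ hg hC₁ hC₂ hR hy hz hRD hcase).trans ?_
    gcongr
    exact le_add_of_nonneg_right (by positivity)
  · refine (hB.killedKernel_le_of_le_dist hG hd hg hC₂ hR hy hz hRD hs hcase).trans ?_
    gcongr
    · exact le_add_of_nonneg_left (by positivity)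
    · have : D ^ 2 / t ≤ D := div_le_of_le_mul₀ (hD.trans hDt) hD (by nlinarith)
      linarith
    · norm_num

end OnDiagonalBound

end GaussianBounds

section DyadicComparison

theorem le_add_div_of_geometric_increments {a : ℕ → ℝ} {M ρ : ℝ} (hM : 0 ≤ M) (hρ0 : 0 ≤ ρ)
    (hρ1 : ρ < 1) (h : ∀ k, a (k + 1) ≤ a k + M * ρ ^ k) (n : ℕ) :
    a n ≤ a 0 + M * (1 - ρ)⁻¹ := by
  have le_geom_sum : a n ≤ a 0 + M * ∑ k ∈ Finset.range n, ρ ^ k := by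
    induction n with
    | zero => simp
    | succ n ih =>
      rw [Finset.sum_range_succ]
      linarith [h n]
  have geom_sum_le : ∑ k ∈ Finset.range n, ρ ^ k ≤ (1 - ρ)⁻¹ :=
    (tsum_geometric_of_lt_one hρ0 hρ1) ▸
      (summable_geometric_of_lt_one hρ0 hρ1).sum_le_tsum _ fun k _ => pow_nonneg hρ0 k
  exact le_geom_sum.trans (by gcongr)

variable {V : Type*} [Nontrivial V] {G : SimpleGraph V} [G.LocallyFinite] {ω : Conductances G}
  {x y : V} {R : ℕ} {d γ g C₁ C₂ t : ℝ}

theorem killedKernel_double_ball_le (hG : G.Connected)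
    (hB : OnDiagonalBound ω x (2 * R) d γ g C₁ C₂) (hd : 0 ≤ d) (hγ : 0 ≤ γ) (hg : 0 ≤ g)
    (hC₁ : 0 ≤ C₁) (hC₂ : 0 ≤ C₂) (hR : 0 < R) (hDR : 2 * G.dist x y ≤ R)
    (hDt : (G.dist x y : ℝ) ≤ t) :
    killedKernel (conductance ω) (mu ω) (ball G x (2 * R)) y t x ≤
      killedKernel (conductance ω) (mu ω) (ball G x R) y t x +
        offDiagonalConst d γ g C₁ C₂ * (R : ℝ) ^ (-d) *
          Real.exp (-((G.dist x y : ℝ) ^ 2 / t / 4096)) := by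
  have hw := isWeight_conductance ω hG
  have R_pos : (0 : ℝ) < R := Nat.cast_pos.mpr hR
  have D_nonneg : (0 : ℝ) ≤ G.dist x y := Nat.cast_nonneg _
  have const_nonneg := offDiagonalConst_nonneg hd hγ hg hC₁ hC₂
  have hDR' : 2 * (G.dist x y : ℝ) ≤ R := by exact_mod_cast hDR
  have hy : y ∈ ball G x R := (mem_ball G hG x y R).mpr (by lia)
  have hsub : ball G x R ⊆ ball G x (2 * R) := ball_mono hG x (by lia)
  refine killedKernel_le_add hw hsub (self_mem_ball hG x R) hy (D_nonneg.trans hDt)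
    (by positivity) fun s hs z hz hzR => ?_
  have lt_dist : (R : ℝ) < G.dist x z := by
    rw [mem_ball G hG] at hzR
    exact_mod_cast not_le.mp hzR
  have := cast_dist_triangle hG x y z
  refine (hB.killedKernel_le_of_le_four_mul_dist hG hd hγ hg hC₁ hC₂ (by lia) (hsub hy) hz
    (by push_cast; linarith) D_nonneg (by linarith) hDt hs.1 hs.2).trans ?_
  gcongr ?_ * ?_ * _
  exact Real.rpow_le_rpow_of_nonpos R_pos (by push_cast; linarith) (neg_nonpos.mpr hd)

theorem killedKernel_dyadic_ball_le (hG : G.Connected)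
    (hB : ∀ k : ℕ, OnDiagonalBound ω x (2 ^ k * R) d γ g C₁ C₂) (hd : 0 < d) (hγ : 0 ≤ γ)
    (hg : 0 ≤ g) (hC₁ : 0 ≤ C₁) (hC₂ : 0 ≤ C₂) (hR : 0 < R) (hDR : 2 * G.dist x y ≤ R)
    (hDt : (G.dist x y : ℝ) ≤ t) (n : ℕ) :
    killedKernel (conductance ω) (mu ω) (ball G x (2 ^ n * R)) y t x ≤
      killedKernel (conductance ω) (mu ω) (ball G x R) y t x +
        offDiagonalConst d γ g C₁ C₂ * (R : ℝ) ^ (-d) *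
          Real.exp (-((G.dist x y : ℝ) ^ 2 / t / 4096)) * (1 - 2 ^ (-d))⁻¹ := by
  have const_nonneg := offDiagonalConst_nonneg hd.le hγ hg hC₁ hC₂
  have ratio_lt_one : (2 : ℝ) ^ (-d) < 1 :=
    Real.rpow_lt_one_of_one_lt_of_neg one_lt_two (neg_lt_zero.mpr hd)
  have telescope := le_add_div_of_geometric_increments (a := fun k =>
    killedKernel (conductance ω) (mu ω) (ball G x (2 ^ k * R)) y t x)
    (M := offDiagonalConst d γ g C₁ C₂ * (R : ℝ) ^ (-d) *
      Real.exp (-((G.dist x y : ℝ) ^ 2 / t / 4096))) (by positivity) (by positivity)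
    ratio_lt_one (fun k => ?_) n
  · simpa only [pow_zero, one_mul] using telescope
  have le_pow_mul : R ≤ 2 ^ k * R := Nat.le_mul_of_pos_left R (by positivity)
  have hB_double := hB (k + 1)
  rw [pow_succ', mul_assoc] at hB_double
  have step := killedKernel_double_ball_le hG hB_double hd.le hγ hg hC₁ hC₂ (by positivity)
    (hDR.trans le_pow_mul) hDt
  rw [Nat.cast_mul, Nat.cast_pow, Nat.cast_ofNat, Real.mul_rpow (by positivity) (by positivity),
    ← Real.rpow_pow_comm zero_le_two] at step
  rw [pow_succ', mul_assoc]
  exact step.trans_eq (by ring)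

/-- The constant in `killedKernel_base_ball_le`. -/
def baseBallConst (d γ g C₁ C₂ : ℝ) : ℝ :=
  gaussianConst d γ g C₁ C₂ * (64 ^ γ * (γ / (1 / 4096)) ^ γ * Real.exp (1 / 4096))

theorem killedKernel_base_ball_le (hG : G.Connected) (hB : OnDiagonalBound ω x R d γ g C₁ C₂)
    (hd : 0 ≤ d) (hγ : 0 ≤ γ) (hg : 0 ≤ g) (hC₁ : 0 ≤ C₁) (hC₂ : 0 ≤ C₂) (hR : 0 < R)
    (hDR : G.dist x y ≤ R) (ht : 0 < t) (hDt : (G.dist x y : ℝ) ≤ t)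
    (hRD : (R : ℝ) ^ 2 ≤ 64 * max ((G.dist x y : ℝ) ^ 2) t) :
    killedKernel (conductance ω) (mu ω) (ball G x R) y t x ≤
      baseBallConst d γ g C₁ C₂ * (R : ℝ) ^ (-d) *
        Real.exp (-((G.dist x y : ℝ) ^ 2 / t / 4096)) := by
  have R_pos : (0 : ℝ) < R := Nat.cast_pos.mpr hR
  have const_nonneg := gaussianConst_nonneg (d := d) (γ := γ) (g := g) (C₂ := C₂) hC₁
  rw [G.dist_comm] at hDR hDt hRD ⊢
  rw [G.dist_comm] at hDR
  have le_gaussian := hB.killedKernel_le_gaussian hG hd hγ hg hC₁ hC₂ hR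
    ((mem_ball G hG x y R).mpr hDR) (self_mem_ball hG x R) ht hDt hRD
  set Z := (G.dist y x : ℝ) ^ 2 / t with hZ
  have : 0 ≤ Z := by positivity
  have rate_le : onDiagonalRate d γ R t ≤ (R : ℝ) ^ (-d) * (64 ^ γ * (1 + Z) ^ γ) :=
    onDiagonalRate_le_mul_rpow hγ R_pos.le ht (by norm_num) (by positivity) (hRD.trans (by
      rw [one_add_mul, hZ, div_mul_cancel₀ _ ht.ne']
      gcongr
      exact max_le (by linarith) (by nlinarith)))
  calc _ ≤ gaussianConst d γ g C₁ C₂ * ((R : ℝ) ^ (-d) * (64 ^ γ * (1 + Z) ^ γ)) *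
        Real.exp (-(1 / 4096 * (1 + Z)) + 1 / 4096 + -(Z / 4096)) :=
        le_gaussian.trans (by
          gcongr
          linarith)
    _ = gaussianConst d γ g C₁ C₂ * (64 ^ γ * ((1 + Z) ^ γ *
          Real.exp (-(1 / 4096 * (1 + Z)))) * Real.exp (1 / 4096)) * (R : ℝ) ^ (-d) *
          Real.exp (-(Z / 4096)) := by
        rw [Real.exp_add, Real.exp_add]
        ring
    _ ≤ _ := by
        rw [baseBallConst]
        gcongr
        exact rpow_mul_exp_neg_le hγ (by norm_num) (by positivity)

/-- The constant in `exists_ball_killedKernel_le_gaussian`. -/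
def nearConst (d γ g C₁ C₂ : ℝ) : ℝ :=
  baseBallConst d γ g C₁ C₂ + offDiagonalConst d γ g C₁ C₂ * (1 - 2 ^ (-d))⁻¹

theorem nearConst_nonneg (hd : 0 < d) (hγ : 0 ≤ γ) (hg : 0 ≤ g) (hC₁ : 0 ≤ C₁) (hC₂ : 0 ≤ C₂) :
    0 ≤ nearConst d γ g C₁ C₂ := by
  have := gaussianConst_nonneg (d := d) (γ := γ) (g := g) (C₂ := C₂) hC₁
  have := offDiagonalConst_nonneg hd.le hγ hg hC₁ hC₂
  have ratio_lt_one : (2 : ℝ) ^ (-d) < 1 :=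
    Real.rpow_lt_one_of_one_lt_of_neg one_lt_two (neg_lt_zero.mpr hd)
  have : 0 < 1 - (2 : ℝ) ^ (-d) := sub_pos.mpr ratio_lt_one
  unfold nearConst baseBallConst
  positivity

theorem exists_radius_of_one_le (ht : 1 ≤ t) (D : ℕ) :
    ∃ R : ℕ, √t ≤ R ∧ 2 * D ≤ R ∧ (R : ℝ) ^ 2 ≤ 64 * max ((D : ℝ) ^ 2) t := by
  have one_le_sqrt : 1 ≤ √t := Real.one_le_sqrt.mpr ht
  have le_ceil := Nat.le_ceil √t
  have ceil_le := (Nat.ceil_lt_add_one (Real.sqrt_nonneg t)).le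
  have : (0 : ℝ) ≤ D := Nat.cast_nonneg _
  refine ⟨2 * ⌈√t⌉₊ + 2 * D, by push_cast; linarith, by lia, ?_⟩
  push_cast
  rcases le_total (D : ℝ) √t with h | h
  · nlinarith [le_max_right ((D : ℝ) ^ 2) t, Real.sq_sqrt (zero_le_one.trans ht)]
  · nlinarith [le_max_left ((D : ℝ) ^ 2) t]

theorem exists_ball_killedKernel_le_gaussian (hG : G.Connected) (hd : 0 < d) (hγ : 0 ≤ γ)
    (hg : 0 ≤ g) (hC₁ : 0 ≤ C₁) (hC₂ : 0 ≤ C₂) (ht : 1 ≤ t)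
    (hB : ∀ R : ℕ, √t ≤ R → OnDiagonalBound ω x R d γ g C₁ C₂) (hDt : (G.dist x y : ℝ) ≤ t)
    (n : ℕ) :
    ∃ R : ℕ, n ≤ R ∧ killedKernel (conductance ω) (mu ω) (ball G x R) x t y ≤
      nearConst d γ g C₁ C₂ * t ^ (-d / 2) *
        Real.exp (-((G.dist x y : ℝ) ^ 2 / t / 4096)) := by
  have t_pos : 0 < t := by linarith
  have sqrt_pos : 0 < √t := Real.sqrt_pos.mpr t_pos
  obtain ⟨R₀, sqrt_le_R₀, two_mul_dist_le, R₀_sq_le⟩ := exists_radius_of_one_le ht (G.dist x y)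
  have R₀_pos : 0 < R₀ := Nat.cast_pos.mp (sqrt_pos.trans_le sqrt_le_R₀)
  have le_pow_mul (k : ℕ) : R₀ ≤ 2 ^ k * R₀ := Nat.le_mul_of_pos_left R₀ (by positivity)
  have hBk (k : ℕ) : OnDiagonalBound ω x (2 ^ k * R₀) d γ g C₁ C₂ :=
    hB _ (sqrt_le_R₀.trans (Nat.cast_le.mpr (le_pow_mul k)))
  have base := killedKernel_base_ball_le hG (hB R₀ sqrt_le_R₀) hd.le hγ hg hC₁ hC₂ R₀_pos
    (by lia) t_pos hDt R₀_sq_le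
  have rpow_le : (R₀ : ℝ) ^ (-d) ≤ t ^ (-d / 2) := by
    rw [show -d / 2 = 1 / 2 * -d by ring, Real.rpow_mul t_pos.le, ← Real.sqrt_eq_rpow]
    exact Real.rpow_le_rpow_of_nonpos sqrt_pos sqrt_le_R₀ (neg_nonpos.mpr hd.le)
  have hy : y ∈ ball G x (2 ^ n * R₀) :=
    (mem_ball G hG x y _).mpr (by linarith [le_pow_mul n])
  refine ⟨2 ^ n * R₀, n.lt_two_pow_self.le.trans (Nat.le_mul_of_pos_right _ R₀_pos), ?_⟩
  rw [killedKernel_symm (isWeight_conductance ω hG) hy (self_mem_ball hG x _) t]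
  calc _ ≤ _ := killedKernel_dyadic_ball_le hG hBk hd hγ hg hC₁ hC₂ R₀_pos two_mul_dist_le hDt n
    _ ≤ _ := add_le_add_left base _
    _ = nearConst d γ g C₁ C₂ * (R₀ : ℝ) ^ (-d) *
          Real.exp (-((G.dist x y : ℝ) ^ 2 / t / 4096)) := by
        rw [nearConst]
        ring
    _ ≤ _ := by
        have := nearConst_nonneg hd hγ hg hC₁ hC₂
        gcongr

end DyadicComparison

section PoissonRegime

theorem cosh_sub_one_mul_le {ℓ D : ℝ} (hℓ : 0 ≤ ℓ) (hD : 0 ≤ D) :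
    (Real.cosh (1 + ℓ / 2) - 1) * (D * Real.exp (-ℓ)) ≤ 86 / 100 * D := by
  set v : ℝ := Real.exp (-(ℓ / 2)) with hv
  have : 0 < v := Real.exp_pos _
  have v_le_one : v ≤ 1 := Real.exp_le_one_iff.mpr (by linarith)
  have exp_neg_eq : Real.exp (-ℓ) = v ^ 2 := by
    rw [hv, ← Real.exp_nat_mul]
    ring_nf
  have exp_mul_eq : Real.exp (1 + ℓ / 2) * v = Real.exp 1 := by
    rw [hv, ← Real.exp_add]
    ring_nf
  have cosh_le : Real.cosh (1 + ℓ / 2) - 1 ≤ (Real.exp (1 + ℓ / 2) - 1) / 2 := by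
    have : Real.exp (-(1 + ℓ / 2)) ≤ 1 := Real.exp_le_one_iff.mpr (by linarith)
    rw [Real.cosh_eq]
    linarith
  have parabola_le : (Real.exp 1 * v - v ^ 2) / 2 ≤ 86 / 100 := by
    have := Real.exp_one_gt_d9
    have := Real.exp_one_lt_d9
    nlinarith [mul_nonneg (sub_nonneg.mpr v_le_one) (by linarith : 0 ≤ Real.exp 1 - 1 - v)]
  calc _ ≤ (Real.exp (1 + ℓ / 2) - 1) / 2 * (D * v ^ 2) := by
        rw [exp_neg_eq]
        gcongr
    _ = (Real.exp 1 * v - v ^ 2) / 2 * D := by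
        rw [← exp_mul_eq]
        ring
    _ ≤ _ := by gcongr

theorem cosh_sub_one_mul_sub_le {t D : ℝ} (ht : 0 < t) (htD : t ≤ D) :
    (Real.cosh (1 + Real.log (D / t) / 2) - 1) * t - (1 + Real.log (D / t) / 2) * D ≤
      -(1 / 16 * D) - 1 / 16 * D * max 1 (Real.log (D / t)) := by
  have D_pos : 0 < D := ht.trans_le htD
  have log_nonneg : 0 ≤ Real.log (D / t) := Real.log_nonneg ((one_le_div ht).mpr htD)
  have eq_mul_exp : D * Real.exp (-Real.log (D / t)) = t := by
    rw [Real.exp_neg, Real.exp_log (by positivity), inv_div, mul_div_cancel₀ _ D_pos.ne']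
  have cosh_le := cosh_sub_one_mul_le log_nonneg D_pos.le
  rw [eq_mul_exp] at cosh_le
  have max_le_add : max 1 (Real.log (D / t)) ≤ 1 + Real.log (D / t) :=
    max_le (by linarith) (by linarith)
  nlinarith [mul_nonneg D_pos.le log_nonneg, mul_le_mul_of_nonneg_left max_le_add D_pos.le]

/-- The constant in `OnDiagonalBound.killedKernel_le_of_time_le_dist`. -/
def farConst (d g C₂ : ℝ) : ℝ :=
  C₂ * ((g + d / 2) / (1 / 16)) ^ (g + d / 2)

theorem farConst_nonneg {d g C₂ : ℝ} (hd : 0 ≤ d) (hg : 0 ≤ g) (hC₂ : 0 ≤ C₂) :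
    0 ≤ farConst d g C₂ := by
  unfold farConst
  positivity

theorem OnDiagonalBound.killedKernel_le_of_time_le_dist {V : Type*} [Nontrivial V]
    {G : SimpleGraph V} [G.LocallyFinite] {ω : Conductances G} {x y : V} {R : ℕ}
    {d γ g C₁ C₂ t : ℝ} (hB : OnDiagonalBound ω x (G.dist x y) d γ g C₁ C₂) (hG : G.Connected)
    (hd : 0 ≤ d) (hg : 0 ≤ g) (hC₂ : 0 ≤ C₂) (ht : 0 < t) (htD : t ≤ G.dist x y)
    (hR : G.dist x y ≤ R) :
    killedKernel (conductance ω) (mu ω) (ball G x R) x t y ≤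
      farConst d g C₂ * t ^ (-d / 2) *
        Real.exp (-(1 / 16 * G.dist x y * max 1 (Real.log (G.dist x y / t)))) := by
  have log_nonneg : 0 ≤ Real.log (G.dist x y / t) := Real.log_nonneg ((one_le_div ht).mpr htD)
  have davies := killedKernel_le_exp (isWeight_conductance ω hG) (self_mem_ball hG x R)
    ((mem_ball G hG x y R).mpr hR) (θ := 1 + Real.log (G.dist x y / t) / 2)
    (ψ := fun z => (1 + Real.log (G.dist x y / t) / 2) * G.dist x z)
    (fun z w h => by
      rw [← mul_sub, abs_mul, abs_of_nonneg (by positivity)]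
      exact mul_le_of_le_one_right (by positivity) (abs_dist_sub_dist_le hG ω x z w h))
    ht.le (hB.inv_mu_le x (self_mem_ball hG x _))
    (hB.inv_mu_le y ((mem_ball G hG x y _).mpr le_rfl))
  rw [G.dist_self, Nat.cast_zero, mul_zero, sub_zero] at davies
  set D : ℝ := (G.dist x y : ℝ)
  have D_pos : 0 < D := ht.trans_le htD
  have absorb : D ^ g * Real.exp (-(1 / 16 * D)) ≤
      ((g + d / 2) / (1 / 16)) ^ (g + d / 2) * t ^ (-d / 2) := by
    refine (mul_le_mul_rpow_neg_of_rpow_add_mul_le D_pos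
      (rpow_mul_exp_neg_le (k := g + d / 2) (by positivity) (by norm_num) D_pos.le)).trans ?_
    rw [neg_div]
    exact mul_le_mul_of_nonneg_left (Real.rpow_le_rpow_of_nonpos ht htD (by linarith))
      (by positivity)
  calc _ ≤ C₂ * D ^ g * Real.exp (-(1 / 16 * D) - 1 / 16 * D * max 1 (Real.log (D / t))) :=
        davies.trans (mul_le_mul_of_nonneg_left
          (Real.exp_le_exp.mpr (cosh_sub_one_mul_sub_le ht htD)) (by positivity))
    _ = C₂ * (D ^ g * Real.exp (-(1 / 16 * D))) *
          Real.exp (-(1 / 16 * D * max 1 (Real.log (D / t)))) := by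
        rw [sub_eq_add_neg, Real.exp_add]
        ring
    _ ≤ C₂ * (((g + d / 2) / (1 / 16)) ^ (g + d / 2) * t ^ (-d / 2)) *
          Real.exp (-(1 / 16 * D * max 1 (Real.log (D / t)))) := by gcongr
    _ = _ := by
        rw [farConst]
        ring

end PoissonRegime

section WaitingTimes

instance isProbabilityMeasure_expMeasure_one : IsProbabilityMeasure (expMeasure 1) :=
  isProbabilityMeasure_expMeasure one_pos

theorem lintegral_expMeasure_one {F : ℝ → ℝ≥0∞} (hF : Measurable F) :
    ∫⁻ r, F r ∂(expMeasure 1) =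
      ∫⁻ r, (Set.Ici 0).indicator (fun r => ENNReal.ofReal (Real.exp (-r)) * F r) r := by
  have withDensity_eq : expMeasure 1 = volume.withDensity (exponentialPDF 1) := rfl
  rw [withDensity_eq, lintegral_withDensity_eq_lintegral_mul (f := exponentialPDF 1) _
    (measurable_exponentialPDFReal 1).ennreal_ofReal hF]
  refine lintegral_congr fun r => ?_
  simp only [Pi.mul_apply, Set.indicator, Set.mem_Ici]
  split_ifs with hr
  · rw [exponentialPDF_of_nonneg hr, one_mul, one_mul]
  · rw [exponentialPDF_of_neg (not_le.mp hr), zero_mul]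

theorem expMeasure_one_Iio_zero : expMeasure 1 (Set.Iio 0) = 0 :=
  (withDensity_apply _ measurableSet_Iio).trans (lintegral_exponentialPDF_of_nonpos le_rfl)

theorem expMeasure_one_Ioi {a : ℝ} (ha : 0 ≤ a) :
    expMeasure 1 (Set.Ioi a) = ENNReal.ofReal (Real.exp (-a)) := by
  have exp_le_one : Real.exp (-(1 * a)) ≤ 1 := Real.exp_le_one_iff.mpr (by linarith)
  rw [← Set.compl_Iic, prob_compl_eq_one_sub measurableSet_Iic, ← ofReal_cdf,
    cdf_expMeasure_eq one_pos, if_pos ha, ← ENNReal.ofReal_one,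
    ← ENNReal.ofReal_sub _ (sub_nonneg.mpr exp_le_one)]
  ring_nf

/-- The probability that a Poisson process of rate `1` has exactly `k` points in an interval of
length `a`, extended by `0` to `a < 0`. -/
def poissonWeight (k : ℕ) (a : ℝ) : ℝ≥0∞ :=
  (Set.Ici 0).indicator (fun a => ENNReal.ofReal (a ^ k / k.factorial * Real.exp (-a))) a

theorem poissonWeight_of_nonneg {a : ℝ} (k : ℕ) (ha : 0 ≤ a) :
    poissonWeight k a = ENNReal.ofReal (a ^ k / k.factorial * Real.exp (-a)) :=
  Set.indicator_of_mem (Set.mem_Ici.mpr ha) _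

theorem poissonWeight_of_neg {a : ℝ} (k : ℕ) (ha : a < 0) : poissonWeight k a = 0 :=
  Set.indicator_of_notMem (Set.notMem_Ici.mpr ha) _

@[fun_prop]
theorem measurable_poissonWeight (k : ℕ) : Measurable (poissonWeight k) :=
  Measurable.indicator (by fun_prop) measurableSet_Ici

theorem integral_sub_pow_mul_exp_div_factorial (k : ℕ) (a : ℝ) :
    ∫ r in (0 : ℝ)..a, (a - r) ^ k / k.factorial * Real.exp (-a) =
      a ^ (k + 1) / (k + 1).factorial * Real.exp (-a) := by
  have : (k.factorial : ℝ) ≠ 0 := by positivity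
  have : (k : ℝ) + 1 ≠ 0 := by positivity
  rw [intervalIntegral.integral_mul_const, intervalIntegral.integral_div,
    intervalIntegral.integral_comp_sub_left (fun r => r ^ k) a, integral_pow, sub_self, sub_zero,
    zero_pow k.succ_ne_zero, Nat.factorial_succ]
  push_cast
  field_simp
  ring

theorem lintegral_poissonWeight_sub (k : ℕ) (a : ℝ) :
    ∫⁻ r, poissonWeight k (a - r) ∂(expMeasure 1) = poissonWeight (k + 1) a := by
  rw [lintegral_expMeasure_one (by fun_prop)]
  have integrand_eq (r : ℝ) : (Set.Ici 0).indicator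
      (fun r => ENNReal.ofReal (Real.exp (-r)) * poissonWeight k (a - r)) r =
      (Set.Icc 0 a).indicator
        (fun r => ENNReal.ofReal ((a - r) ^ k / k.factorial * Real.exp (-a))) r := by
    by_cases hr : 0 ≤ r
    · rw [Set.indicator_of_mem (Set.mem_Ici.mpr hr)]
      by_cases hra : r ≤ a
      · rw [Set.indicator_of_mem (Set.mem_Icc.mpr ⟨hr, hra⟩),
          poissonWeight_of_nonneg k (sub_nonneg.mpr hra), ← ENNReal.ofReal_mul (by positivity),
          mul_left_comm, ← Real.exp_add]
        ring_nf
      · rw [Set.indicator_of_notMem fun h => hra h.2, poissonWeight_of_neg k (by linarith),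
          mul_zero]
    · rw [Set.indicator_of_notMem (Set.notMem_Ici.mpr (not_le.mp hr)),
        Set.indicator_of_notMem fun h => hr h.1]
  simp_rw [integrand_eq]
  rw [lintegral_indicator measurableSet_Icc]
  rcases lt_or_ge a 0 with ha | ha
  · rw [Set.Icc_eq_empty (not_le.mpr ha), setLIntegral_empty, poissonWeight_of_neg _ ha]
  have cont : Continuous fun r : ℝ => (a - r) ^ k / k.factorial * Real.exp (-a) := by fun_prop
  rw [← ofReal_integral_eq_lintegral_ofReal cont.integrableOn_Icc, integral_Icc_eq_integral_Ioc,
    ← intervalIntegral.integral_of_le ha, integral_sub_pow_mul_exp_div_factorial,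
    poissonWeight_of_nonneg _ ha]
  filter_upwards [ae_restrict_mem measurableSet_Icc] with r hr
  have : 0 ≤ a - r := sub_nonneg.mpr hr.2
  positivity

/-- The law of a sequence of independent exponential waiting times with mean `1`. -/
abbrev waitingLaw : Measure (ℕ → ℝ) := Measure.infinitePi fun _ : ℕ => expMeasure 1

theorem ae_waiting_nonneg : ∀ᵐ τ ∂waitingLaw, ∀ i, 0 ≤ τ i := by
  refine ae_all_iff.mpr fun i => ?_
  refine ae_of_ae_map (f := fun τ : ℕ → ℝ => τ i) (p := fun r => 0 ≤ r)
    (measurable_pi_apply i).aemeasurable ?_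
  rw [Measure.infinitePi_map_eval, ae_iff]
  simp only [not_le]
  exact expMeasure_one_Iio_zero

/-- The time of the `n`-th jump, when the waiting times are `τ 0, τ 1, …`. -/
def jumpTime (n : ℕ) (τ : ℕ → ℝ) : ℝ := ∑ i ∈ Finset.range n, τ i

@[fun_prop]
theorem measurable_jumpTime (n : ℕ) : Measurable (jumpTime n) := by
  unfold jumpTime
  fun_prop

theorem jumpTime_zero (τ : ℕ → ℝ) : jumpTime 0 τ = 0 := Finset.sum_range_zero _

theorem jumpTime_succ (n : ℕ) (τ : ℕ → ℝ) : jumpTime (n + 1) τ = jumpTime n τ + τ n :=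
  Finset.sum_range_succ _ _

theorem map_jumpTime_prodMk (n : ℕ) :
    waitingLaw.map (fun τ => (jumpTime n τ, τ n)) =
      (waitingLaw.map (jumpTime n)).prod (expMeasure 1) := by
  have indep_waiting : iIndepFun (fun (i : ℕ) (τ : ℕ → ℝ) => τ i) waitingLaw :=
    iIndepFun_infinitePi (X := fun _ x => x) fun _ => measurable_id
  have indep_jumpTime : IndepFun (jumpTime n) (fun τ : ℕ → ℝ => τ n) waitingLaw := by
    convert indep_waiting.indepFun_sum_range_succ measurable_pi_apply n using 1
    ext τ
    rw [jumpTime, Finset.sum_apply]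
  rw [(indepFun_iff_map_prod_eq_prod_map_map (measurable_jumpTime n).aemeasurable
    (measurable_pi_apply n).aemeasurable).mp indep_jumpTime,
    Measure.infinitePi_map_eval (fun _ : ℕ => expMeasure 1) n]

theorem lintegral_jumpTime_succ {F : ℝ → ℝ≥0∞} (hF : Measurable F) (n : ℕ) :
    ∫⁻ τ, F (jumpTime (n + 1) τ) ∂waitingLaw =
      ∫⁻ τ, ∫⁻ r, F (jumpTime n τ + r) ∂(expMeasure 1) ∂waitingLaw := by
  have hF_add : Measurable fun p : ℝ × ℝ => F (p.1 + p.2) := by fun_prop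
  calc _ = ∫⁻ p, F (p.1 + p.2) ∂(waitingLaw.map fun τ => (jumpTime n τ, τ n)) := by
        rw [lintegral_map hF_add (by fun_prop)]
        simp_rw [jumpTime_succ]
    _ = _ := by
        rw [map_jumpTime_prodMk, lintegral_prod _ hF_add.aemeasurable,
          lintegral_map hF_add.lintegral_prod_right' (measurable_jumpTime n)]

theorem lintegral_poissonWeight_sub_jumpTime (n k : ℕ) (t : ℝ) :
    ∫⁻ τ, poissonWeight k (t - jumpTime n τ) ∂waitingLaw = poissonWeight (k + n) t := by
  induction n generalizing k with
  | zero => simp [jumpTime_zero]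
  | succ n ih =>
    rw [lintegral_jumpTime_succ (F := fun s => poissonWeight k (t - s)) (by fun_prop)]
    simp_rw [← sub_sub, lintegral_poissonWeight_sub]
    rw [ih, add_right_comm, add_assoc]

theorem waitingLaw_jumpTime_le_lt (n : ℕ) (t : ℝ) :
    waitingLaw {τ | jumpTime n τ ≤ t ∧ t < jumpTime (n + 1) τ} = poissonWeight n t := by
  have measurable_event : MeasurableSet {p : ℝ × ℝ | p.1 ≤ t ∧ t < p.1 + p.2} :=
    (measurableSet_le measurable_fst measurable_const).inter
      (measurableSet_lt measurable_const (measurable_fst.add measurable_snd))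
  have section_eq (s : ℝ) : expMeasure 1 (Prod.mk s ⁻¹' {p | p.1 ≤ t ∧ t < p.1 + p.2}) =
      poissonWeight 0 (t - s) := by
    rcases le_or_gt s t with hs | hs
    · have preimage_eq : Prod.mk s ⁻¹' {p : ℝ × ℝ | p.1 ≤ t ∧ t < p.1 + p.2} = Set.Ioi (t - s) := by
        ext r
        simp [hs, sub_lt_iff_lt_add']
      rw [preimage_eq, expMeasure_one_Ioi (sub_nonneg.mpr hs),
        poissonWeight_of_nonneg _ (sub_nonneg.mpr hs)]
      simp
    · rw [poissonWeight_of_neg _ (sub_neg.mpr hs)]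
      simp [hs.not_ge]
  calc _ = (waitingLaw.map fun τ => (jumpTime n τ, τ n)) {p | p.1 ≤ t ∧ t < p.1 + p.2} := by
        rw [Measure.map_apply (by fun_prop) measurable_event]
        simp_rw [jumpTime_succ]
        rfl
    _ = ∫⁻ τ, poissonWeight 0 (t - jumpTime n τ) ∂waitingLaw := by
        rw [map_jumpTime_prodMk, Measure.prod_apply measurable_event]
        simp_rw [section_eq]
        exact lintegral_map (by fun_prop) (measurable_jumpTime n)
    _ = _ := by rw [lintegral_poissonWeight_sub_jumpTime, zero_add]

theorem waitingLaw_jumpTime_le_le {t : ℝ} (ht : 0 ≤ t) (n : ℕ) :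
    waitingLaw {τ | jumpTime n τ ≤ t} ≤ ENNReal.ofReal (t ^ n / n.factorial) := by
  have exp_le : ∀ᵐ τ ∂waitingLaw, jumpTime n τ ≤ t →
      ENNReal.ofReal (Real.exp (-t)) ≤ poissonWeight 0 (t - jumpTime n τ) := by
    filter_upwards [ae_waiting_nonneg] with τ hτ hle
    have jumpTime_nonneg : 0 ≤ jumpTime n τ := Finset.sum_nonneg fun i _ => hτ i
    rw [poissonWeight_of_nonneg _ (sub_nonneg.mpr hle), pow_zero, Nat.factorial_zero,
      Nat.cast_one, div_one, one_mul]
    gcongr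
    linarith
  have markov := meas_ge_le_lintegral_div (μ := waitingLaw)
    (f := fun τ => poissonWeight 0 (t - jumpTime n τ)) (by fun_prop)
    (ENNReal.ofReal_pos.mpr (Real.exp_pos (-t))).ne' ENNReal.ofReal_ne_top
  rw [lintegral_poissonWeight_sub_jumpTime, zero_add, poissonWeight_of_nonneg _ ht,
    ← ENNReal.ofReal_div_of_pos (Real.exp_pos _), mul_div_cancel_right₀ _ (Real.exp_ne_zero _)]
    at markov
  exact (measure_mono_ae exp_le).trans markov

theorem ae_exists_lt_jumpTime {t : ℝ} (ht : 0 ≤ t) :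
    ∀ᵐ τ ∂waitingLaw, ∃ n, t < jumpTime n τ := by
  have tendsto_zero : Tendsto (fun n : ℕ => ENNReal.ofReal (t ^ n / n.factorial)) atTop
      (nhds 0) := by
    rw [← ENNReal.ofReal_zero]
    exact ENNReal.tendsto_ofReal (FloorSemiring.tendsto_pow_div_factorial_atTop t)
  rw [ae_iff]
  push Not
  refine le_antisymm (ge_of_tendsto' tendsto_zero fun n => ?_) zero_le
  exact (measure_mono fun τ (hτ : ∀ n, jumpTime n τ ≤ t) => hτ n).trans
    (waitingLaw_jumpTime_le_le ht n)

theorem jumpTime_jumpCount_le_lt {t : ℝ} (ht : 0 ≤ t) {τ : ℕ → ℝ} (hτ : ∀ i, 0 ≤ τ i)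
    (hex : ∃ n, t < jumpTime n τ) :
    jumpTime (jumpCount t τ) τ ≤ t ∧ t < jumpTime (jumpCount t τ + 1) τ := by
  classical
  have mono : Monotone fun n => jumpTime n τ :=
    monotone_nat_of_le_succ fun n => by
      rw [jumpTime_succ]
      linarith [hτ n]
  have exists_succ : ∃ n, t < jumpTime (n + 1) τ := hex.imp fun n hn => hn.trans_le (mono n.le_succ)
  have jumps_eq : {k : ℕ | jumpTime (k + 1) τ ≤ t} = Set.Iio (Nat.find exists_succ) := by
    ext k
    refine ⟨fun hk => ?_, fun hk => not_lt.mp (Nat.find_min exists_succ hk)⟩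
    by_contra hcon
    exact (Nat.find_spec exists_succ).not_ge
      ((mono (Nat.succ_le_succ (not_lt.mp hcon))).trans hk)
  have jumpCount_eq : jumpCount t τ = Nat.find exists_succ := by
    change {k : ℕ | jumpTime (k + 1) τ ≤ t}.ncard = _
    rw [jumps_eq, ← Finset.coe_range, Set.ncard_coe_finset, Finset.card_range]
  rw [jumpCount_eq]
  refine ⟨?_, Nat.find_spec exists_succ⟩
  rcases hn : Nat.find exists_succ with _ | n
  · rwa [jumpTime_zero]
  · exact not_lt.mp (Nat.find_min exists_succ (by lia))

theorem waitingLaw_jumpCount_eq_le {t : ℝ} (ht : 0 ≤ t) (n : ℕ) :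
    waitingLaw {τ | jumpCount t τ = n} ≤
      ENNReal.ofReal (t ^ n / n.factorial * Real.exp (-t)) := by
  rw [← poissonWeight_of_nonneg n ht, ← waitingLaw_jumpTime_le_lt n t]
  refine measure_mono_ae ?_
  filter_upwards [ae_waiting_nonneg, ae_exists_lt_jumpTime ht] with τ nonneg exists_lt
  rintro rfl
  exact jumpTime_jumpCount_le_lt ht nonneg exists_lt

end WaitingTimes

section Trajectory

open Kernel

variable {X : ℕ → Type*} [∀ n, MeasurableSpace (X n)] {μ₀ : Measure (X 0)}
  {κ : (n : ℕ) → Kernel (Π i : Finset.Iic n, X i) (X (n + 1))} [∀ n, IsMarkovKernel (κ n)]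

theorem map_eval_zero_trajMeasure : (trajMeasure μ₀ κ).map (fun z => z 0) = μ₀ := by
  have map_frestrictLe : (trajMeasure μ₀ κ).map (Preorder.frestrictLe 0) =
      μ₀.map (MeasurableEquiv.piUnique fun i : Finset.Iic 0 => X i).symm := by
    rw [trajMeasure, Measure.map_comp _ _ (by fun_prop), traj_map_frestrictLe, partialTraj_self,
      Measure.id_comp]
    rfl
  calc (trajMeasure μ₀ κ).map (fun z => z 0)
      = ((trajMeasure μ₀ κ).map (Preorder.frestrictLe 0)).map
          (MeasurableEquiv.piUnique fun i : Finset.Iic 0 => X i) := by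
        rw [Measure.map_map (by fun_prop) (by fun_prop)]
        rfl
    _ = μ₀ := by
        rw [map_frestrictLe]
        exact (MeasurableEquiv.piUnique fun i : Finset.Iic 0 => X i).map_map_symm

theorem trajMeasure_eval_succ_mem [IsProbabilityMeasure μ₀] (n : ℕ) {s : Set (X (n + 1))}
    (hs : MeasurableSet s) :
    trajMeasure μ₀ κ {z | z (n + 1) ∈ s} =
      ∫⁻ z, κ n (Preorder.frestrictLe n z) s ∂trajMeasure μ₀ κ := by
  calc trajMeasure μ₀ κ {z | z (n + 1) ∈ s}
      = (trajMeasure μ₀ κ).map (fun z => (Preorder.frestrictLe n z, z (n + 1)))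
          (Set.univ ×ˢ s) := by
        rw [Measure.map_apply (by fun_prop) (MeasurableSet.univ.prod hs), Set.mk_preimage_prod,
          Set.preimage_univ, Set.univ_inter]
        rfl
    _ = _ := by
        rw [← map_frestrictLe_trajMeasure_compProd_eq_map_trajMeasure,
          Measure.compProd_apply_prod MeasurableSet.univ hs, Measure.restrict_univ,
          lintegral_map (Kernel.measurable_coe _ hs) (by fun_prop)]

end Trajectory

section JumpChain

variable {V : Type*} {G : SimpleGraph V} [G.LocallyFinite] [MeasurableSpace V]
  [DiscreteMeasurableSpace V] {ω : Conductances G} {x y : V} {R : ℕ}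

/-- The law of the sequence of successive positions of the walk. -/
abbrev chainLaw (ω : Conductances G) (x : V) : Measure (ℕ → V) :=
  Kernel.trajMeasure (X := fun _ : ℕ => V) (Measure.dirac x) (jumpKernel ω)

theorem measurableSet_eval_eq (n : ℕ) (y : V) : MeasurableSet {z : ℕ → V | z n = y} :=
  measurable_pi_apply (X := fun _ : ℕ => V) n (MeasurableSet.of_discrete (s := {y}))

theorem chainLaw_zero_eq_zero (h : x ≠ y) : chainLaw ω x {z | z 0 = y} = 0 := by
  have map_eval := congrArg (fun μ => μ {y})
    (map_eval_zero_trajMeasure (X := fun _ : ℕ => V) (μ₀ := Measure.dirac x) (κ := jumpKernel ω))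
  rw [Measure.map_apply (by fun_prop) MeasurableSet.of_discrete,
    Measure.dirac_apply' _ MeasurableSet.of_discrete] at map_eval
  exact map_eval.trans (Set.indicator_of_notMem (Set.mem_singleton_iff.not.mpr h) _)

theorem walkLaw_walk_eq_le_tsum (ω : Conductances G) (x y : V) (t : ℝ) :
    walkLaw ω x {s | walk t s = y} ≤
      ∑' n : ℕ, chainLaw ω x {z | z n = y} * waitingLaw {τ | jumpCount t τ = n} := by
  have subset_iUnion : {s : (ℕ → V) × (ℕ → ℝ) | walk t s = y} ⊆
      ⋃ n : ℕ, {z : ℕ → V | z n = y} ×ˢ {τ : ℕ → ℝ | jumpCount t τ = n} := fun s hs =>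
    Set.mem_iUnion.mpr ⟨jumpCount t s.2, hs, rfl⟩
  calc _ ≤ _ := measure_mono subset_iUnion
    _ ≤ _ := measure_iUnion_le _
    _ = _ := tsum_congr fun n => Measure.prod_prod _ _

variable [Nontrivial V]

theorem jumpLaw_singleton (hG : G.Connected) (ω : Conductances G) (w y : V) :
    jumpLaw ω w {y} = ENNReal.ofReal (conductance ω w y / mu ω w) := by
  classical
  rw [jumpLaw, if_neg ((isWeight_conductance ω hG).pos w).ne', Measure.finsetSum_apply]
  simp only [Measure.smul_apply, smul_eq_mul, Measure.dirac_apply, Set.indicator,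
    Set.mem_singleton_iff, Pi.one_apply, mul_ite, mul_one, mul_zero, Finset.sum_ite_eq',
    SimpleGraph.mem_neighborFinset, ite_eq_left_iff]
  intro not_adj
  rw [conductance_of_not_adj ω not_adj, zero_div, ENNReal.ofReal_zero]

theorem chainLaw_succ (hG : G.Connected) (ω : Conductances G) (x y : V) (n : ℕ) :
    chainLaw ω x {z | z (n + 1) = y} = ∑ w ∈ G.neighborFinset y,
      chainLaw ω x {z | z n = w} * ENNReal.ofReal (conductance ω w y / mu ω w) := by
  classical
  have jumpLaw_eq_sum (z : ℕ → V) : jumpLaw ω (z n) {y} =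
      ∑ w ∈ G.neighborFinset y, ({z : ℕ → V | z n = w}).indicator
        (fun _ => ENNReal.ofReal (conductance ω w y / mu ω w)) z := by
    rw [jumpLaw_singleton hG]
    simp only [Set.indicator, Set.mem_ofPred_eq]
    rw [Finset.sum_ite_eq]
    simp only [SimpleGraph.mem_neighborFinset, left_eq_ite_iff]
    intro not_adj
    rw [conductance_of_not_adj ω fun h => not_adj h.symm, zero_div, ENNReal.ofReal_zero]
  calc chainLaw ω x {z | z (n + 1) = y} = ∫⁻ z, jumpLaw ω (z n) {y} ∂chainLaw ω x :=
        trajMeasure_eval_succ_mem (X := fun _ : ℕ => V) (μ₀ := Measure.dirac x) (κ := jumpKernel ω)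
          n (s := {y}) MeasurableSet.of_discrete
    _ = _ := by
        simp_rw [jumpLaw_eq_sum]
        rw [lintegral_finsetSum _ fun w _ =>
          measurable_const.indicator (measurableSet_eval_eq n w)]
        refine Finset.sum_congr rfl fun w _ => ?_
        rw [lintegral_indicator_const (measurableSet_eval_eq n w), mul_comm]

theorem chainLaw_eq_zero_of_notMem_ball (hG : G.Connected) (n : ℕ) (hy : y ∉ ball G x n) :
    chainLaw ω x {z | z n = y} = 0 := by
  induction n generalizing y with
  | zero => exact chainLaw_zero_eq_zero (ne_of_mem_of_not_mem (self_mem_ball hG x 0) hy)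
  | succ n ih =>
    rw [chainLaw_succ hG]
    refine Finset.sum_eq_zero fun w hw => ?_
    rw [ih, zero_mul]
    rw [mem_ball G hG] at hy ⊢
    have dist_eq_one := SimpleGraph.dist_eq_one_iff_adj.mpr ((G.mem_neighborFinset y w).mp hw).symm
    have := hG.dist_triangle (u := x) (v := w) (w := y)
    lia

theorem chainLaw_le_killedIter (hG : G.Connected) (ω : Conductances G) (x : V) (n : ℕ)
    (hn : n ≤ R) (y : V) :
    chainLaw ω x {z | z n = y} ≤
      ENNReal.ofReal (mu ω y * killedIter (conductance ω) (mu ω) (ball G x R) x n y) := by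
  have hw := isWeight_conductance ω hG
  have hx := self_mem_ball hG x R
  induction n generalizing y with
  | zero =>
    rcases eq_or_ne x y with rfl | hxy
    · rw [killedIter, if_pos rfl, mul_inv_cancel₀ (hw.pos x).ne', ENNReal.ofReal_one]
      exact prob_le_one
    · rw [chainLaw_zero_eq_zero hxy]
      exact zero_le
  | succ n ih =>
    by_cases hy : y ∈ ball G x R
    swap
    · rw [chainLaw_eq_zero_of_notMem_ball hG (n + 1) fun h => hy (ball_mono hG x hn h)]
      exact zero_le
    rw [chainLaw_succ hG, killedIter, if_pos hy, mul_div_cancel₀ _ (hw.pos y).ne',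
      ← sum_neighborFinset_eq (fun _ hz => conductance_of_not_adj ω hz)
        (fun _ hz => killedIter_of_notMem hx n hz),
      ENNReal.ofReal_sum_of_nonneg fun w _ =>
        mul_nonneg (hw.nonneg _ _) (killedIter_nonneg hw n w)]
    gcongr with w
    refine (mul_le_mul_left (ih (by lia) w) _).trans_eq ?_
    rw [← ENNReal.ofReal_mul (mul_nonneg (hw.pos w).le (killedIter_nonneg hw n w)),
      conductance_symm ω w y, mul_comm, ← mul_assoc, div_mul_cancel₀ _ (hw.pos w).ne']

theorem sum_chainLaw_mul_poisson_le (hG : G.Connected) (ω : Conductances G) (x y : V) {t : ℝ}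
    (ht : 0 ≤ t) (n : ℕ) (hn : n ≤ R) :
    ∑ k ∈ Finset.range n, chainLaw ω x {z | z k = y} *
        ENNReal.ofReal (t ^ k / k.factorial * Real.exp (-t)) ≤
      ENNReal.ofReal (mu ω y * killedKernel (conductance ω) (mu ω) (ball G x R) x t y) := by
  have hw := isWeight_conductance ω hG
  have iter_nonneg (k : ℕ) : 0 ≤ killedIter (conductance ω) (mu ω) (ball G x R) x k y :=
    killedIter_nonneg hw k y
  have mu_pos := hw.pos y
  calc _ ≤ ∑ k ∈ Finset.range n,
          ENNReal.ofReal (mu ω y * killedIter (conductance ω) (mu ω) (ball G x R) x k y) *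
            ENNReal.ofReal (t ^ k / k.factorial * Real.exp (-t)) := by
        gcongr with k hk
        exact chainLaw_le_killedIter hG ω x k ((Finset.mem_range.mp hk).le.trans hn) y
    _ = ENNReal.ofReal (mu ω y * (Real.exp (-t) * ∑ k ∈ Finset.range n, t ^ k / k.factorial *
          killedIter (conductance ω) (mu ω) (ball G x R) x k y)) := by
        rw [Finset.mul_sum, Finset.mul_sum, ENNReal.ofReal_sum_of_nonneg fun k _ => by
          have := iter_nonneg k
          positivity]
        refine Finset.sum_congr rfl fun k _ => ?_
        rw [← ENNReal.ofReal_mul (mul_nonneg mu_pos.le (iter_nonneg k))]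
        ring_nf
    _ ≤ _ := by
        rw [killedKernel]
        gcongr
        exact (summable_killedIter hw (self_mem_ball hG x R) t y).sum_le_tsum _
          fun k _ => mul_nonneg (by positivity) (iter_nonneg k)

theorem heatKernel_le_of_killedKernel_le (hG : G.Connected) {t B : ℝ} (ht : 0 ≤ t)
    (hB : ∀ n : ℕ, ∃ R : ℕ, n ≤ R ∧
      killedKernel (conductance ω) (mu ω) (ball G x R) x t y ≤ B) :
    heatKernel ω t x y ≤ B := by
  have hw := isWeight_conductance ω hG
  have mu_pos := hw.pos y
  have B_nonneg : 0 ≤ B := by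
    obtain ⟨R, _, hR⟩ := hB 0
    exact (killedKernel_nonneg hw ht y).trans hR
  rw [heatKernel, div_le_iff₀ mu_pos, mul_comm]
  refine ENNReal.toReal_le_of_le_ofReal (by positivity)
    ((walkLaw_walk_eq_le_tsum ω x y t).trans (ENNReal.tsum_le_of_sum_range_le fun n => ?_))
  obtain ⟨R, hnR, hR⟩ := hB n
  calc _ ≤ ∑ k ∈ Finset.range n, chainLaw ω x {z | z k = y} *
          ENNReal.ofReal (t ^ k / k.factorial * Real.exp (-t)) := by
        gcongr with k
        exact waitingLaw_jumpCount_eq_le ht k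
    _ ≤ _ := sum_chainLaw_mul_poisson_le hG ω x y ht n hnR
    _ ≤ _ := by gcongr

end JumpChain

section RegularityOfBalls

variable {V : Type*} {G : SimpleGraph V} [G.LocallyFinite] {d d' Creg CS : ℝ} {p q : ℝ≥0∞}
  {Mμ Mν : ℝ≥0} {N N₁ N₂ : V → ℝ} {ω : Conductances G} {x : V} {n : ℕ}

theorem VolumeRegular.pos (h : VolumeRegular G d Creg N₁) (hG : G.Connected) (hd : d ≠ 0)
    (x : V) : 0 < N₁ x := by
  by_contra! nonpos
  have card_le := (h x 0 (by simpa using nonpos)).2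
  rw [Nat.cast_zero, Real.zero_rpow hd, mul_zero] at card_le
  exact card_le.not_gt (Nat.cast_pos.mpr (Finset.card_pos.mpr ⟨x, self_mem_ball hG x 0⟩))

theorem AvgControlled.avgNorm_le {f : V → ℝ} {M : ℝ≥0} (h : AvgControlled G p f N)
    (hM : (⨆ x, limsupAvg G p f x) ≤ M) (hn : N x ≤ n) : avgNorm p (ball G x n) f ≤ 2 * M := by
  refine (ENNReal.ofReal_le_ofReal_iff (by positivity)).mp ((h x n hn).trans ?_)
  rw [ENNReal.ofReal_mul zero_le_two, ENNReal.ofReal_coe_nnreal, ENNReal.ofReal_ofNat]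
  gcongr
  exact (le_iSup (limsupAvg G p f) x).trans hM

theorem VolumeRegular.regularBall (hN₁ : VolumeRegular G d Creg N₁)
    (hN₂ : LocalSobolev G d d' CS N₂) (hμ : (⨆ x, limsupAvg G p (mu ω) x) ≤ Mμ)
    (hν : (⨆ x, limsupAvg G q (nu ω) x) ≤ Mν) (hNμ : AvgControlled G p (mu ω) N)
    (hNν : AvgControlled G q (nu ω) N) (hn : max (N x) (max (N₁ x) (N₂ x)) ≤ n) :
    RegularBall ω d d' Creg CS p q (2 * Mμ + 1) (2 * Mν + 1) x n where
  card_le := (hN₁ x n ((le_max_left _ _).trans ((le_max_right _ _).trans hn))).2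
  sobolev := hN₂ x n ((le_max_right _ _).trans ((le_max_right _ _).trans hn))
  avgNorm_mu_le := (hNμ.avgNorm_le hμ ((le_max_left _ _).trans hn)).trans (by linarith)
  avgNorm_nu_le := (hNν.avgNorm_le hν ((le_max_left _ _).trans hn)).trans (by linarith)

end RegularityOfBalls

section HeatKernel

variable {V : Type*} [Nontrivial V] [MeasurableSpace V] [DiscreteMeasurableSpace V]
  {G : SimpleGraph V} [G.LocallyFinite] {ω : Conductances G} {x y : V} {d γ g C₁ C₂ t : ℝ}

theorem OnDiagonalBound.heatKernel_self_le (hB : OnDiagonalBound ω x 1 d γ g C₁ C₂)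
    (hG : G.Connected) (ht : 0 ≤ t) : heatKernel ω t x x ≤ C₂ := by
  refine heatKernel_le_of_killedKernel_le hG ht fun n => ⟨n, le_rfl, ?_⟩
  calc _ ≤ (mu ω x)⁻¹ :=
        killedKernel_self_le (isWeight_conductance ω hG) (self_mem_ball hG x n) ht
    _ ≤ C₂ := by simpa using hB.inv_mu_le x (self_mem_ball hG x 1)

theorem heatKernel_le_of_dist_le_time (hG : G.Connected) (hd : 0 < d) (hγ : 0 ≤ γ) (hg : 0 ≤ g)
    (hC₁ : 0 ≤ C₁) (hC₂ : 0 ≤ C₂) (ht : 0 < t)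
    (hB : ∀ R : ℕ, √t ≤ R → OnDiagonalBound ω x R d γ g C₁ C₂) (hDt : (G.dist x y : ℝ) ≤ t) :
    heatKernel ω t x y ≤ (nearConst d γ g C₁ C₂ + C₂) * t ^ (-d / 2) *
      Real.exp (-((G.dist x y : ℝ) ^ 2 / t / 4096)) := by
  have nearConst_nonneg := nearConst_nonneg hd hγ hg hC₁ hC₂
  rcases le_or_gt 1 t with one_le | lt_one
  · refine (heatKernel_le_of_killedKernel_le hG ht.le
      (exists_ball_killedKernel_le_gaussian hG hd hγ hg hC₁ hC₂ one_le hB hDt)).trans ?_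
    gcongr
    linarith
  · have dist_eq_zero : G.dist x y = 0 := Nat.lt_one_iff.mp (by exact_mod_cast hDt.trans_lt lt_one)
    obtain rfl := hG.dist_eq_zero_iff.mp dist_eq_zero
    have one_le_rpow : 1 ≤ t ^ (-d / 2) :=
      Real.one_le_rpow_of_pos_of_le_one_of_nonpos ht lt_one.le (by linarith)
    have sqrt_le : √t ≤ (1 : ℕ) := by simpa using lt_one.le
    calc heatKernel ω t x x ≤ C₂ := (hB 1 sqrt_le).heatKernel_self_le hG ht.le
      _ ≤ nearConst d γ g C₁ C₂ + C₂ := by linarith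
      _ ≤ (nearConst d γ g C₁ C₂ + C₂) * t ^ (-d / 2) :=
        le_mul_of_one_le_right (by positivity) one_le_rpow
      _ = _ := by simp

theorem heatKernel_le_of_time_le_dist (hG : G.Connected) (hd : 0 ≤ d) (hg : 0 ≤ g)
    (hC₂ : 0 ≤ C₂) (ht : 0 < t)
    (hB : ∀ R : ℕ, √t ≤ R → OnDiagonalBound ω x R d γ g C₁ C₂) (htD : t ≤ G.dist x y) :
    heatKernel ω t x y ≤ farConst d g C₂ * t ^ (-d / 2) *
      Real.exp (-(1 / 16 * G.dist x y * max 1 (Real.log (G.dist x y / t)))) := by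
  have one_le_dist : (1 : ℝ) ≤ G.dist x y := by exact_mod_cast ht.trans_le htD
  have sqrt_le_dist : √t ≤ G.dist x y :=
    Real.sqrt_le_iff.mpr ⟨by positivity, htD.trans (le_self_pow₀ one_le_dist two_ne_zero)⟩
  exact heatKernel_le_of_killedKernel_le hG ht.le fun n => ⟨max n (G.dist x y), le_max_left _ _,
    (hB _ sqrt_le_dist).killedKernel_le_of_time_le_dist hG hd hg hC₂ ht htD (le_max_right _ _)⟩

end HeatKernel

end WeightedGraph

end

theorem theorem1p4_general {d d' Creg CS Mμ Mν : ℝ} (hd : 0 < d) (hd' : 2 ≤ d') (hCreg : 0 < Creg)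
    (hCS : 0 < CS) {p q : ℝ≥0∞} (hpq : p⁻¹ + q⁻¹ < ENNReal.ofReal (2 / d')) (hMμ : 0 < Mμ)
    (hMν : 0 < Mν) :
    ∃ c₁ c₂ c₃ c₄ : ℝ, 0 < c₁ ∧ 0 < c₂ ∧ 0 < c₃ ∧ 0 < c₄ ∧
      ∀ (V : Type*) [Nontrivial V] [MeasurableSpace V] [DiscreteMeasurableSpace V]
        (G : SimpleGraph V) [G.LocallyFinite], G.Connected →
      ∀ (ω : Conductances G) (t : ℝ) (x : V), 0 < t →
        (∀ R : ℕ, √t ≤ R → RegularBall ω d d' Creg CS p q Mμ Mν x R) →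
      ∀ y : V,
        ((G.dist x y : ℝ) ≤ c₁ * t →
          heatKernel ω t x y ≤
            c₂ * t ^ (-d / 2) * Real.exp (-c₃ * (G.dist x y : ℝ) ^ 2 / t)) ∧
        (c₁ * t ≤ (G.dist x y : ℝ) →
          heatKernel ω t x y ≤
            c₂ * t ^ (-d / 2) *
              Real.exp (-c₄ * (G.dist x y : ℝ) *
                max 1 (Real.log ((G.dist x y : ℝ) / t)))) := by
  obtain ⟨γ, g, C₁, C₂, hγ, hg, hC₁, hC₂, onDiagonal⟩ :=
    exists_onDiagonalBound hd hd' hCreg hCS hpq hMμ hMν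
  have near_nonneg := nearConst_nonneg hd hγ.le hg.le hC₁.le hC₂.le
  have far_nonneg := farConst_nonneg hd.le hg.le hC₂.le
  refine ⟨1, nearConst d γ g C₁ C₂ + farConst d g C₂ + C₂, 1 / 4096, 1 / 16, one_pos,
    by positivity, by norm_num, by norm_num, ?_⟩
  intro V _ _ _ G _ hG ω t x ht regular y
  have hB (R : ℕ) (hR : √t ≤ R) : OnDiagonalBound ω x R d γ g C₁ C₂ :=
    onDiagonal V G hG ω x R (Nat.cast_pos.mp ((Real.sqrt_pos.mpr ht).trans_le hR)) (regular R hR)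
  rw [one_mul]
  constructor
  · intro hDt
    refine (heatKernel_le_of_dist_le_time hG hd hγ.le hg.le hC₁.le hC₂.le ht hB hDt).trans ?_
    gcongr ?_ * _ * Real.exp ?_
    · linarith
    · exact le_of_eq (by ring)
  · intro htD
    refine (heatKernel_le_of_time_le_dist hG hd.le hg.le hC₂.le ht hB htD).trans ?_
    gcongr ?_ * _ * Real.exp ?_
    · linarith
    · exact le_of_eq (by ring)

theorem theorem1p4 (d d' Creg CS : ℝ) (hd : 2 ≤ d) (hd' : d ≤ d') (hCreg : 0 < Creg) (hCS : 0 < CS)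
    (p q : ℝ≥0∞) (hp : 1 < p) (hq : 1 < q) (hpq : p⁻¹ + q⁻¹ < ENNReal.ofReal (2 / d'))
    (Mμ Mν : ℝ≥0) :
    ∃ c₁ c₂ c₃ c₄ : ℝ, 0 < c₁ ∧ 0 < c₂ ∧ 0 < c₃ ∧ 0 < c₄ ∧
      ∀ (V : Type*) [Infinite V] [MeasurableSpace V] [DiscreteMeasurableSpace V]
        (G : SimpleGraph V) [G.LocallyFinite], G.Connected →
      ∀ N₁ N₂ : V → ℝ, VolumeRegular G d Creg N₁ → LocalSobolev G d d' CS N₂ →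
      ∀ ω : Conductances G,
        (⨆ x, limsupAvg G p (mu ω) x) ≤ Mμ → (⨆ x, limsupAvg G q (nu ω) x) ≤ Mν →
      ∀ N : V → ℝ, AvgControlled G p (mu ω) N → AvgControlled G q (nu ω) N →
      ∀ (t : ℝ) (x : V), max (N x) (2 * max (N₁ x) (N₂ x)) ≤ √t →
      ∀ y : V,
        ((G.dist x y : ℝ) ≤ c₁ * t →
          heatKernel ω t x y ≤
            c₂ * t ^ (-d / 2) * Real.exp (-c₃ * (G.dist x y : ℝ) ^ 2 / t)) ∧
        (c₁ * t ≤ (G.dist x y : ℝ) →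
          heatKernel ω t x y ≤
            c₂ * t ^ (-d / 2) *
              Real.exp (-c₄ * (G.dist x y : ℝ) *
                max 1 (Real.log ((G.dist x y : ℝ) / t)))) := by
  obtain ⟨c₁, c₂, c₃, c₄, hc₁, hc₂, hc₃, hc₄, bound⟩ := theorem1p4_general (d := d)
    (Mμ := 2 * Mμ + 1) (Mν := 2 * Mν + 1) (by linarith) (hd.trans hd') hCreg hCS hpq
    (by positivity) (by positivity)
  refine ⟨c₁, c₂, c₃, c₄, hc₁, hc₂, hc₃, hc₄, ?_⟩
  intro V _ _ _ G _ hG N₁ N₂ hN₁ hN₂ ω hμ hν N hNμ hNν t x htx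
  have N₁_pos := hN₁.pos hG (by linarith) x
  obtain ⟨N_le, N₁₂_le⟩ := max_le_iff.mp htx
  have max_pos : 0 < max (N₁ x) (N₂ x) := lt_max_of_lt_left N₁_pos
  exact bound V G hG ω t x (Real.sqrt_pos.mp (by linarith)) fun R hR =>
    hN₁.regularBall hN₂ hμ hν hNμ hNν (max_le (N_le.trans hR) (by linarith))
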